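/- Let $n\ge 0$, let $t\in\mathbb C$, and let $x_1,\dots,x_n$, $y_1,\dots,y_n$ be complex numbers; write $\bar x:=1/x$. Partitions $\lambda=(\lambda_1\ge\dots\ge\lambda_n\ge 0)$ have exactly $n$ parts, zero parts being allowed and counted, $m_j(\lambda)=\#\{k:\lambda_k=j\}$ for $j\ge 0$, and $$b_\lambda(t)=\prod_{j\ge 1}\prod_{i=1}^{m_j(\lambda)}(1-t^i).$$ Let $S_n^\lambda\subseteq S_n$ be the stabilizer of $\lambda$, and let $$P_\lambda(y_1,\dots,y_n;t)=\sum_{\sigma\in S_n/S_n^\lambda}\sigma\Big(\prod_{i=1}^n y_i^{\lambda_i}\prod_{\lambda_i>\lambda_j}\frac{y_i-ty_j}{y_i-y_j}\Big)$$ be the Hall--Littlewood polynomial and $$K_\lambda(x_1^{\pm1},\dots,x_n^{\pm1};t)=\sum_{\omega\in (S_n/S_n^\lambda)\ltimes\{\pm1\}^n}\omega\Big(\prod_{i=1}^n\frac{x_i^{\lambda_i}}{1-\bar x_i^2}\prod_{\lambda_i>\lambda_j}\frac{x_i-tx_j}{x_i-x_j}\prod_{1\le i<j\le n}\frac{1-t\bar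 x_i\bar x_j}{1-\bar x_i\bar x_j}\Big)$$ the $BC_n$ (hyperoctahedral) Hall--Littlewood polynomial, where signed permutations act by permuting and inverting the $x_i$. Assume that all denominators that occur here and below are nonzero, that is, $x_i\ne0$, $x_i^2\neq 1$, $tx_iy_j\ne1$ and $t\bar x_iy_j\neq 1$ for all $i,j$, and $x_i\ne x_j$, $x_ix_j\neq 1$, $y_i\ne y_j$, $ty_iy_j\ne 1$ for $i<j$, and assume that $|x_iy_j|<1$ and $|\bar x_iy_j|<1$ for all $i,j$. Put $$D=\frac{\prod_{i,j=1}^n(1-tx_iy_j)(1-t\bar x_iy_j)}{\prod_{1\le i<j\le n}(x_i-x_j)(y_i-y_j)(1-\bar x_i\bar x_j)(1-ty_iy_j)}\;\det_{1\le i,j\le n}\left[\frac{1-t}{(1-x_iy_j)(1-\bar x_iy_j)(1-tx_iy_j)(1-t\bar x_iy_j)}\right].$$ Then the following series over all partitions with exactly $n$ parts converges absolutely, and $$\sum_\lambda\ \prod_{i=1}^{m_0(\lambda)}(1-t^i)\; b_\lambda(t)\,K_\lambda(x_1^{\pm1},\dots,x_n^{\pm1};t)\,P_\lambda(y_1,\dots,y_n;t)=D.$$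 Moreover, $D$ is the normalized partition function of the six-vertex model with a U-turn boundary: $$Z_{\rm U}=\prod_{i=1}^n(x_i-t\bar x_i)\,y_i\cdot D.$$ Here $Z_{\rm U}$ is the sum of the weights of all hole/particle configurations on the edges of the lattice with $2n$ rows, with parameters $x_1,\bar x_1,\dots,x_n,\bar x_n$ from top to bottom, and $n$ columns, with parameters $\bar y_n,\dots,\bar y_1$ from left to right, with holes on the top edges and particles on the bottom and on the right edges. The weight of a configuration is the product of its vertex weights and its U-turn weights. With $0$ for a hole, $1$ for a particle, and $z$ the row parameter divided by the column parameter, a vertex with (left, right, bottom, top) edges $(0,0,0,0)$ or $(1,1,1,1)$ has weight $\frac{1-tz}{1-z}$; $(0,0,1,1)$ has weight $t$; $(1,1,0,0)$ has weight $1$; $(0,1,1,0)$ has weight $\frac{(1-t)z}{1-z}$; $(1,0,0,1)$ has weight $\frac{1-t}{1-z}$; all others have weight $0$. The left ends of the rows $x_i$ and $\bar x_i$ are joined by a U-turn, of weight $1$ if the edge of row $x_i$ is a hole and that of row $\bar x_i$ is a particle, $-t$ if the edge of row $x_i$ is a particle and that of row $\bar x_i$ is a hole, and $0$ otherwise. 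-/

import Mathlib

open scoped BigOperators

noncomputable section

namespace ReflCauchy

/-- Partitions with exactly `n` parts, parts of size zero being allowed and counted:
weakly decreasing sequences `lam 0 ≥ lam 1 ≥ … ≥ lam (n - 1) ≥ 0`. -/
def Part (n : ℕ) : Type := {lam : Fin n → ℕ // Antitone lam}

/-- The multiplicity `m_j(lam) = #{k : lam_k = j}`; for `j = 0` it counts the zero parts. -/
def mult {n : ℕ} (lam : Fin n → ℕ) (j : ℕ) : ℕ :=
  (Finset.univ.filter fun k => lam k = j).card

/-- `b_lam(t) = ∏_{j ≥ 1} ∏_{i = 1}^{m_j(lam)} (1 - t ^ i)`. The outer product runs over the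
`j ≥ 1` that occur as parts; for every other `j` the inner product is empty. -/
def bFactor {n : ℕ} (t : ℂ) (lam : Fin n → ℕ) : ℂ :=
  ∏ j ∈ (Finset.univ.image lam).filter (fun j => 1 ≤ j),
    ∏ i ∈ Finset.Icc 1 (mult lam j), (1 - t ^ i)

/-- The orbit `{lam ∘ σ : σ ∈ S_n}` of distinct rearrangements of `lam`. It is a model of the
coset space `S_n / S_n^lam`, where `S_n^lam` is the stabilizer of `lam`. -/
def orbit {n : ℕ} (lam : Fin n → ℕ) : Finset (Fin n → ℕ) :=
  Finset.univ.image fun σ : Equiv.Perm (Fin n) => lam ∘ σ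

/-- `∏_i x_i ^ (a_i) ∏_{i, j : a_i > a_j} (x_i - t x_j) / (x_i - x_j)`. When `a` is the
rearrangement of `lam` with `a_{σ(i)} = lam_i`, this is the image under `x_i ↦ x_{σ(i)}` of the
same expression for `lam`. -/
def hlTerm {n : ℕ} (t : ℂ) (x : Fin n → ℂ) (a : Fin n → ℕ) : ℂ :=
  (∏ i, x i ^ a i) *
    ∏ i, ∏ j ∈ Finset.univ.filter (fun j => a j < a i), (x i - t * x j) / (x i - x j)

/-- The (type `A`) Hall--Littlewood polynomial `P_lam(x_1, …, x_n; t)`, as the sum over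
`σ ∈ S_n / S_n^lam` of
`σ (∏_i x_i ^ lam_i ∏_{lam_i > lam_j} (x_i - t x_j) / (x_i - x_j))`,
at pairwise distinct `x_i`. -/
def hallLittlewoodP {n : ℕ} (t : ℂ) (lam : Fin n → ℕ) (x : Fin n → ℂ) : ℂ :=
  ∑ a ∈ orbit lam, hlTerm t x a

/-- The point obtained from `x` by inverting the coordinates selected by `e ∈ {±1}^n`
(`true` means: invert). -/
def signFlip {n : ℕ} (e : Fin n → Bool) (x : Fin n → ℂ) : Fin n → ℂ :=
  fun i => if e i then (x i)⁻¹ else x i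

/-- `∏_i 1 / (1 - x_i⁻²) ∏_{i < j} (1 - t x_i⁻¹ x_j⁻¹) / (1 - x_i⁻¹ x_j⁻¹)`, an expression
that is symmetric in the `x_i`. -/
def bcFactor {n : ℕ} (t : ℂ) (x : Fin n → ℂ) : ℂ :=
  (∏ i, 1 / (1 - (x i)⁻¹ ^ 2)) *
    ∏ i, ∏ j ∈ Finset.univ.filter (fun j => i < j),
      (1 - t * (x i)⁻¹ * (x j)⁻¹) / (1 - (x i)⁻¹ * (x j)⁻¹)

/-- The hyperoctahedral (type `BC`) Hall--Littlewood polynomial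
`K_lam(x_1^{±1}, …, x_n^{±1}; t)`, as the sum over the signed permutations
`ω ∈ (S_n / S_n^lam) ⋉ {±1}^n` of
`ω (∏_i x_i ^ lam_i / (1 - x_i⁻²) ∏_{lam_i > lam_j} (x_i - t x_j) / (x_i - x_j)
  ∏_{i < j} (1 - t x_i⁻¹ x_j⁻¹) / (1 - x_i⁻¹ x_j⁻¹))`. -/
def hallLittlewoodK {n : ℕ} (t : ℂ) (lam : Fin n → ℕ) (x : Fin n → ℂ) : ℂ :=
  ∑ e : Fin n → Bool, ∑ a ∈ orbit lam,
    hlTerm t (signFlip e x) a * bcFactor t (signFlip e x)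

/-- The determinantal right-hand side. -/
def reflectingDet {n : ℕ} (t : ℂ) (x y : Fin n → ℂ) : ℂ :=
  (∏ i, ∏ j, (1 - t * x i * y j) * (1 - t * (x i)⁻¹ * y j)) /
    (∏ i, ∏ j ∈ Finset.univ.filter (fun j => i < j),
      (x i - x j) * (y i - y j) * (1 - (x i)⁻¹ * (x j)⁻¹) * (1 - t * y i * y j)) *
    Matrix.det (Matrix.of fun i j : Fin n =>
      (1 - t) / ((1 - x i * y j) * (1 - (x i)⁻¹ * y j) *
        (1 - t * x i * y j) * (1 - t * (x i)⁻¹ * y j)))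

/-- Six-vertex Boltzmann weights. `l r b u` are the states of the left, right, bottom and top
edges of a vertex (`true` a particle, `false` a hole); `z` is the ratio of the horizontal and the
vertical spectral parameters. All other edge states have weight `0`. -/
def sixVertexWeight (t z : ℂ) (l r b u : Bool) : ℂ :=
  match l, r, b, u with
  | false, false, false, false => (1 - t * z) / (1 - z)
  | true, true, true, true => (1 - t * z) / (1 - z)
  | false, false, true, true => t
  | true, true, false, false => 1
  | false, true, true, false => (1 - t) * z / (1 - z)
  | true, false, false, true => (1 - t) / (1 - z)
  | _, _, _, _ => 0

/-- Weights of the U-turn joining the left ends of two consecutive rows, with the states of the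
upper and of the lower row: hole above particle has weight `1`, particle above hole `-t`. -/
def uTurnWeight (t : ℂ) (upper lower : Bool) : ℂ :=
  match upper, lower with
  | false, true => 1
  | true, false => -t
  | _, _ => 0

/-- Row `2 i` of the double row `i`, on which the spectral parameter is `x_i`. -/
def upperRow {n : ℕ} (i : Fin n) : Fin (2 * n) := ⟨2 * i.val, by omega⟩

/-- Row `2 i + 1` of the double row `i`, on which the spectral parameter is `x_i⁻¹`. -/
def lowerRow {n : ℕ} (i : Fin n) : Fin (2 * n) := ⟨2 * i.val + 1, by omega⟩

/-- The partition function of the six-vertex model with a reflecting (U-turn) left boundary.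
The lattice has `2 n` rows, which carry from top to bottom the parameters
`x_1, x_1⁻¹, …, x_n, x_n⁻¹`, and `n` columns, which carry from left to right the parameters
`y_n⁻¹, …, y_1⁻¹`. A configuration consists of the horizontal edges `h r c` (row `r`,
numbered from the left by `c = 0, …, n`) and of the vertical edges `v r c` (column `c`, numbered
from the top by `r = 0, …, 2 n`); the vertex in row `r` and column `c` has left edge `h r c`,
right edge `h r (c + 1)`, top edge `v r c` and bottom edge `v (r + 1) c`. The top edges are
holes, the bottom and the right edges are particles. -/
def uTurnPartitionFunction {n : ℕ} (t : ℂ) (x y : Fin n → ℂ) : ℂ :=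
  ∑ h : Fin (2 * n) → Fin (n + 1) → Bool, ∑ v : Fin (2 * n + 1) → Fin n → Bool,
    if (∀ c, v 0 c = false) ∧ (∀ c, v (Fin.last (2 * n)) c = true) ∧
        (∀ r, h r (Fin.last n) = true) then
      ∏ i : Fin n,
        (uTurnWeight t (h (upperRow i) 0) (h (lowerRow i) 0) *
          ∏ c : Fin n,
            (sixVertexWeight t (x i * y c.rev)
                (h (upperRow i) c.castSucc) (h (upperRow i) c.succ)
                (v (upperRow i).succ c) (v (upperRow i).castSucc c) *
              sixVertexWeight t ((x i)⁻¹ * y c.rev)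
                (h (lowerRow i) c.castSucc) (h (lowerRow i) c.succ)
                (v (lowerRow i).succ c) (v (lowerRow i).castSucc c)))
    else 0

end ReflCauchy

end

open scoped BigOperators

noncomputable section

namespace ReflCauchy

/-! The series, the determinant and the lattice sum are all compared with one quantity,
`signedDomainWall`: the sum over all choices of signs of `bcFactor` times the domain wall partition
function `domainWall`, taken at the row parameters with the chosen ones inverted.

Series. `hallLittlewoodK` is a sum over signs of `bcFactor` times a type A polynomial, so the series
reduces to a refined type A Cauchy identity with value `domainWall` (`tsum_pairTerm_eq_domainWall`).
Removing the first column of the Young diagram of λ expresses the Cauchy sum for variable sets S, T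
through the sums for subsets S', T', the sets of variables whose exponent is positive
(`tsum_pairTerm_rec`). The domain wall function has the same expansion (`domainWall_eq_peel`), which
follows by turning zero column parameters into the y's one at a time and comparing partial fractions
(`peel_insert`). By induction on the size, the difference of the two sides equals itself times the
product of all x's and y's, a number of modulus less than one, so it vanishes.

Determinant. The weights that couple a row w to another row v combine into a function of v + 1/v, so
the remaining sign sum factors out and `signedDomainWall` obeys a recursion in its first column
parameter z, with one term for each pole z = 1/w (`signedDomainWall_cons`). The determinant obeys
the same recursion (`reflectingDet_cons`): expand along the first column; equal columns make the
numerator vanish at z = y_j, the symmetry z ↦ 1/(tz) gives the second root, and after division by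
these factors the degree is low enough for Lagrange interpolation at the nodes x_i, 1/x_i
(`sum_eq_sum_node_poles`).

Lattice. Rows are operators with quadratic exchange relations (`rowOp_relations`). As in the
algebraic Bethe ansatz, a double row acting on a created state gives two wanted terms, one for each
sign of its parameter, and unwanted terms. The latter cancel in pairs under flipping one earlier
sign (`sum_doubleRowCoeff_eq_zero`), so the lattice state is a signed sum of ordinary created states
(`doubleRowState_eq`), whose top component is a domain wall function (`rowState_apply_true`). -/

/-- The partition function of the six-vertex model with domain wall boundary conditions, up to
normalization, for the row parameters `x i` (`i ∈ S`) and a list of column parameters. It is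
defined by its recursion in the first column parameter. -/
def domainWall {ι : Type*} [DecidableEq ι] (t : ℂ) (x : ι → ℂ) : List ℂ → Finset ι → ℂ
  | [], S => if S = ∅ then 1 else 0
  | y :: L, S => ∑ i ∈ S, (1 - t) / (1 - x i * y) *
      (∏ k ∈ S.erase i, (x i - t * x k) / (x i - x k)) *
      (L.map fun z => (1 - t * x i * z) / (1 - x i * z)).prod * domainWall t x L (S.erase i)

/-! ### Symmetry and recursions of the domain wall partition function. -/

section DomainWall

variable {ι : Type*} [DecidableEq ι] {t : ℂ} {x : ι → ℂ}

theorem domainWall_nil (S : Finset ι) : domainWall t x [] S = if S = ∅ then 1 else 0 := rfl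

theorem domainWall_cons (y : ℂ) (L : List ℂ) (S : Finset ι) :
    domainWall t x (y :: L) S = ∑ i ∈ S, (1 - t) / (1 - x i * y) *
      (∏ k ∈ S.erase i, (x i - t * x k) / (x i - x k)) *
      (L.map fun z => (1 - t * x i * z) / (1 - x i * z)).prod *
        domainWall t x L (S.erase i) := rfl

theorem domainWall_eq_zero_of_card_ne :
    ∀ (L : List ℂ) (S : Finset ι), S.card ≠ L.length → domainWall t x L S = 0
  | [], S, h => by
      rw [domainWall_nil, if_neg]
      rintro rfl
      simp at h
  | y :: L, S, h => by
      rw [domainWall_cons]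
      refine Finset.sum_eq_zero fun i hi => ?_
      rw [domainWall_eq_zero_of_card_ne L, mul_zero]
      rw [Finset.card_erase_of_mem hi]
      have := Finset.card_pos.2 ⟨i, hi⟩
      simp only [List.length_cons] at h
      omega

theorem sum_erase_comm (S : Finset ι) (F : ι → ι → ℂ) :
    ∑ i ∈ S, ∑ k ∈ S.erase i, F i k = ∑ i ∈ S, ∑ k ∈ S.erase i, F k i := by
  refine Finset.sum_comm' fun i k => ?_
  simp only [Finset.mem_erase]
  tauto

theorem sum_erase_congr_of_symm (S : Finset ι) (F G : ι → ι → ℂ)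
    (h : ∀ i ∈ S, ∀ k ∈ S, i ≠ k → F i k + F k i = G i k + G k i) :
    ∑ i ∈ S, ∑ k ∈ S.erase i, F i k = ∑ i ∈ S, ∑ k ∈ S.erase i, G i k := by
  have key : ∑ i ∈ S, ∑ k ∈ S.erase i, (F i k + F k i)
      = ∑ i ∈ S, ∑ k ∈ S.erase i, (G i k + G k i) := by
    refine Finset.sum_congr rfl fun i hi => Finset.sum_congr rfl fun k hk => ?_
    rw [Finset.mem_erase] at hk
    exact h i hi k hk.2 (Ne.symm hk.1)
  simp only [Finset.sum_add_distrib] at key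
  rw [← sum_erase_comm S F, ← sum_erase_comm S G] at key
  linear_combination key / 2

/-- The two-row, two-column case of the symmetry in the column parameters, stripped of common
factors; the general case reduces to it. -/
theorem domainWall_exchange_scalar {t a b y z : ℂ} (hab : a ≠ b) (hay : 1 - a * y ≠ 0)
    (haz : 1 - a * z ≠ 0) (hby : 1 - b * y ≠ 0) (hbz : 1 - b * z ≠ 0) :
    1 / (1 - a * y) * ((a - t * b) / (a - b)) * ((1 - t * a * z) / (1 - a * z)) *
          (1 / (1 - b * z)) +
        1 / (1 - b * y) * ((b - t * a) / (b - a)) * ((1 - t * b * z) / (1 - b * z)) *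
          (1 / (1 - a * z)) =
      1 / (1 - a * z) * ((a - t * b) / (a - b)) * ((1 - t * a * y) / (1 - a * y)) *
          (1 / (1 - b * y)) +
        1 / (1 - b * z) * ((b - t * a) / (b - a)) * ((1 - t * b * y) / (1 - b * y)) *
          (1 / (1 - a * y)) := by
  have h1 : a - b ≠ 0 := sub_ne_zero.2 hab
  have h2 : b - a ≠ 0 := sub_ne_zero.2 hab.symm
  have h3 : (b - t * a) / (b - a) = (t * a - b) / (a - b) := by
    rw [div_eq_div_iff h2 h1]; ring
  have hby' : 1 - y * b ≠ 0 := by rwa [mul_comm]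
  have hbz' : 1 - z * b ≠ 0 := by rwa [mul_comm]
  rw [h3]
  field_simp
  ring

/-- After two steps of the recursion the sum runs over ordered pairs of rows. Adding the terms for
(i, k) and (k, i), all factors involving other rows or columns are common, and the two-row identity
remains. -/
theorem domainWall_swap {S : Finset ι} (hx : ∀ i ∈ S, ∀ k ∈ S, i ≠ k → x i ≠ x k) {y z : ℂ}
    (hy : ∀ i ∈ S, 1 - x i * y ≠ 0) (hz : ∀ i ∈ S, 1 - x i * z ≠ 0) (L : List ℂ) :
    domainWall t x (y :: z :: L) S = domainWall t x (z :: y :: L) S := by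
  simp only [domainWall_cons, Finset.mul_sum]
  refine sum_erase_congr_of_symm S _ _ fun i hi k hk hik => ?_
  have hki : k ∈ S.erase i := Finset.mem_erase.2 ⟨hik.symm, hk⟩
  have hik' : i ∈ S.erase k := Finset.mem_erase.2 ⟨hik, hi⟩
  rw [← Finset.mul_prod_erase _ _ hki, ← Finset.mul_prod_erase _ _ hik',
    Finset.erase_right_comm (a := k) (b := i)]
  have e := domainWall_exchange_scalar (t := t) (hx i hi k hk hik) (hy i hi) (hz i hi) (hy k hk)
    (hz k hk)
  simp only [List.map_cons, List.prod_cons]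
  linear_combination ((1 - t) ^ 2 *
    (∏ m ∈ (S.erase i).erase k, (x i - t * x m) / (x i - x m)) *
    (∏ m ∈ (S.erase i).erase k, (x k - t * x m) / (x k - x m)) *
    (L.map fun z => (1 - t * x i * z) / (1 - x i * z)).prod *
    (L.map fun z => (1 - t * x k * z) / (1 - x k * z)).prod *
    domainWall t x L ((S.erase i).erase k)) * e

theorem domainWall_perm {L L' : List ℂ} (h : L.Perm L') :
    ∀ {S : Finset ι}, (∀ i ∈ S, ∀ k ∈ S, i ≠ k → x i ≠ x k) →
      (∀ i ∈ S, ∀ y ∈ L, 1 - x i * y ≠ 0) → domainWall t x L S = domainWall t x L' S := by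
  induction h with
  | nil => intros; rfl
  | cons y h ih =>
    intro S hx hy
    rw [domainWall_cons, domainWall_cons]
    refine Finset.sum_congr rfl fun i hi => ?_
    rw [ih (fun a ha b hb => hx a (Finset.mem_of_mem_erase ha) b (Finset.mem_of_mem_erase hb))
      (fun a ha z hz => hy a (Finset.mem_of_mem_erase ha) z (List.mem_cons_of_mem _ hz)),
      (h.map _).prod_eq]
  | swap y z L =>
    intro S hx hy
    exact domainWall_swap hx (fun i hi => hy i hi _ (by simp)) (fun i hi => hy i hi _ (by simp)) L
  | trans h1 h2 ih1 ih2 =>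
    intro S hx hy
    rw [ih1 hx hy, ih2 hx fun i hi y hy' => hy i hi y (h1.mem_iff.2 hy')]

/-- Exchanging the order in which two rows are removed turns the recursion in the first column into
one in the last. This is the form in which the lattice produces the function; it needs no symmetry,
hence no hypotheses on the parameters. -/
theorem domainWall_append_singleton (y : ℂ) : ∀ (L : List ℂ) (S : Finset ι),
    domainWall t x (L ++ [y]) S = ∑ i ∈ S, (1 - t) / (1 - x i * y) *
      (∏ k ∈ S.erase i, (x k - t * x i) / (x k - x i) * ((1 - t * x k * y) / (1 - x k * y))) *
        domainWall t x L (S.erase i)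
  | [], S => by
      rw [List.nil_append, domainWall_cons]
      refine Finset.sum_congr rfl fun i _ => ?_
      by_cases h : S.erase i = ∅
      · simp [h]
      · simp [domainWall_nil, h]
  | z :: L, S => by
      rw [List.cons_append, domainWall_cons]
      simp only [domainWall_append_singleton y L, domainWall_cons, Finset.mul_sum]
      rw [sum_erase_comm]
      refine Finset.sum_congr rfl fun i hi => Finset.sum_congr rfl fun k hk => ?_
      have hik : i ≠ k := (Finset.ne_of_mem_erase hk).symm
      have hik' : i ∈ S.erase k := Finset.mem_erase.2 ⟨hik, hi⟩
      rw [← Finset.mul_prod_erase _ _ hk, ← Finset.mul_prod_erase _ _ hik',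
        Finset.erase_right_comm (a := k) (b := i)]
      simp only [List.map_append, List.prod_append, List.map_cons, List.map_nil, List.prod_cons,
        List.prod_nil]
      ring

theorem domainWall_map {κ : Type*} [DecidableEq κ] (f : κ ↪ ι) :
    ∀ (L : List ℂ) (S : Finset κ),
      domainWall t x L (S.map f) = domainWall t (fun i => x (f i)) L S
  | [], S => by simp [domainWall_nil]
  | y :: L, S => by
      rw [domainWall_cons, domainWall_cons, Finset.sum_map]
      refine Finset.sum_congr rfl fun i _ => ?_
      rw [← Finset.map_erase, domainWall_map f L, Finset.prod_map]

end DomainWall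

/-! ### Finite q-products and partial fractions. -/

/-- `∏_{i = 1}^m (1 - t ^ i)`. -/
def qFactorial (t : ℂ) (m : ℕ) : ℂ := ∏ i ∈ Finset.Icc 1 m, (1 - t ^ i)

theorem qFactorial_zero (t : ℂ) : qFactorial t 0 = 1 := by simp [qFactorial]

theorem qFactorial_succ (t : ℂ) (m : ℕ) :
    qFactorial t (m + 1) = qFactorial t m * (1 - t ^ (m + 1)) := by
  rw [qFactorial, qFactorial, Finset.prod_Icc_succ_top (by omega)]

/-- `∏_{i ∈ S', k ∈ S \ S'} (x_i - t x_k) / (x_i - x_k)`. -/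
def splitFactor {ι : Type*} [DecidableEq ι] (t : ℂ) (x : ι → ℂ) (S S' : Finset ι) : ℂ :=
  ∏ i ∈ S', ∏ k ∈ S \ S', (x i - t * x k) / (x i - x k)

section PartialFractions

variable {κ : Type*} [DecidableEq κ] {t : ℂ} {y : κ → ℂ}

/-- Partial fractions in `z`, normalized by the value at `z = 1 / a` in place of the value at
infinity; `a = 0` gives the usual form with constant term 1. The free parameter is later set to a
row parameter, so that `1 - a * z` clears a denominator. -/
theorem prod_sub_prod_eq_sum_poles (hy : Function.Injective y) {a : ℂ} (ha : ∀ j, 1 - a * y j ≠ 0)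
    (U : Finset κ) : ∀ z : ℂ, (∀ j ∈ U, z ≠ y j) →
    ∏ j ∈ U, (z - t * y j) / (z - y j) =
      ∏ j ∈ U, (1 - t * a * y j) / (1 - a * y j) +
        (1 - a * z) * ∑ j ∈ U, (1 - t) * y j / ((z - y j) * (1 - a * y j)) *
          ∏ k ∈ U.erase j, (y j - t * y k) / (y j - y k) := by
  induction U using Finset.induction_on with
  | empty => intro z _; simp
  | insert l U hl ih =>
    intro z hz
    have hzl : z - y l ≠ 0 := sub_ne_zero.2 (hz l (Finset.mem_insert_self _ _))
    have hlU : ∀ j ∈ U, y l ≠ y j := fun j hj h => hl (hy h ▸ hj)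
    have e1 := ih z fun j hj => hz j (Finset.mem_insert_of_mem hj)
    -- The induction hypothesis is also used at the new pole, to evaluate its residue; this is why
    -- `z` is quantified inside the induction.
    have e2 := ih (y l) hlU
    rw [Finset.prod_insert hl, Finset.prod_insert hl, Finset.sum_insert hl,
      Finset.erase_insert hl, e1, e2]
    have e3 : ∑ j ∈ U, (1 - t) * y j / ((z - y j) * (1 - a * y j)) *
          ∏ k ∈ (insert l U).erase j, (y j - t * y k) / (y j - y k) =
        ∑ j ∈ U, (1 - t) * y j / ((z - y j) * (1 - a * y j)) *
          ((y j - t * y l) / (y j - y l) *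
            ∏ k ∈ U.erase j, (y j - t * y k) / (y j - y k)) := by
      refine Finset.sum_congr rfl fun j hj => ?_
      have hjl : l ≠ j := fun h => hl (h ▸ hj)
      rw [Finset.erase_insert_of_ne hjl, Finset.prod_insert]
      exact fun h => hl (Finset.mem_of_mem_erase h)
    rw [e3]
    have hal := ha l
    have hal' : 1 - y l * a ≠ 0 := by rw [mul_comm]; exact hal
    have e4 : (z - t * y l) / (z - y l) *
          ((1 - a * z) * ∑ j ∈ U, (1 - t) * y j / ((z - y j) * (1 - a * y j)) *
            ∏ k ∈ U.erase j, (y j - t * y k) / (y j - y k)) =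
        (1 - a * z) * ((1 - t) * y l / ((z - y l) * (1 - a * y l)) *
          ((1 - a * y l) * ∑ j ∈ U, (1 - t) * y j / ((y l - y j) * (1 - a * y j)) *
            ∏ k ∈ U.erase j, (y j - t * y k) / (y j - y k)) +
          ∑ j ∈ U, (1 - t) * y j / ((z - y j) * (1 - a * y j)) *
            ((y j - t * y l) / (y j - y l) *
              ∏ k ∈ U.erase j, (y j - t * y k) / (y j - y k))) := by
      rw [Finset.mul_sum, Finset.mul_sum, Finset.mul_sum, Finset.mul_sum,
        ← Finset.sum_add_distrib, Finset.mul_sum]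
      refine Finset.sum_congr rfl fun j hj => ?_
      have h1 : z - y j ≠ 0 := sub_ne_zero.2 (hz j (Finset.mem_insert_of_mem hj))
      have h2 : y l - y j ≠ 0 := sub_ne_zero.2 (hlU j hj)
      have h4 : (y j - t * y l) / (y j - y l) = (t * y l - y j) / (y l - y j) := by
        rw [div_eq_div_iff (sub_ne_zero.2 (hlU j hj).symm) h2]; ring
      have haj := ha j
      have haj' : 1 - y j * a ≠ 0 := by rw [mul_comm]; exact haj
      rw [h4]
      generalize ∏ k ∈ U.erase j, (y j - t * y k) / (y j - y k) = P
      field_simp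
      ring
    have e5 : (z - t * y l) / (z - y l) =
        (1 - t * a * y l) / (1 - a * y l) +
          (1 - a * z) * ((1 - t) * y l / ((z - y l) * (1 - a * y l))) := by
      field_simp
      ring
    linear_combination e4 + (∏ j ∈ U, (1 - t * a * y j) / (1 - a * y j)) * e5

/-- Partial fractions in `z` again, now normalized at `z = 0`, where the product is 1. -/
theorem prod_sub_one_eq_sum_poles (hy : Function.Injective y) (z : ℂ) (U : Finset κ)
    (hz : ∀ j ∈ U, z ≠ y j) :
    ∏ j ∈ U, (y j - t * z) / (y j - z) =
      1 + ∑ j ∈ U, (1 - t) * z / (y j - z) *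
        ∏ k ∈ U.erase j, (y k - t * y j) / (y k - y j) := by
  have gen : ∀ z : ℂ, (∀ j ∈ U, z ≠ y j) →
      ∏ j ∈ U, (y j - t * z) / (y j - z) =
        1 + ∑ j ∈ U, (1 - t) * z / (y j - z) *
          ∏ k ∈ U.erase j, (y k - t * y j) / (y k - y j) := by
    clear hz z
    induction U using Finset.induction_on with
    | empty => intro z _; simp
    | insert l U hl ih =>
      intro z hz
      have hzl : y l - z ≠ 0 := sub_ne_zero.2 (hz l (Finset.mem_insert_self _ _)).symm
      have hlU : ∀ j ∈ U, y l ≠ y j := fun j hj h => hl (hy h ▸ hj)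
      have e1 := ih z fun j hj => hz j (Finset.mem_insert_of_mem hj)
      have e2 := ih (y l) hlU
      rw [Finset.prod_insert hl, Finset.sum_insert hl, Finset.erase_insert hl, e1, e2]
      have e3 : ∑ j ∈ U, (1 - t) * z / (y j - z) *
            ∏ k ∈ (insert l U).erase j, (y k - t * y j) / (y k - y j) =
          ∑ j ∈ U, (1 - t) * z / (y j - z) *
            ((y l - t * y j) / (y l - y j) *
              ∏ k ∈ U.erase j, (y k - t * y j) / (y k - y j)) := by
        refine Finset.sum_congr rfl fun j hj => ?_
        have hjl : l ≠ j := fun h => hl (h ▸ hj)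
        rw [Finset.erase_insert_of_ne hjl, Finset.prod_insert]
        exact fun h => hl (Finset.mem_of_mem_erase h)
      rw [e3]
      have e4 : (y l - t * z) / (y l - z) * ∑ j ∈ U, (1 - t) * z / (y j - z) *
            ∏ k ∈ U.erase j, (y k - t * y j) / (y k - y j) =
          (1 - t) * z / (y l - z) * (∑ j ∈ U, (1 - t) * y l / (y j - y l) *
            ∏ k ∈ U.erase j, (y k - t * y j) / (y k - y j)) +
          ∑ j ∈ U, (1 - t) * z / (y j - z) * ((y l - t * y j) / (y l - y j) *
              ∏ k ∈ U.erase j, (y k - t * y j) / (y k - y j)) := by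
        rw [Finset.mul_sum, Finset.mul_sum, ← Finset.sum_add_distrib]
        refine Finset.sum_congr rfl fun j hj => ?_
        have h1 : y j - z ≠ 0 := sub_ne_zero.2 (hz j (Finset.mem_insert_of_mem hj)).symm
        have h2 : y j - y l ≠ 0 := sub_ne_zero.2 (hlU j hj).symm
        have h4 : (y l - t * y j) / (y l - y j) = (t * y j - y l) / (y j - y l) := by
          rw [div_eq_div_iff (sub_ne_zero.2 (hlU j hj)) h2]; ring
        rw [h4]
        generalize ∏ k ∈ U.erase j, (y k - t * y j) / (y k - y j) = P
        field_simp
        ring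
      have e5 : (y l - t * z) / (y l - z) = 1 + (1 - t) * z / (y l - z) := by
        field_simp
        ring
      linear_combination e4 + e5
  exact gen z hz

/-- Evaluate the partial fraction expansion with `a = 0` at `z = 0`, where each factor becomes `t`.
-/
theorem sum_prod_erase (hy : Function.Injective y) (h0 : ∀ j, y j ≠ 0) (U : Finset κ) :
    (1 - t) * ∑ j ∈ U, ∏ k ∈ U.erase j, (y j - t * y k) / (y j - y k) = 1 - t ^ U.card := by
  have h := prod_sub_prod_eq_sum_poles (t := t) hy (a := 0) (by simp) U 0 fun j _ => (h0 j).symm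
  have e1 : ∏ j ∈ U, (0 - t * y j) / (0 - y j) = t ^ U.card := by
    rw [← Finset.prod_const]
    refine Finset.prod_congr rfl fun j _ => ?_
    rw [zero_sub, zero_sub, neg_div_neg_eq, mul_div_cancel_right₀ _ (h0 j)]
  have e2 : ∑ j ∈ U, (1 - t) * y j / ((0 - y j) * (1 - 0 * y j)) *
        ∏ k ∈ U.erase j, (y j - t * y k) / (y j - y k) =
      -((1 - t) * ∑ j ∈ U, ∏ k ∈ U.erase j, (y j - t * y k) / (y j - y k)) := by
    rw [Finset.mul_sum, ← Finset.sum_neg_distrib]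
    refine Finset.sum_congr rfl fun j _ => ?_
    have := h0 j
    rw [← neg_mul]
    congr 1
    field_simp
    ring
  have e3 : ∏ j ∈ U, (1 - t * 0 * y j) / (1 - 0 * y j) = 1 := by simp
  rw [e1, e2, e3] at h
  linear_combination h

end PartialFractions

theorem sum_powerset_sum_mem {ι : Type*} [DecidableEq ι] (S : Finset ι) (F : ι → Finset ι → ℂ) :
    ∑ S' ∈ S.powerset, ∑ i ∈ S', F i (S'.erase i) =
      ∑ i ∈ S, ∑ S' ∈ (S.erase i).powerset, F i S' := by
  rw [Finset.sum_comm' (t' := S) (s' := fun i => S.powerset.filter fun S' => i ∈ S')]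
  · refine Finset.sum_congr rfl fun i hi => ?_
    refine Finset.sum_bij' (fun S' _ => S'.erase i) (fun S' _ => insert i S') ?_ ?_ ?_ ?_ ?_
    · intro S' h
      rw [Finset.mem_filter, Finset.mem_powerset] at h
      exact Finset.mem_powerset.2 (Finset.erase_subset_erase _ h.1)
    · intro S' h
      rw [Finset.mem_powerset] at h
      rw [Finset.mem_filter, Finset.mem_powerset]
      exact ⟨Finset.insert_subset hi (h.trans (Finset.erase_subset _ _)),
        Finset.mem_insert_self _ _⟩
    · intro S' h
      exact Finset.insert_erase (Finset.mem_filter.1 h).2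
    · intro S' h
      exact Finset.erase_insert fun h' => Finset.notMem_erase i S (Finset.mem_powerset.1 h h')
    · intros; rfl
  · intro S' i
    simp only [Finset.mem_powerset, Finset.mem_filter]
    exact ⟨fun h => ⟨h, h.1 h.2⟩, fun h => h.1⟩

theorem sum_powerset_sum_sdiff {ι : Type*} [DecidableEq ι] (S : Finset ι)
    (F : ι → Finset ι → ℂ) :
    ∑ S' ∈ S.powerset, ∑ i ∈ S \ S', F i S' =
      ∑ i ∈ S, ∑ S' ∈ (S.erase i).powerset, F i S' := by
  refine Finset.sum_comm' fun S' i => ?_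
  simp only [Finset.mem_powerset, Finset.mem_sdiff, Finset.subset_erase]
  tauto

/-! ### The peeling expansion of the domain wall partition function. -/

section Cauchy

variable {ι κ : Type*} [DecidableEq ι] [DecidableEq κ] {t : ℂ} {x : ι → ℂ} {y : κ → ℂ}

theorem splitFactor_mul_prod_erase {S S' : Finset ι} (h : S' ⊆ S) {i : ι} (hi : i ∈ S') :
    splitFactor t x S S' * ∏ k ∈ S'.erase i, (x i - t * x k) / (x i - x k) =
      splitFactor t x (S.erase i) (S'.erase i) *
        ∏ k ∈ S.erase i, (x i - t * x k) / (x i - x k) := by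
  have h1 : S.erase i \ S'.erase i = S \ S' := by
    ext k
    simp only [Finset.mem_sdiff, Finset.mem_erase]
    constructor
    · rintro ⟨⟨a, b⟩, c⟩; exact ⟨b, fun d => c ⟨a, d⟩⟩
    · rintro ⟨a, b⟩
      exact ⟨⟨fun e => b (e ▸ hi), a⟩, fun c => b c.2⟩
  rw [splitFactor, splitFactor, h1, ← Finset.mul_prod_erase _ _ hi,
    ← Finset.prod_sdiff (Finset.erase_subset_erase i h), h1]
  ring

theorem splitFactor_insert_mul {T T' : Finset κ} {j : κ} (hj : j ∈ T) (hj' : j ∉ T') :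
    splitFactor t y T T' * ∏ k ∈ (T \ T').erase j, (y j - t * y k) / (y j - y k) =
      splitFactor t y T (insert j T') * ∏ k ∈ T', (y k - t * y j) / (y k - y j) := by
  have h1 : T \ insert j T' = (T \ T').erase j := Finset.sdiff_insert _ _ _
  have hm : j ∈ T \ T' := Finset.mem_sdiff.2 ⟨hj, hj'⟩
  rw [splitFactor, splitFactor, Finset.prod_insert hj', h1]
  have : ∀ i ∈ T', ∏ k ∈ T \ T', (y i - t * y k) / (y i - y k) =
      (y i - t * y j) / (y i - y j) * ∏ k ∈ (T \ T').erase j, (y i - t * y k) / (y i - y k) :=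
    fun i _ => (Finset.mul_prod_erase _ _ hm).symm
  rw [Finset.prod_congr rfl this, Finset.prod_mul_distrib]
  ring

theorem splitFactor_insert_left {T T' : Finset κ} (h : T' ⊆ T) {j : κ} (hj : j ∉ T) :
    splitFactor t y (insert j T) T' =
      splitFactor t y T T' * ∏ k ∈ T', (y k - t * y j) / (y k - y j) := by
  have h1 : insert j T \ T' = insert j (T \ T') :=
    Finset.insert_sdiff_of_notMem _ fun h' => hj (h h')
  rw [splitFactor, splitFactor, h1, ← Finset.prod_mul_distrib]
  refine Finset.prod_congr rfl fun i _ => ?_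
  rw [Finset.prod_insert fun h' => hj (Finset.sdiff_subset h'), mul_comm]

theorem splitFactor_insert_insert {T T' : Finset κ} (h : T' ⊆ T) {j : κ} (hj : j ∉ T) :
    splitFactor t y (insert j T) (insert j T') =
      splitFactor t y T T' * ∏ k ∈ T \ T', (y j - t * y k) / (y j - y k) := by
  have h1 : insert j T \ insert j T' = T \ T' := by
    rw [Finset.insert_sdiff_insert, Finset.sdiff_insert_of_notMem hj]
  rw [splitFactor, splitFactor, h1, Finset.prod_insert fun h' => hj (h h'), mul_comm]

/-- The domain wall partition function with column parameters `y j`, `j ∈ T`, times all row and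
column parameters. -/
def wallWeight (t : ℂ) (x : ι → ℂ) (y : κ → ℂ) (S : Finset ι) (T : Finset κ) : ℂ :=
  (∏ i ∈ S, x i) * (∏ j ∈ T, y j) * domainWall t x (T.toList.map y) S

/-- Partial sum of the peeling expansion, over the sets of rows only. -/
def rowPeel (t : ℂ) (x : ι → ℂ) (y : κ → ℂ) (S : Finset ι) (T : Finset κ) : ℂ :=
  ∑ S' ∈ S.powerset, qFactorial t (S.card - S'.card) * splitFactor t x S S' * wallWeight t x y S' T

/-- The peeling expansion
`∑ φ_{|S| - |S'|}(t) A_{S, S'}(x) A_{T, T'}(y) x_{S'} y_{T'} Z(S', T')` over `S' ⊆ S` and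
`T' ⊆ T`, with `Z` the domain wall partition function. -/
def peel (t : ℂ) (x : ι → ℂ) (y : κ → ℂ) (S : Finset ι) (T : Finset κ) : ℂ :=
  ∑ T' ∈ T.powerset, splitFactor t y T T' * rowPeel t x y S T'

theorem domainWall_toList_insert (hx : Function.Injective x) (hxy : ∀ i j, 1 - x i * y j ≠ 0)
    {T : Finset κ} {j : κ} (hj : j ∉ T) (S : Finset ι) :
    domainWall t x ((insert j T).toList.map y) S = ∑ i ∈ S, (1 - t) / (1 - x i * y j) *
      (∏ k ∈ S.erase i, (x i - t * x k) / (x i - x k)) *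
      (∏ k ∈ T, (1 - t * x i * y k) / (1 - x i * y k)) *
        domainWall t x (T.toList.map y) (S.erase i) := by
  rw [domainWall_perm ((Finset.toList_insert hj).map y) (fun i _ k _ h e => h (hx e)),
    List.map_cons, domainWall_cons]
  · refine Finset.sum_congr rfl fun i _ => ?_
    rw [List.map_map, Function.comp_def, Finset.prod_map_toList]
  · intro i _ z hz
    obtain ⟨k, -, rfl⟩ := List.mem_map.1 hz
    exact hxy i k

theorem wallWeight_insert (hx : Function.Injective x) (hxy : ∀ i j, 1 - x i * y j ≠ 0)
    {T : Finset κ} {j : κ} (hj : j ∉ T) (S : Finset ι) :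
    wallWeight t x y S (insert j T) = ∑ i ∈ S, (1 - t) * x i * y j / (1 - x i * y j) *
      (∏ k ∈ S.erase i, (x i - t * x k) / (x i - x k)) *
      (∏ k ∈ T, (1 - t * x i * y k) / (1 - x i * y k)) * wallWeight t x y (S.erase i) T := by
  rw [wallWeight, domainWall_toList_insert hx hxy hj, Finset.mul_sum, Finset.prod_insert hj]
  refine Finset.sum_congr rfl fun i hi => ?_
  rw [wallWeight, ← Finset.mul_prod_erase S x hi]
  ring

/-- The row expansion obeys the same column recursion as its summands: by
`splitFactor_mul_prod_erase`, removing row `i` from both `S` and `S'` trades the product over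
`S'.erase i` for the one over `S.erase i`, which no longer depends on `S'`. -/
theorem rowPeel_insert (hx : Function.Injective x) (hxy : ∀ i j, 1 - x i * y j ≠ 0)
    {T : Finset κ} {j : κ} (hj : j ∉ T) (S : Finset ι) :
    rowPeel t x y S (insert j T) = ∑ i ∈ S, (1 - t) * x i * y j / (1 - x i * y j) *
      (∏ k ∈ S.erase i, (x i - t * x k) / (x i - x k)) *
      (∏ k ∈ T, (1 - t * x i * y k) / (1 - x i * y k)) * rowPeel t x y (S.erase i) T := by
  have h1 : rowPeel t x y S (insert j T) = ∑ S' ∈ S.powerset, ∑ i ∈ S',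
      (1 - t) * x i * y j / (1 - x i * y j) *
      (∏ k ∈ S.erase i, (x i - t * x k) / (x i - x k)) *
      (∏ k ∈ T, (1 - t * x i * y k) / (1 - x i * y k)) *
        (qFactorial t ((S.erase i).card - (S'.erase i).card) *
          splitFactor t x (S.erase i) (S'.erase i) * wallWeight t x y (S'.erase i) T) := by
    refine Finset.sum_congr rfl fun S' hS' => ?_
    rw [Finset.mem_powerset] at hS'
    rw [wallWeight_insert hx hxy hj, Finset.mul_sum]
    refine Finset.sum_congr rfl fun i hi => ?_
    have hc : (S.erase i).card - (S'.erase i).card = S.card - S'.card := by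
      rw [Finset.card_erase_of_mem hi, Finset.card_erase_of_mem (hS' hi)]
      have := Finset.card_pos.2 ⟨i, hi⟩
      omega
    rw [hc]
    linear_combination (qFactorial t (S.card - S'.card) *
      ((1 - t) * x i * y j / (1 - x i * y j)) *
      (∏ k ∈ T, (1 - t * x i * y k) / (1 - x i * y k)) * wallWeight t x y (S'.erase i) T) *
      splitFactor_mul_prod_erase (t := t) (x := x) hS' hi
  rw [h1, sum_powerset_sum_mem S fun i S' => (1 - t) * x i * y j / (1 - x i * y j) *
      (∏ k ∈ S.erase i, (x i - t * x k) / (x i - x k)) *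
      (∏ k ∈ T, (1 - t * x i * y k) / (1 - x i * y k)) *
        (qFactorial t ((S.erase i).card - S'.card) *
          splitFactor t x (S.erase i) S' * wallWeight t x y S' T)]
  refine Finset.sum_congr rfl fun i _ => ?_
  rw [rowPeel, Finset.mul_sum]

/-- Split the subsets of `insert n T` by membership of `n`. Those without `n` carry an extra product
over `T'`, whose expansion normalized at 0 has a constant term yielding the sum over `T`. Those with
`n` carry an extra product over `T \ T'`; its expansion normalized at `1 / x i` has a constant term
supplying the missing factors of row `i`. The pole terms of the two families cancel. -/
theorem peel_insert (hx : Function.Injective x) (hy : Function.Injective y)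
    (hxy : ∀ i j, 1 - x i * y j ≠ 0) {T : Finset κ} {n : κ} (hn : n ∉ T) (S : Finset ι) :
    peel t x y S (insert n T) = peel t x y S T +
      ∑ i ∈ S, (1 - t) * x i * y n / (1 - x i * y n) *
        (∏ k ∈ S.erase i, (x i - t * x k) / (x i - x k)) *
        (∏ k ∈ T, (1 - t * x i * y k) / (1 - x i * y k)) * peel t x y (S.erase i) T := by
  have hnT : ∀ j ∈ T, y n ≠ y j := fun j hj h => hn (hy h ▸ hj)
  -- The common contribution of the pole at `y n = y j`, indexed by a set avoiding `j`: it comes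
  -- from the subset `insert j T'` in the first family and from `T'` in the second.
  set G : κ → Finset κ → ℂ := fun j T' => (1 - t) * y n / (y j - y n) *
    (∏ k ∈ T', (y k - t * y j) / (y k - y j)) *
      (splitFactor t y T (insert j T') * rowPeel t x y S (insert j T')) with hG
  have e1 : ∑ T' ∈ T.powerset, splitFactor t y (insert n T) T' * rowPeel t x y S T' =
      peel t x y S T + ∑ j ∈ T, ∑ T' ∈ (T.erase j).powerset, G j T' := by
    rw [← sum_powerset_sum_mem, peel, ← Finset.sum_add_distrib]
    refine Finset.sum_congr rfl fun T' hT' => ?_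
    rw [Finset.mem_powerset] at hT'
    rw [splitFactor_insert_left hT' hn, prod_sub_one_eq_sum_poles hy (y n) T'
      (fun j hj => hnT j (hT' hj)), mul_add, mul_one, add_mul, Finset.mul_sum, Finset.sum_mul]
    congr 1
    refine Finset.sum_congr rfl fun j hj => ?_
    simp only [hG]
    rw [Finset.insert_erase hj]
    ring
  have e2 : ∑ T' ∈ T.powerset, splitFactor t y (insert n T) (insert n T') *
        rowPeel t x y S (insert n T') =
      (∑ i ∈ S, (1 - t) * x i * y n / (1 - x i * y n) *
        (∏ k ∈ S.erase i, (x i - t * x k) / (x i - x k)) *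
        (∏ k ∈ T, (1 - t * x i * y k) / (1 - x i * y k)) * peel t x y (S.erase i) T) -
      ∑ j ∈ T, ∑ T' ∈ (T.erase j).powerset, G j T' := by
    rw [← sum_powerset_sum_sdiff]
    simp only [peel, Finset.mul_sum]
    rw [Finset.sum_comm, ← Finset.sum_sub_distrib]
    refine Finset.sum_congr rfl fun T' hT' => ?_
    rw [Finset.mem_powerset] at hT'
    have e3 : ∀ j ∈ T \ T', G j T' = -(∑ i ∈ S, (splitFactor t y T T' *
        ((∏ k ∈ S.erase i, (x i - t * x k) / (x i - x k)) *
        (∏ k ∈ T', (1 - t * x i * y k) / (1 - x i * y k)) * rowPeel t x y (S.erase i) T')) *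
          ((1 - t) * x i * y n * ((1 - t) * y j / ((y n - y j) * (1 - x i * y j)) *
            ∏ k ∈ (T \ T').erase j, (y j - t * y k) / (y j - y k)))) := by
      intro j hj
      rw [Finset.mem_sdiff] at hj
      simp only [hG]
      rw [rowPeel_insert hx hxy hj.2, Finset.mul_sum, Finset.mul_sum, ← Finset.sum_neg_distrib]
      refine Finset.sum_congr rfl fun i _ => ?_
      have e4 := splitFactor_insert_mul (t := t) (y := y) hj.1 hj.2
      have e5 : (1 - t) * y n / (y j - y n) = -((1 - t) * y n / (y n - y j)) := by
        rw [← neg_sub (y n) (y j), div_neg]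
      have e6 : (1 - t) * x i * y n * ((1 - t) * y j / ((y n - y j) * (1 - x i * y j))) =
          ((1 - t) * y n / (y n - y j)) * ((1 - t) * x i * y j / (1 - x i * y j)) := by
        have := hxy i j
        have := sub_ne_zero.2 (hnT j hj.1)
        field_simp
      rw [e5]
      linear_combination (((∏ k ∈ S.erase i, (x i - t * x k) / (x i - x k)) *
        (∏ k ∈ T', (1 - t * x i * y k) / (1 - x i * y k)) * rowPeel t x y (S.erase i) T') *
        splitFactor t y T T' * ∏ k ∈ (T \ T').erase j, (y j - t * y k) / (y j - y k)) * e6 +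
        ((∏ k ∈ S.erase i, (x i - t * x k) / (x i - x k)) *
        (∏ k ∈ T', (1 - t * x i * y k) / (1 - x i * y k)) * rowPeel t x y (S.erase i) T') *
        ((1 - t) * y n / (y n - y j)) * ((1 - t) * x i * y j / (1 - x i * y j)) * e4
    rw [Finset.sum_congr rfl e3, Finset.sum_neg_distrib, sub_neg_eq_add, Finset.sum_comm,
      ← Finset.sum_add_distrib, rowPeel_insert hx hxy fun h => hn (hT' h),
      splitFactor_insert_insert hT' hn, Finset.mul_sum]
    refine Finset.sum_congr rfl fun i _ => ?_
    rw [← Finset.mul_sum, ← Finset.mul_sum]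
    have e7 := prod_sub_prod_eq_sum_poles (t := t) hy (a := x i) (hxy i) (T \ T') (y n)
      fun j hj => hnT j (Finset.sdiff_subset hj)
    have e8 : ∏ k ∈ T, (1 - t * x i * y k) / (1 - x i * y k) =
        (∏ k ∈ T \ T', (1 - t * x i * y k) / (1 - x i * y k)) *
          ∏ k ∈ T', (1 - t * x i * y k) / (1 - x i * y k) := (Finset.prod_sdiff hT').symm
    have e9 : (1 - t) * x i * y n / (1 - x i * y n) * (1 - x i * y n) = (1 - t) * x i * y n :=
      div_mul_cancel₀ _ (hxy i n)
    rw [e8, e7]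
    linear_combination (splitFactor t y T T' *
      (∏ k ∈ S.erase i, (x i - t * x k) / (x i - x k)) *
      (∏ k ∈ T', (1 - t * x i * y k) / (1 - x i * y k)) * rowPeel t x y (S.erase i) T' *
      ∑ j ∈ T \ T', (1 - t) * y j / ((y n - y j) * (1 - x i * y j)) *
        ∏ k ∈ (T \ T').erase j, (y j - t * y k) / (y j - y k)) * e9
  rw [peel, Finset.sum_powerset_insert hn, e1, e2]
  ring

theorem domainWall_replicate_zero (hx : Function.Injective x) (h0 : ∀ i, x i ≠ 0) (m : ℕ) :
    ∀ S : Finset ι, S.card = m → domainWall t x (List.replicate m 0) S = qFactorial t m := by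
  induction m with
  | zero =>
    intro S hS
    rw [Finset.card_eq_zero] at hS
    simp [domainWall_nil, hS, qFactorial_zero]
  | succ m ih =>
    intro S hS
    rw [List.replicate_succ, domainWall_cons, qFactorial_succ, ← hS, ← sum_prod_erase hx h0 S,
      Finset.mul_sum, Finset.mul_sum]
    refine Finset.sum_congr rfl fun i hi => ?_
    rw [ih (S.erase i) (by rw [Finset.card_erase_of_mem hi, hS]; rfl)]
    simp
    ring

theorem peel_empty (S : Finset ι) : peel t x y S ∅ = qFactorial t S.card := by
  rw [peel, Finset.powerset_empty, Finset.sum_singleton, rowPeel,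
    Finset.sum_eq_single_of_mem ∅ (Finset.empty_mem_powerset S)]
  · simp [splitFactor, wallWeight, domainWall_nil]
  · intro S' _ h
    simp [wallWeight, domainWall_nil, h]

/-- Padding with zero columns keeps the numbers of rows and columns equal while `T` grows by
induction; the base case, with all columns zero, is a q-factorial. The expansion needed later is the
case `m = 0`. -/
theorem domainWall_eq_peel (hx : Function.Injective x) (h0 : ∀ i, x i ≠ 0)
    (hy : Function.Injective y) (hxy : ∀ i j, 1 - x i * y j ≠ 0) (T : Finset κ) :
    ∀ (m : ℕ) (S : Finset ι), S.card = T.card + m →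
      domainWall t x (T.toList.map y ++ List.replicate m 0) S = peel t x y S T := by
  induction T using Finset.induction_on with
  | empty =>
    intro m S hS
    rw [peel_empty, hS]
    simpa using domainWall_replicate_zero hx h0 m S (by simpa using hS)
  | insert n T hn ih =>
    intro m S hS
    rw [Finset.card_insert_of_notMem hn] at hS
    have hx' : ∀ i ∈ S, ∀ k ∈ S, i ≠ k → x i ≠ x k := fun i _ k _ h e => h (hx e)
    -- With `z` free, the values at `z = 0` (known by induction) and `z = y n` (wanted) differ only
    -- in the first factor, and their difference is the increment found in `peel_insert`.
    have key : ∀ z : ℂ, domainWall t x (z :: (T.toList.map y ++ List.replicate m 0)) S =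
        ∑ i ∈ S, (1 - t) / (1 - x i * z) *
          (∏ k ∈ S.erase i, (x i - t * x k) / (x i - x k)) *
          (∏ k ∈ T, (1 - t * x i * y k) / (1 - x i * y k)) * peel t x y (S.erase i) T := by
      intro z
      rw [domainWall_cons]
      refine Finset.sum_congr rfl fun i hi => ?_
      rw [ih m (S.erase i) (by rw [Finset.card_erase_of_mem hi, hS]; omega), List.map_append,
        List.prod_append, List.map_map, Function.comp_def, Finset.prod_map_toList]
      simp
    have hS' := ih (m + 1) S (by omega)
    have p1 : (T.toList.map y ++ List.replicate (m + 1) 0).Perm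
        (0 :: (T.toList.map y ++ List.replicate m 0)) := by
      rw [List.replicate_succ]
      exact List.perm_middle
    have p2 : ((insert n T).toList.map y ++ List.replicate m 0).Perm
        (y n :: (T.toList.map y ++ List.replicate m 0)) :=
      ((Finset.toList_insert hn).map y).append_right _
    have hmem : ∀ (T : Finset κ) (m : ℕ), ∀ i ∈ S,
        ∀ z ∈ T.toList.map y ++ List.replicate m 0, 1 - x i * z ≠ 0 := by
      intro T m i _ z hz
      rcases List.mem_append.1 hz with hz | hz
      · obtain ⟨k, -, rfl⟩ := List.mem_map.1 hz
        exact hxy i k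
      · rw [(List.mem_replicate.1 hz).2]
        simp
    rw [domainWall_perm p1 hx' (hmem _ _), key] at hS'
    rw [domainWall_perm p2 hx' (hmem _ _), key, peel_insert hx hy hxy hn, ← hS',
      ← Finset.sum_add_distrib]
    refine Finset.sum_congr rfl fun i _ => ?_
    have := hxy i n
    have e : (1 - t) / (1 - x i * y n) = (1 - t) / (1 - x i * 0) +
        (1 - t) * x i * y n / (1 - x i * y n) := by
      field_simp
      ring
    rw [e]
    ring

end Cauchy

/-! ### Exponent vectors and removal of the first column of a partition. -/

section Levels

variable {ι κ : Type*} [DecidableEq ι] [DecidableEq κ] {t : ℂ} {x : ι → ℂ}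

/-- `∏_k φ_{m_k}(t)`, where `m_k = #{i ∈ S : a i = k}`. -/
def levelWeight (t : ℂ) (S : Finset ι) (a : ι → ℕ) : ℂ :=
  ∏ k ∈ S.image a, qFactorial t (S.filter fun i => a i = k).card

/-- The term of a Hall--Littlewood polynomial in the variables `x i`, `i ∈ S`, that belongs to
the exponents `a`. -/
def hlOn (t : ℂ) (x : ι → ℂ) (S : Finset ι) (a : ι → ℕ) : ℂ :=
  (∏ i ∈ S, x i ^ a i) *
    ∏ i ∈ S, ∏ j ∈ S.filter (fun j => a j < a i), (x i - t * x j) / (x i - x j)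

/-- Add one to the exponents in `S`. -/
def raise (S : Finset ι) (a : ι → ℕ) : ι → ℕ := fun i => a i + if i ∈ S then 1 else 0

theorem raise_injective (S : Finset ι) : Function.Injective (raise S) := by
  intro a b h
  funext i
  have := congrFun h i
  simp only [raise] at this
  omega

theorem card_filter_raise_zero {S S' : Finset ι} (h : S' ⊆ S) {a : ι → ℕ}
    (ha : ∀ i, i ∉ S' → a i = 0) :
    (S.filter fun i => raise S' a i = 0).card = S.card - S'.card := by
  rw [← Finset.card_sdiff_of_subset h]
  congr 1
  ext i
  rw [Finset.mem_filter, Finset.mem_sdiff, raise]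
  by_cases hi : i ∈ S' <;> simp [hi, ha]

theorem card_filter_raise_succ {S S' : Finset ι} (h : S' ⊆ S) {a : ι → ℕ}
    (ha : ∀ i, i ∉ S' → a i = 0) (k : ℕ) :
    (S.filter fun i => raise S' a i = k + 1).card = (S'.filter fun i => a i = k).card := by
  congr 1
  ext i
  rw [Finset.mem_filter, Finset.mem_filter, raise]
  by_cases hi : i ∈ S'
  · simp [hi, h hi]
  · simp [hi, ha i hi]

theorem levelWeight_eq_prod {S : Finset ι} {a : ι → ℕ} {K : Finset ℕ} (hK : S.image a ⊆ K) :
    levelWeight t S a = ∏ k ∈ K, qFactorial t (S.filter fun i => a i = k).card := by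
  refine Finset.prod_subset hK fun k _ hk => ?_
  rw [Finset.filter_eq_empty_iff.2, Finset.card_empty, qFactorial_zero]
  rintro i hi rfl
  exact hk (Finset.mem_image_of_mem a hi)

theorem levelWeight_raise {S S' : Finset ι} (h : S' ⊆ S) {a : ι → ℕ}
    (ha : ∀ i, i ∉ S' → a i = 0) :
    levelWeight t S (raise S' a) = qFactorial t (S.card - S'.card) * levelWeight t S' a := by
  rw [levelWeight_eq_prod (K := insert 0 ((S'.image a).image Nat.succ)), Finset.prod_insert,
    card_filter_raise_zero h ha, Finset.prod_image, levelWeight]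
  · congr 1
    exact Finset.prod_congr rfl fun k _ => by rw [Nat.succ_eq_add_one, card_filter_raise_succ h ha]
  · exact fun _ _ _ _ e => Nat.succ_injective e
  · simp
  · intro k hk
    obtain ⟨i, -, rfl⟩ := Finset.mem_image.1 hk
    by_cases hi : i ∈ S'
    · refine Finset.mem_insert_of_mem (Finset.mem_image.2 ⟨a i, Finset.mem_image_of_mem a hi, ?_⟩)
      simp [raise, hi]
    · simp [raise, hi, ha i hi]

/-- Raising `S'` preserves the order inside `S'` and puts all of `S'` strictly above the rest, whose
exponents are zero. The new pairs are exactly those of `splitFactor`, and each raised variable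
contributes one more power. -/
theorem hlOn_raise {S S' : Finset ι} (h : S' ⊆ S) {a : ι → ℕ} (ha : ∀ i, i ∉ S' → a i = 0) :
    hlOn t x S (raise S' a) = splitFactor t x S S' * (∏ i ∈ S', x i) * hlOn t x S' a := by
  have r1 : ∀ i ∈ S', raise S' a i = a i + 1 := fun i hi => by simp [raise, hi]
  have r0 : ∀ i, i ∉ S' → raise S' a i = 0 := fun i hi => by simp [raise, hi, ha i hi]
  simp only [hlOn, splitFactor, Finset.prod_filter]
  rw [← Finset.prod_sdiff h, ← Finset.prod_sdiff h]
  have e1 : ∏ i ∈ S \ S', x i ^ raise S' a i = 1 := Finset.prod_eq_one fun i hi => by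
    rw [r0 i (Finset.mem_sdiff.1 hi).2, pow_zero]
  have e2 : ∏ i ∈ S \ S', ∏ j ∈ S, (if raise S' a j < raise S' a i then
      (x i - t * x j) / (x i - x j) else 1) = 1 := Finset.prod_eq_one fun i hi => by
    rw [r0 i (Finset.mem_sdiff.1 hi).2]
    simp
  have e3 : ∏ i ∈ S', x i ^ raise S' a i = (∏ i ∈ S', x i) * ∏ i ∈ S', x i ^ a i := by
    rw [← Finset.prod_mul_distrib]
    exact Finset.prod_congr rfl fun i hi => by rw [r1 i hi, pow_succ']
  have e4 : ∏ i ∈ S', ∏ j ∈ S, (if raise S' a j < raise S' a i then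
      (x i - t * x j) / (x i - x j) else 1) =
      (∏ i ∈ S', ∏ k ∈ S \ S', (x i - t * x k) / (x i - x k)) *
        ∏ i ∈ S', ∏ j ∈ S', (if a j < a i then (x i - t * x j) / (x i - x j) else 1) := by
    rw [← Finset.prod_mul_distrib]
    refine Finset.prod_congr rfl fun i hi => ?_
    rw [← Finset.prod_sdiff h]
    congr 1
    · refine Finset.prod_congr rfl fun j hj => ?_
      rw [r0 j (Finset.mem_sdiff.1 hj).2, r1 i hi, if_pos (Nat.succ_pos _)]
    · refine Finset.prod_congr rfl fun j hj => ?_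
      rw [r1 j hj, r1 i hi]
      simp
  rw [e1, e2, e3, e4]
  ring

/-- Two families of exponents have the same multiplicities. -/
def SameLevels (S : Finset ι) (T : Finset κ) (a : ι → ℕ) (b : κ → ℕ) : Prop :=
  ∀ k, (S.filter fun i => a i = k).card = (T.filter fun j => b j = k).card

theorem SameLevels.image_eq {S : Finset ι} {T : Finset κ} {a : ι → ℕ} {b : κ → ℕ}
    (h : SameLevels S T a b) : S.image a = T.image b := by
  have key : ∀ k, (∃ i ∈ S, a i = k) ↔ ∃ j ∈ T, b j = k := by
    intro k
    have := h k
    have e1 : (∃ i ∈ S, a i = k) ↔ 0 < (S.filter fun i => a i = k).card := by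
      rw [Finset.card_pos, Finset.filter_nonempty_iff]
    have e2 : (∃ j ∈ T, b j = k) ↔ 0 < (T.filter fun j => b j = k).card := by
      rw [Finset.card_pos, Finset.filter_nonempty_iff]
    rw [e1, e2, this]
  ext k
  simpa only [Finset.mem_image] using key k

theorem SameLevels.sum_eq {S : Finset ι} {T : Finset κ} {a : ι → ℕ} {b : κ → ℕ}
    (h : SameLevels S T a b) (f : ℕ → ℕ) : ∑ i ∈ S, f (a i) = ∑ j ∈ T, f (b j) := by
  rw [Finset.sum_comp f a, Finset.sum_comp f b, h.image_eq]
  exact Finset.sum_congr rfl fun k _ => by rw [h k]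

theorem SameLevels.card_eq {S : Finset ι} {T : Finset κ} {a : ι → ℕ} {b : κ → ℕ}
    (h : SameLevels S T a b) : S.card = T.card := by
  simpa using h.sum_eq fun _ => 1

/-- Positive levels are shifted by one; level zero is then matched by counting, which is where
equality of the cardinalities of `S` and `T` enters. -/
theorem sameLevels_raise {S S' : Finset ι} {T T' : Finset κ} (hS : S' ⊆ S) (hT : T' ⊆ T)
    (hc : S.card = T.card) {a : ι → ℕ} {b : κ → ℕ} (ha : ∀ i, i ∉ S' → a i = 0)
    (hb : ∀ j, j ∉ T' → b j = 0) :
    SameLevels S T (raise S' a) (raise T' b) ↔ SameLevels S' T' a b := by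
  constructor
  · intro h k
    rw [← card_filter_raise_succ hS ha, ← card_filter_raise_succ hT hb, h]
  · intro h k
    rcases k with _ | k
    · rw [card_filter_raise_zero hS ha, card_filter_raise_zero hT hb, hc, h.card_eq]
    · rw [card_filter_raise_succ hS ha, card_filter_raise_succ hT hb, h]

end Levels

/-! ### The refined Cauchy sum over pairs of rearrangements, and its value. -/

section PairSum

variable {ι κ : Type*} [Fintype ι] [Fintype κ] [DecidableEq ι] [DecidableEq κ] {t : ℂ}
  {x : ι → ℂ} {y : κ → ℂ}

open Classical in
/-- The term of the refined Cauchy sum for a pair of rearrangements of the same partition. -/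
def pairTerm (t : ℂ) (x : ι → ℂ) (y : κ → ℂ) (S : Finset ι) (T : Finset κ)
    (p : (ι → ℕ) × (κ → ℕ)) : ℂ :=
  if (∀ i, i ∉ S → p.1 i = 0) ∧ (∀ j, j ∉ T → p.2 j = 0) ∧ SameLevels S T p.1 p.2 then
    levelWeight t S p.1 * hlOn t x S p.1 * hlOn t y T p.2 else 0

theorem pairTerm_raise {S S' : Finset ι} {T T' : Finset κ} (hS : S' ⊆ S) (hT : T' ⊆ T)
    (hc : S.card = T.card) {a : ι → ℕ} {b : κ → ℕ} (ha : ∀ i, i ∉ S' → a i = 0)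
    (hb : ∀ j, j ∉ T' → b j = 0) :
    pairTerm t x y S T (raise S' a, raise T' b) =
      qFactorial t (S.card - S'.card) * splitFactor t x S S' * splitFactor t y T T' *
        (∏ i ∈ S', x i) * (∏ j ∈ T', y j) * pairTerm t x y S' T' (a, b) := by
  have h1 : ∀ i, i ∉ S → raise S' a i = 0 := fun i hi => by
    simp [raise, ha i fun h => hi (hS h), show i ∉ S' from fun h => hi (hS h)]
  have h2 : ∀ j, j ∉ T → raise T' b j = 0 := fun j hj => by
    simp [raise, hb j fun h => hj (hT h), show j ∉ T' from fun h => hj (hT h)]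
  by_cases h : SameLevels S' T' a b
  · rw [pairTerm, pairTerm, if_pos ⟨h1, h2, (sameLevels_raise hS hT hc ha hb).2 h⟩,
      if_pos ⟨ha, hb, h⟩, levelWeight_raise hS ha, hlOn_raise hS ha, hlOn_raise hT hb]
    ring
  · rw [pairTerm, pairTerm, if_neg fun h' => h ((sameLevels_raise hS hT hc ha hb).1 h'.2.2),
      if_neg fun h' => h h'.2.2, mul_zero]

theorem pairTerm_eq_zero_of_card_ne {S : Finset ι} {T : Finset κ} (h : S.card ≠ T.card)
    (p : (ι → ℕ) × (κ → ℕ)) : pairTerm t x y S T p = 0 :=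
  if_neg fun h' => h h'.2.2.card_eq

/-- The set of indices with positive exponent. -/
def posPart {ι : Type*} [Fintype ι] (a : ι → ℕ) : Finset ι := Finset.univ.filter fun i => a i ≠ 0

theorem mem_posPart {a : ι → ℕ} {i : ι} : i ∈ posPart a ↔ a i ≠ 0 := by simp [posPart]

theorem posPart_raise {S : Finset ι} {a : ι → ℕ} :
    posPart (raise S a) = S ↔ ∀ i, i ∉ S → a i = 0 := by
  constructor
  · intro h i hi
    by_contra h0
    exact hi (h ▸ mem_posPart.2 (by simp [raise, h0]))
  · intro h
    ext i
    rw [mem_posPart]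
    by_cases hi : i ∈ S <;> simp [raise, hi, h]

theorem raise_posPart (a : ι → ℕ) : raise (posPart a) (fun i => a i - 1) = a := by
  funext i
  by_cases h : a i = 0
  · simp [raise, mem_posPart, h]
  · simp only [raise, mem_posPart, ne_eq, h, not_false_eq_true, if_true]
    omega

theorem summable_prod_pow {r : ℝ} (h0 : 0 ≤ r) (h1 : r < 1) :
    Summable fun a : ι → ℕ => ∏ i, r ^ a i := by
  refine summable_of_sum_le (c := ((1 - r)⁻¹) ^ Fintype.card ι)
    (fun a => Finset.prod_nonneg fun i _ => pow_nonneg h0 _) fun u => ?_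
  set N := u.sup (fun a => Finset.univ.sup a) + 1 with hN
  have hu : u ⊆ Fintype.piFinset fun _ : ι => Finset.range N := by
    intro a ha
    rw [Fintype.mem_piFinset]
    intro i
    rw [Finset.mem_range, hN, Nat.lt_succ_iff]
    exact (Finset.le_sup (f := a) (Finset.mem_univ i)).trans
      (Finset.le_sup (f := fun a => Finset.univ.sup a) ha)
  calc ∑ a ∈ u, ∏ i, r ^ a i
      ≤ ∑ a ∈ Fintype.piFinset fun _ : ι => Finset.range N, ∏ i, r ^ a i :=
        Finset.sum_le_sum_of_subset_of_nonneg hu fun a _ _ =>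
          Finset.prod_nonneg fun i _ => pow_nonneg h0 _
    _ = ∏ _i : ι, ∑ k ∈ Finset.range N, r ^ k :=
        (Finset.prod_univ_sum (fun _ => Finset.range N) fun _ k => r ^ k).symm
    _ ≤ ∏ _i : ι, (1 - r)⁻¹ := by
        refine Finset.prod_le_prod (fun i _ => Finset.sum_nonneg fun k _ => pow_nonneg h0 _)
          fun i _ => ?_
        rw [← tsum_geometric_of_lt_one h0 h1]
        exact (summable_geometric_of_lt_one h0 h1).sum_le_tsum _ fun k _ => pow_nonneg h0 _
    _ = ((1 - r)⁻¹) ^ Fintype.card ι := by simp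

theorem norm_qFactorial_le (t : ℂ) {m N : ℕ} (h : m ≤ N) :
    ‖qFactorial t m‖ ≤ ∏ i ∈ Finset.range N, max 1 ‖1 - t ^ (i + 1)‖ := by
  induction N, h using Nat.le_induction with
  | base =>
    rw [qFactorial, norm_prod, Finset.range_eq_Ico, Finset.prod_Ico_add' (fun i =>
      max 1 ‖1 - t ^ i‖) 0 m 1]
    exact Finset.prod_le_prod (fun _ _ => norm_nonneg _) fun _ _ => le_max_right _ _
  | succ N _ ih =>
    rw [Finset.prod_range_succ]
    exact ih.trans (le_mul_of_one_le_right
      (Finset.prod_nonneg fun _ _ => zero_le_one.trans (le_max_left _ _)) (le_max_left _ _))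

theorem norm_levelWeight_le (t : ℂ) (S : Finset ι) :
    ∃ C : ℝ, 0 ≤ C ∧ ∀ a : ι → ℕ, ‖levelWeight t S a‖ ≤ C := by
  set M : ℝ := ∏ i ∈ Finset.range S.card, max 1 ‖1 - t ^ (i + 1)‖
  have hM : 1 ≤ M := Finset.one_le_prod fun _ _ => le_max_left _ _
  refine ⟨M ^ S.card, by positivity, fun a => ?_⟩
  rw [levelWeight, norm_prod]
  calc ∏ k ∈ S.image a, ‖qFactorial t (S.filter fun i => a i = k).card‖
      ≤ ∏ k ∈ S.image a, M := Finset.prod_le_prod (fun _ _ => norm_nonneg _) fun k _ =>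
        norm_qFactorial_le t (Finset.card_filter_le _ _)
    _ = M ^ (S.image a).card := by rw [Finset.prod_const]
    _ ≤ M ^ S.card := pow_le_pow_right₀ hM Finset.card_image_le

theorem norm_hlOn_le (t : ℂ) (x : ι → ℂ) {X : ℝ} (hX : ∀ i, ‖x i‖ ≤ X) (S : Finset ι) :
    ∃ C : ℝ, 0 ≤ C ∧ ∀ a : ι → ℕ, ‖hlOn t x S a‖ ≤ C * X ^ ∑ i ∈ S, a i := by
  refine ⟨∏ i ∈ S, ∏ j ∈ S, max 1 ‖(x i - t * x j) / (x i - x j)‖,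
    Finset.prod_nonneg fun _ _ => Finset.prod_nonneg fun _ _ => zero_le_one.trans (le_max_left _ _),
    fun a => ?_⟩
  rw [hlOn, norm_mul, mul_comm]
  refine mul_le_mul ?_ ?_ (norm_nonneg _)
    (Finset.prod_nonneg fun _ _ => Finset.prod_nonneg fun _ _ => zero_le_one.trans (le_max_left _ _))
  · rw [norm_prod]
    refine Finset.prod_le_prod (fun _ _ => norm_nonneg _) fun i _ => ?_
    rw [Finset.prod_filter, norm_prod]
    refine Finset.prod_le_prod (fun _ _ => norm_nonneg _) fun j _ => ?_
    split_ifs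
    · exact le_max_right _ _
    · simp
  · rw [norm_prod, ← Finset.prod_pow_eq_pow_sum]
    refine Finset.prod_le_prod (fun _ _ => norm_nonneg _) fun i _ => ?_
    rw [norm_pow]
    exact pow_le_pow_left₀ (norm_nonneg _) (hX i) _

/-- Rearrangements of one partition have the same sum of exponents, so the monomials are bounded by
a power of `X * Y`. The other factors take boundedly many sizes. -/
theorem summable_pairTerm {X Y : ℝ} (hX0 : 0 ≤ X) (hY0 : 0 ≤ Y) (hX : ∀ i, ‖x i‖ ≤ X)
    (hY : ∀ j, ‖y j‖ ≤ Y) (hXY : X * Y < 1) (S : Finset ι) (T : Finset κ) :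
    Summable (pairTerm t x y S T) := by
  obtain ⟨C₁, h₁, hC₁⟩ := norm_levelWeight_le t S
  obtain ⟨C₂, h₂, hC₂⟩ := norm_hlOn_le t x hX S
  obtain ⟨C₃, h₃, hC₃⟩ := norm_hlOn_le t y hY T
  -- Since both exponent sums agree, the square root distributes the decay evenly over the two
  -- vectors and gives a product of two geometric majorants.
  set r := Real.sqrt (X * Y) with hr
  have hr0 : 0 ≤ r := Real.sqrt_nonneg _
  have hr1 : r < 1 := by
    rw [hr, Real.sqrt_lt' zero_lt_one]
    simpa using hXY
  have hr2 : r * r = X * Y := Real.mul_self_sqrt (mul_nonneg hX0 hY0)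
  have hs : Summable fun p : (ι → ℕ) × (κ → ℕ) =>
      C₁ * C₂ * C₃ * ((∏ i, r ^ p.1 i) * ∏ j, r ^ p.2 j) :=
    ((summable_prod_pow hr0 hr1).mul_of_nonneg (summable_prod_pow hr0 hr1)
      (fun a => Finset.prod_nonneg fun i _ => pow_nonneg hr0 _)
      fun a => Finset.prod_nonneg fun i _ => pow_nonneg hr0 _).mul_left _
  refine Summable.of_norm_bounded hs fun p => ?_
  rw [pairTerm]
  split_ifs with h
  · obtain ⟨ha, hb, hl⟩ := h
    have e1 : ∏ i, r ^ p.1 i = r ^ ∑ i ∈ S, p.1 i := by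
      rw [Finset.prod_pow_eq_pow_sum]
      congr 1
      exact (Finset.sum_subset (Finset.subset_univ S) fun i _ hi => ha i hi).symm
    have e2 : ∏ j, r ^ p.2 j = r ^ ∑ i ∈ S, p.1 i := by
      rw [Finset.prod_pow_eq_pow_sum, hl.sum_eq fun k => k]
      congr 1
      exact (Finset.sum_subset (Finset.subset_univ T) fun i _ hi => hb i hi).symm
    have e3 : C₁ * C₂ * C₃ * ((∏ i, r ^ p.1 i) * ∏ j, r ^ p.2 j) =
        C₁ * (C₂ * X ^ ∑ i ∈ S, p.1 i) * (C₃ * Y ^ ∑ j ∈ T, p.2 j) := by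
      rw [e1, e2, ← hl.sum_eq fun k => k, ← mul_pow, hr2, mul_pow]
      ring
    rw [e3, norm_mul, norm_mul]
    have hp : 0 ≤ C₂ * X ^ ∑ i ∈ S, p.1 i := by positivity
    exact mul_le_mul (mul_le_mul (hC₁ _) (hC₂ _) (norm_nonneg _) h₁) (hC₃ _) (norm_nonneg _)
      (mul_nonneg h₁ hp)
  · rw [norm_zero]
    exact mul_nonneg (by positivity) (mul_nonneg (Finset.prod_nonneg fun i _ => pow_nonneg hr0 _)
      (Finset.prod_nonneg fun i _ => pow_nonneg hr0 _))

/-- Group the pairs by their supports `S'` and `T'`; each group is parametrized injectively by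
subtracting one from the positive exponents. -/
theorem tsum_pairTerm_rec {X Y : ℝ} (hX0 : 0 ≤ X) (hY0 : 0 ≤ Y) (hX : ∀ i, ‖x i‖ ≤ X)
    (hY : ∀ j, ‖y j‖ ≤ Y) (hXY : X * Y < 1) {S : Finset ι} {T : Finset κ}
    (hc : S.card = T.card) :
    ∑' p, pairTerm t x y S T p = ∑ T' ∈ T.powerset, ∑ S' ∈ S.powerset,
      qFactorial t (S.card - S'.card) * splitFactor t x S S' * splitFactor t y T T' *
        (∏ i ∈ S', x i) * (∏ j ∈ T', y j) * ∑' p, pairTerm t x y S' T' p := by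
  classical
  have hsum := summable_pairTerm (t := t) hX0 hY0 hX hY hXY S T
  set f : Finset κ → Finset ι → ((ι → ℕ) × (κ → ℕ)) → ℂ := fun T' S' p =>
    if posPart p.1 = S' ∧ posPart p.2 = T' then pairTerm t x y S T p else 0 with hf
  have hfs : ∀ T' S', Summable (f T' S') := fun T' S' => by
    have := hsum.indicator {p | posPart p.1 = S' ∧ posPart p.2 = T'}
    exact this.congr fun p => by simp [hf, Set.indicator_apply]
  have hdec : ∀ p, pairTerm t x y S T p = ∑ T' ∈ T.powerset, ∑ S' ∈ S.powerset, f T' S' p := by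
    intro p
    by_cases hp : posPart p.1 ⊆ S ∧ posPart p.2 ⊆ T
    · rw [Finset.sum_eq_single_of_mem (posPart p.2) (Finset.mem_powerset.2 hp.2),
        Finset.sum_eq_single_of_mem (posPart p.1) (Finset.mem_powerset.2 hp.1)]
      · simp [hf]
      · intro S' _ h
        simp [hf, h.symm]
      · intro T' _ h
        exact Finset.sum_eq_zero fun S' _ => by simp [hf, h.symm]
    · have h0 : pairTerm t x y S T p = 0 := if_neg fun h => hp
        ⟨fun i hi => by_contra fun h' => mem_posPart.1 hi (h.1 i h'),
          fun i hi => by_contra fun h' => mem_posPart.1 hi (h.2.1 i h')⟩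
      rw [h0]
      symm
      refine Finset.sum_eq_zero fun T' _ => Finset.sum_eq_zero fun S' _ => ?_
      simp [hf, h0]
  rw [tsum_congr hdec, Summable.tsum_finsetSum fun T' _ => summable_sum fun S' _ => hfs T' S']
  refine Finset.sum_congr rfl fun T' hT' => ?_
  rw [Summable.tsum_finsetSum fun S' _ => hfs T' S']
  refine Finset.sum_congr rfl fun S' hS' => ?_
  rw [Finset.mem_powerset] at hT' hS'
  have hinj : Function.Injective (Prod.map (raise S') (raise T') :
      (ι → ℕ) × (κ → ℕ) → (ι → ℕ) × (κ → ℕ)) :=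
    (raise_injective S').prodMap (raise_injective T')
  rw [← hinj.tsum_eq, ← tsum_mul_left]
  · refine tsum_congr fun p => ?_
    simp only [hf, Prod.map_fst, Prod.map_snd, posPart_raise]
    split_ifs with h
    · exact pairTerm_raise hS' hT' hc h.1 h.2
    · rw [pairTerm, if_neg fun h' => h ⟨h'.1, h'.2.1⟩, mul_zero]
  · intro p hp
    have hp' : posPart p.1 = S' ∧ posPart p.2 = T' := by
      by_contra h
      exact hp (if_neg h)
    refine ⟨(fun i => p.1 i - 1, fun j => p.2 j - 1), ?_⟩
    rw [Prod.map_apply, ← hp'.1, ← hp'.2, raise_posPart, raise_posPart]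

theorem tsum_pairTerm_empty : ∑' p, pairTerm t x y ∅ ∅ p = 1 := by
  rw [tsum_eq_single (0, 0)]
  · simp [pairTerm, levelWeight, hlOn, SameLevels]
  · intro p hp
    refine if_neg fun h => hp ?_
    ext i
    · exact h.1 i (Finset.notMem_empty i)
    · exact h.2.1 i (Finset.notMem_empty i)

/-- The refined Cauchy identity for Hall--Littlewood polynomials of type `A`. -/
theorem tsum_pairTerm_eq_domainWall {X Y : ℝ} (hX0 : 0 ≤ X) (hY0 : 0 ≤ Y) (hX : ∀ i, ‖x i‖ ≤ X)
    (hY : ∀ j, ‖y j‖ ≤ Y) (hXY : X * Y < 1) (hx : Function.Injective x) (h0 : ∀ i, x i ≠ 0)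
    (hy : Function.Injective y) :
    ∀ (n : ℕ) (S : Finset ι) (T : Finset κ), S.card = n → T.card = n →
      ∑' p, pairTerm t x y S T p = domainWall t x (T.toList.map y) S := by
  have hxyn : ∀ i j, ‖x i * y j‖ < 1 := fun i j => by
    rw [norm_mul]
    exact (mul_le_mul (hX i) (hY j) (norm_nonneg _) hX0).trans_lt hXY
  have hxy : ∀ i j, 1 - x i * y j ≠ 0 := fun i j h => by
    have := hxyn i j
    rw [← sub_eq_zero.1 h, norm_one] at this
    exact lt_irrefl _ this
  intro n
  induction n using Nat.strong_induction_on with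
  | _ n ih =>
  intro S T hS hT
  rcases Nat.eq_zero_or_pos n with rfl | hn
  · rw [Finset.card_eq_zero] at hS hT
    subst hS hT
    rw [tsum_pairTerm_empty]
    simp [domainWall_nil]
  have hD := domainWall_eq_peel (t := t) hx h0 hy hxy T 0 S (by omega)
  rw [List.replicate_zero, List.append_nil] at hD
  have hG := tsum_pairTerm_rec (t := t) hX0 hY0 hX hY hXY (hS.trans hT.symm)
  -- Both sides have the same expansion. Proper subsets cancel by induction, or because unequal
  -- cardinalities give zero, so only `S' = S`, `T' = T` survives.
  have hsub : (∑' p, pairTerm t x y S T p) - domainWall t x (T.toList.map y) S =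
      (∏ i ∈ S, x i) * (∏ j ∈ T, y j) *
        ((∑' p, pairTerm t x y S T p) - domainWall t x (T.toList.map y) S) := by
    conv_lhs => rw [hG, hD]
    simp only [peel, rowPeel, wallWeight, Finset.mul_sum]
    rw [← Finset.sum_sub_distrib,
      Finset.sum_eq_single_of_mem T (Finset.mem_powerset_self T), ← Finset.sum_sub_distrib,
      Finset.sum_eq_single_of_mem S (Finset.mem_powerset_self S)]
    · simp [splitFactor, qFactorial_zero]
      ring
    · intro S' hS' hne
      have hlt : S'.card < S.card :=
        Finset.card_lt_card (lt_of_le_of_ne (Finset.mem_powerset.1 hS') hne)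
      have hcard : S'.card ≠ T.card := by omega
      rw [domainWall_eq_zero_of_card_ne _ S' (by simpa using hcard)]
      simp [pairTerm_eq_zero_of_card_ne hcard]
    · intro T' hT' hne
      have hlt : T'.card < T.card :=
        Finset.card_lt_card (lt_of_le_of_ne (Finset.mem_powerset.1 hT') hne)
      rw [← Finset.sum_sub_distrib]
      refine Finset.sum_eq_zero fun S' hS' => ?_
      by_cases hc : S'.card = T'.card
      · rw [ih T'.card (by omega) S' T' hc rfl]
        ring
      · rw [domainWall_eq_zero_of_card_ne _ S' (by simpa using hc)]
        simp [pairTerm_eq_zero_of_card_ne hc]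
  have hlt : ‖(∏ i ∈ S, x i) * ∏ j ∈ T, y j‖ < 1 := by
    rw [norm_mul, norm_prod, norm_prod]
    calc (∏ i ∈ S, ‖x i‖) * ∏ j ∈ T, ‖y j‖ ≤ (∏ _i ∈ S, X) * ∏ _j ∈ T, Y :=
          mul_le_mul (Finset.prod_le_prod (fun _ _ => norm_nonneg _) fun i _ => hX i)
            (Finset.prod_le_prod (fun _ _ => norm_nonneg _) fun i _ => hY i)
            (Finset.prod_nonneg fun _ _ => norm_nonneg _) (Finset.prod_nonneg fun _ _ => hX0)
      _ = (X * Y) ^ n := by rw [Finset.prod_const, Finset.prod_const, hS, hT, mul_pow]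
      _ < 1 := pow_lt_one₀ (mul_nonneg hX0 hY0) hXY hn.ne'
  have hne : 1 - (∏ i ∈ S, x i) * ∏ j ∈ T, y j ≠ 0 := fun h => by
    rw [← sub_eq_zero.1 h, norm_one] at hlt
    exact lt_irrefl _ hlt
  have : (1 - (∏ i ∈ S, x i) * ∏ j ∈ T, y j) *
      ((∑' p, pairTerm t x y S T p) - domainWall t x (T.toList.map y) S) = 0 := by
    linear_combination hsub
  exact sub_eq_zero.1 ((mul_eq_zero.1 this).resolve_left hne)

end PairSum

/-! ### From pairs of rearrangements to partitions, and the sum over signs. -/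

section Partitions

variable {n : ℕ} {t : ℂ} {x y : Fin n → ℂ}

theorem mult_comp_perm (a : Fin n → ℕ) (σ : Equiv.Perm (Fin n)) (k : ℕ) :
    mult (a ∘ σ) k = mult a k :=
  Finset.card_bij (fun i _ => σ i) (fun i hi => by simpa using hi)
    (fun _ _ _ _ h => σ.injective h)
    fun j hj => ⟨σ.symm j, by simpa using hj, by simp⟩

theorem exists_perm_of_mult_eq {a b : Fin n → ℕ} (h : ∀ k, mult a k = mult b k) :
    ∃ σ : Equiv.Perm (Fin n), a = b ∘ σ := by
  have e : ∀ k, Nonempty ({i // a i = k} ≃ {i // b i = k}) := fun k => by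
    rw [← Fintype.card_eq, Fintype.card_subtype, Fintype.card_subtype]
    exact h k
  refine ⟨Equiv.ofFiberEquiv fun k => (e k).some, ?_⟩
  funext i
  exact (Equiv.ofFiberEquiv_map _ i).symm

theorem mem_orbit_iff {a lam : Fin n → ℕ} : a ∈ orbit lam ↔ ∀ k, mult a k = mult lam k := by
  rw [orbit, Finset.mem_image]
  constructor
  · rintro ⟨σ, -, rfl⟩ k
    exact mult_comp_perm lam σ k
  · intro h
    obtain ⟨σ, rfl⟩ := exists_perm_of_mult_eq h
    exact ⟨σ, Finset.mem_univ _, rfl⟩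

theorem exists_part_mult_eq (a : Fin n → ℕ) : ∃ lam : Part n, ∀ k, mult a k = mult lam.1 k := by
  refine ⟨⟨a ∘ (Tuple.sort a) ∘ Fin.rev,
    fun i j h => Tuple.monotone_sort a (Fin.rev_le_rev.2 h)⟩, fun k => ?_⟩
  exact (mult_comp_perm a (Fin.revPerm.trans (Tuple.sort a)) k).symm

theorem Part.eq_of_mult_eq {lam mu : Part n} (h : ∀ k, mult lam.1 k = mult mu.1 k) : lam = mu := by
  obtain ⟨σ, hσ⟩ := exists_perm_of_mult_eq h
  have h1 : Monotone (mu.1 ∘ (Fin.revPerm : Equiv.Perm (Fin n))) :=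
    fun i j hij => mu.2 (Fin.rev_le_rev.2 hij)
  have h2 : Monotone (mu.1 ∘ (Fin.revPerm.trans σ : Equiv.Perm (Fin n))) := by
    intro i j hij
    have : lam.1 (Fin.rev i) ≤ lam.1 (Fin.rev j) := lam.2 (Fin.rev_le_rev.2 hij)
    rw [hσ] at this
    exact this
  have h3 := Tuple.unique_monotone h1 h2
  refine Subtype.ext (funext fun i => ?_)
  have := congrFun h3 (Fin.rev i)
  simp only [Function.comp_apply, Fin.revPerm_apply, Fin.rev_rev, Equiv.trans_apply] at this
  rw [hσ, this]
  rfl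

theorem levelWeight_univ (t : ℂ) (lam : Fin n → ℕ) :
    levelWeight t Finset.univ lam =
      (∏ i ∈ Finset.Icc 1 (mult lam 0), (1 - t ^ i)) * bFactor t lam := by
  rw [levelWeight_eq_prod (K := insert 0 ((Finset.univ.image lam).filter fun j => 1 ≤ j)),
    Finset.prod_insert]
  · rfl
  · simp
  · intro k hk
    rcases Nat.eq_zero_or_pos k with rfl | h
    · exact Finset.mem_insert_self _ _
    · exact Finset.mem_insert_of_mem (Finset.mem_filter.2 ⟨hk, h⟩)

theorem levelWeight_eq_of_mult_eq {a b : Fin n → ℕ} (h : ∀ k, mult a k = mult b k) :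
    levelWeight t Finset.univ a = levelWeight t Finset.univ b := by
  have h' : SameLevels Finset.univ Finset.univ a b := h
  rw [levelWeight, levelWeight, h'.image_eq]
  exact Finset.prod_congr rfl fun k _ => by rw [h' k]

/-- A pair with nonzero term has a common sorted partition, so the pairs form the disjoint union
over λ of products of two orbits; on each piece the level weight is constant and the sum factors. -/
theorem hasSum_part (hs : Summable (pairTerm t x y Finset.univ Finset.univ)) :
    HasSum (fun lam : Part n => (∏ i ∈ Finset.Icc 1 (mult lam.1 0), (1 - t ^ i)) *
        bFactor t lam.1 * hallLittlewoodP t lam.1 x * hallLittlewoodP t lam.1 y)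
      (∑' p, pairTerm t x y Finset.univ Finset.univ p) := by
  set ψ : (Σ lam : Part n, {p // p ∈ orbit lam.1 ×ˢ orbit lam.1}) → (Fin n → ℕ) × (Fin n → ℕ) :=
    fun s => s.2.1 with hψ
  have hinj : Function.Injective ψ := by
    rintro ⟨lam, ⟨⟨a, b⟩, hab⟩⟩ ⟨mu, ⟨⟨a', b'⟩, hab'⟩⟩ h
    have h' : (a, b) = (a', b') := h
    have e : lam = mu := by
      refine Part.eq_of_mult_eq fun k => ?_
      rw [Finset.mem_product] at hab hab'
      rw [← mem_orbit_iff.1 hab.1, ← mem_orbit_iff.1 hab'.1, (Prod.ext_iff.1 h').1]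
    subst e
    simp only [h']
  have hrange : ∀ p ∉ Set.range ψ, pairTerm t x y Finset.univ Finset.univ p = 0 := by
    intro p hp
    refine if_neg fun h => hp ?_
    obtain ⟨lam, hlam⟩ := exists_part_mult_eq p.1
    refine ⟨⟨lam, ⟨p, Finset.mem_product.2 ⟨mem_orbit_iff.2 hlam, mem_orbit_iff.2 fun k => ?_⟩⟩⟩,
      rfl⟩
    rw [← hlam k]
    exact (h.2.2 k).symm
  refine ((hinj.hasSum_iff hrange).2 hs.hasSum).sigma fun lam => ?_
  have hfib := hasSum_fintype fun p : {p // p ∈ orbit lam.1 ×ˢ orbit lam.1} =>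
    pairTerm t x y Finset.univ Finset.univ p.1
  suffices hval : (∏ i ∈ Finset.Icc 1 (mult lam.1 0), (1 - t ^ i)) * bFactor t lam.1 *
      hallLittlewoodP t lam.1 x * hallLittlewoodP t lam.1 y =
      ∑ p : {p // p ∈ orbit lam.1 ×ˢ orbit lam.1},
        pairTerm t x y Finset.univ Finset.univ p.1 by
    rw [hval]
    exact hfib
  rw [Finset.sum_coe_sort (orbit lam.1 ×ˢ orbit lam.1)
    (fun p => pairTerm t x y Finset.univ Finset.univ p), Finset.sum_product, hallLittlewoodP,
    hallLittlewoodP, ← levelWeight_univ, mul_assoc, Finset.sum_mul_sum,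
    Finset.mul_sum]
  refine Finset.sum_congr rfl fun a ha => ?_
  rw [Finset.mul_sum]
  refine Finset.sum_congr rfl fun b hb => ?_
  rw [mem_orbit_iff] at ha hb
  rw [pairTerm, if_pos ⟨fun i hi => absurd (Finset.mem_univ i) hi,
    fun i hi => absurd (Finset.mem_univ i) hi, fun k => (ha k).trans (hb k).symm⟩,
    levelWeight_eq_of_mult_eq ha, mul_assoc]
  rfl

/-- The maxima of both families are attained, and their product is one of the products assumed to be
less than 1. -/
theorem exists_norm_bounds (hxy : ∀ i j, ‖x i * y j‖ < 1) :
    ∃ X Y : ℝ, 0 ≤ X ∧ 0 ≤ Y ∧ (∀ i, ‖x i‖ ≤ X) ∧ (∀ j, ‖y j‖ ≤ Y) ∧ X * Y < 1 := by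
  rcases Nat.eq_zero_or_pos n with rfl | hn
  · exact ⟨0, 0, le_rfl, le_rfl, fun i => i.elim0, fun i => i.elim0, by norm_num⟩
  · have : Nonempty (Fin n) := ⟨⟨0, hn⟩⟩
    obtain ⟨i, hi⟩ := Finite.exists_max fun i => ‖x i‖
    obtain ⟨j, hj⟩ := Finite.exists_max fun j => ‖y j‖
    exact ⟨‖x i‖, ‖y j‖, norm_nonneg _, norm_nonneg _, hi, hj, by rw [← norm_mul]; exact hxy i j⟩

theorem hasSum_hallLittlewood_cauchy (hx : Function.Injective x) (h0 : ∀ i, x i ≠ 0)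
    (hy : Function.Injective y) (hxy : ∀ i j, ‖x i * y j‖ < 1) :
    HasSum (fun lam : Part n => (∏ i ∈ Finset.Icc 1 (mult lam.1 0), (1 - t ^ i)) *
        bFactor t lam.1 * hallLittlewoodP t lam.1 x * hallLittlewoodP t lam.1 y)
      (domainWall t x (List.ofFn y) Finset.univ) := by
  obtain ⟨X, Y, hX0, hY0, hX, hY, hXY⟩ := exists_norm_bounds hxy
  have h := hasSum_part (summable_pairTerm (t := t) hX0 hY0 hX hY hXY Finset.univ Finset.univ)
  rw [tsum_pairTerm_eq_domainWall hX0 hY0 hX hY hXY hx h0 hy n _ _ (by simp) (by simp),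
    domainWall_perm _ (fun i _ k _ h e => h (hx e))] at h
  · exact h
  · intro i _ z hz e
    obtain ⟨j, -, rfl⟩ := List.mem_map.1 hz
    have := hxy i j
    rw [← sub_eq_zero.1 e, norm_one] at this
    exact lt_irrefl _ this
  · rw [List.ofFn_eq_map]
    refine List.Perm.map _ ((List.perm_ext_iff_of_nodup (Finset.nodup_toList _)
      (List.nodup_finRange n)).2 fun i => by simp)

/-- The symmetrization over signs of the domain wall partition function. -/
def signedDomainWall (t : ℂ) (x : Fin n → ℂ) (L : List ℂ) : ℂ :=
  ∑ e : Fin n → Bool, bcFactor t (signFlip e x) * domainWall t (signFlip e x) L Finset.univ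

theorem signFlip_ne_zero (h0 : ∀ i, x i ≠ 0) (e : Fin n → Bool) (i : Fin n) :
    signFlip e x i ≠ 0 := by
  rw [signFlip]
  split_ifs
  · exact inv_ne_zero (h0 i)
  · exact h0 i

theorem signFlip_injective (h0 : ∀ i, x i ≠ 0)
    (hxx : ∀ i j, i < j → x i ≠ x j ∧ x i * x j ≠ 1) (e : Fin n → Bool) :
    Function.Injective (signFlip e x) := by
  have key : ∀ i j, i < j → signFlip e x i ≠ signFlip e x j := by
    intro i j hij h
    obtain ⟨h1, h2⟩ := hxx i j hij
    simp only [signFlip] at h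
    split_ifs at h
    · exact h1 (inv_injective h)
    · exact h2 (by rw [← h, mul_inv_cancel₀ (h0 i)])
    · exact h2 (by rw [h, inv_mul_cancel₀ (h0 j)])
    · exact h1 h
  intro i j h
  by_contra hne
  rcases lt_or_gt_of_ne hne with hlt | hlt
  · exact key i j hlt h
  · exact key j i hlt h.symm

theorem hasSum_hallLittlewoodK (h0 : ∀ i, x i ≠ 0)
    (hxx : ∀ i j, i < j → x i ≠ x j ∧ x i * x j ≠ 1) (hy : Function.Injective y)
    (hxy : ∀ i j, ‖x i * y j‖ < 1 ∧ ‖(x i)⁻¹ * y j‖ < 1) :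
    HasSum (fun lam : Part n => (∏ i ∈ Finset.Icc 1 (mult lam.1 0), (1 - t ^ i)) *
        bFactor t lam.1 * hallLittlewoodK t lam.1 x * hallLittlewoodP t lam.1 y)
      (signedDomainWall t x (List.ofFn y)) := by
  have hn : ∀ (e : Fin n → Bool) i j, ‖signFlip e x i * y j‖ < 1 := by
    intro e i j
    rw [signFlip]
    split_ifs
    · exact (hxy i j).2
    · exact (hxy i j).1
  have h := hasSum_sum (s := (Finset.univ : Finset (Fin n → Bool))) fun e _ =>
    (hasSum_hallLittlewood_cauchy (t := t) (signFlip_injective h0 hxx e) (signFlip_ne_zero h0 e) hy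
      (hn e)).mul_left (bcFactor t (signFlip e x))
  refine h.congr_fun ?_
  intro lam
  rw [hallLittlewoodK, Finset.mul_sum, Finset.sum_mul]
  refine Finset.sum_congr rfl fun e _ => ?_
  rw [← Finset.sum_mul, hallLittlewoodP, hallLittlewoodP]
  ring

end Partitions

/-! ### The column recursion of the signed domain wall function. -/

section SignedRecursion

variable {n : ℕ} {t : ℂ}

theorem prod_prod_lt_succAbove (f : Fin (n + 1) → Fin (n + 1) → ℂ) (i : Fin (n + 1)) :
    ∏ a, ∏ b ∈ Finset.univ.filter (fun b => a < b), f a b =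
      (∏ k, if i < i.succAbove k then f i (i.succAbove k) else f (i.succAbove k) i) *
        ∏ k, ∏ l ∈ Finset.univ.filter (fun l => k < l), f (i.succAbove k) (i.succAbove l) := by
  simp only [Finset.prod_filter]
  rw [Fin.prod_univ_succAbove _ i, Fin.prod_univ_succAbove _ i, if_neg (lt_irrefl _), one_mul]
  have h : ∀ k, ∏ b, (if i.succAbove k < b then f (i.succAbove k) b else 1) =
      (if i.succAbove k < i then f (i.succAbove k) i else 1) *
        ∏ l, if k < l then f (i.succAbove k) (i.succAbove l) else 1 := fun k => by
    rw [Fin.prod_univ_succAbove _ i]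
    simp only [Fin.succAbove_lt_succAbove_iff]
  rw [Finset.prod_congr rfl fun k _ => h k, Finset.prod_mul_distrib, ← mul_assoc,
    ← Finset.prod_mul_distrib]
  congr 1
  refine Finset.prod_congr rfl fun k _ => ?_
  rcases lt_or_gt_of_ne (Fin.succAbove_ne i k) with hk | hk
  · rw [if_neg hk.not_gt, if_pos hk, if_neg hk.not_gt, one_mul]
  · rw [if_pos hk, if_neg hk.not_gt, if_pos hk, mul_one]

theorem bcFactor_succAbove (t : ℂ) (x : Fin (n + 1) → ℂ) (i : Fin (n + 1)) :
    bcFactor t x = 1 / (1 - (x i)⁻¹ ^ 2) *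
      (∏ k, (1 - t * (x i)⁻¹ * (x (i.succAbove k))⁻¹) / (1 - (x i)⁻¹ * (x (i.succAbove k))⁻¹)) *
        bcFactor t fun k => x (i.succAbove k) := by
  rw [bcFactor, bcFactor, prod_prod_lt_succAbove _ i, Fin.prod_univ_succAbove _ i]
  have h : ∀ k, (if i < i.succAbove k then
        (1 - t * (x i)⁻¹ * (x (i.succAbove k))⁻¹) / (1 - (x i)⁻¹ * (x (i.succAbove k))⁻¹)
      else (1 - t * (x (i.succAbove k))⁻¹ * (x i)⁻¹) / (1 - (x (i.succAbove k))⁻¹ * (x i)⁻¹)) =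
      (1 - t * (x i)⁻¹ * (x (i.succAbove k))⁻¹) / (1 - (x i)⁻¹ * (x (i.succAbove k))⁻¹) := by
    intro k
    split_ifs
    · rfl
    · rw [mul_right_comm, mul_comm (x (i.succAbove k))⁻¹]
  rw [Finset.prod_congr rfl fun k _ => h k]
  ring

theorem signFlip_trace (e : Fin n → Bool) (x : Fin n → ℂ) (i : Fin n) :
    signFlip e x i + (signFlip e x i)⁻¹ = x i + (x i)⁻¹ := by
  rw [signFlip]
  split_ifs
  · rw [inv_inv, add_comm]
  · rfl

/-- The contribution of the pole at `z = w⁻¹` to the recursion in the column parameter `z`. The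
numbers `T k` are the traces `x_k + x_k⁻¹` of the other row parameters. -/
def poleCoeff (t w z : ℂ) (T : Fin n → ℂ) (L : List ℂ) : ℂ :=
  (1 - t) / (1 - w * z) * (1 / (1 - w⁻¹ ^ 2)) *
    (∏ k, (w + t ^ 2 * w⁻¹ - t * T k) / (w + w⁻¹ - T k)) *
    (L.map fun z => (1 - t * w * z) / (1 - w * z)).prod

/-- Multiplying the type BC and the type A factor makes numerator and denominator separately
invariant under inversion of `v`. This invariance decouples the sign of one row from those of the
others. -/
theorem exchange_factor_trace {w v : ℂ} (hw : w ≠ 0) (hv : v ≠ 0) :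
    (1 - t * w⁻¹ * v⁻¹) / (1 - w⁻¹ * v⁻¹) * ((w - t * v) / (w - v)) =
      (w + t ^ 2 * w⁻¹ - t * (v + v⁻¹)) / (w + w⁻¹ - (v + v⁻¹)) := by
  rw [div_mul_div_comm]
  congr 1 <;> field_simp <;> ring

/-- Let row `i` meet the first column and split off its sign. Its interaction with every other row
depends only on a trace, so it leaves the sum over the remaining signs. -/
theorem signedDomainWall_cons (x : Fin (n + 1) → ℂ) (h0 : ∀ i, x i ≠ 0) (z : ℂ) (L : List ℂ) :
    signedDomainWall t x (z :: L) = ∑ i, ∑ b : Bool,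
      poleCoeff t (if b then (x i)⁻¹ else x i) z
        (fun k => x (i.succAbove k) + (x (i.succAbove k))⁻¹) L *
        signedDomainWall t (fun k => x (i.succAbove k)) L := by
  simp only [signedDomainWall, domainWall_cons, Finset.mul_sum]
  rw [Finset.sum_comm]
  refine Finset.sum_congr rfl fun i _ => ?_
  rw [← (Fin.insertNthEquiv (fun _ => Bool) i).sum_comp, Fintype.sum_prod_type]
  refine Finset.sum_congr rfl fun b _ => Finset.sum_congr rfl fun e _ => ?_
  have e1 : Finset.univ.erase i = Finset.univ.map (Fin.succAboveEmb i) := by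
    ext k
    simp only [Finset.mem_erase, Finset.mem_univ, and_true, Finset.mem_map, true_and,
      Fin.succAboveEmb_apply]
    exact (Fin.exists_succAbove_eq_iff (x := i)).symm
  have e2 : signFlip (Fin.insertNthEquiv (fun _ => Bool) i (b, e)) x i =
      if b then (x i)⁻¹ else x i := by
    simp [signFlip]
  have e3 : ∀ k, signFlip (Fin.insertNthEquiv (fun _ => Bool) i (b, e)) x (i.succAbove k) =
      signFlip e (fun k => x (i.succAbove k)) k := by
    intro k
    simp [signFlip]
  rw [bcFactor_succAbove t _ i, e1, Finset.prod_map, domainWall_map]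
  simp only [Fin.succAboveEmb_apply, e2, e3]
  have hw : (if b then (x i)⁻¹ else x i) ≠ 0 := by
    split_ifs
    · exact inv_ne_zero (h0 i)
    · exact h0 i
  set w := if b then (x i)⁻¹ else x i
  have e4 : poleCoeff t w z (fun k => x (i.succAbove k) + (x (i.succAbove k))⁻¹) L =
      (1 - t) / (1 - w * z) * (1 / (1 - w⁻¹ ^ 2)) *
      ((∏ k, (1 - t * w⁻¹ * (signFlip e (fun k => x (i.succAbove k)) k)⁻¹) /
        (1 - w⁻¹ * (signFlip e (fun k => x (i.succAbove k)) k)⁻¹)) *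
        ∏ k, (w - t * signFlip e (fun k => x (i.succAbove k)) k) /
          (w - signFlip e (fun k => x (i.succAbove k)) k)) *
      (L.map fun z => (1 - t * w * z) / (1 - w * z)).prod := by
    rw [poleCoeff, ← Finset.prod_mul_distrib]
    congr 2
    refine Finset.prod_congr rfl fun k _ => ?_
    rw [exchange_factor_trace hw (signFlip_ne_zero (fun k => h0 _) e k), signFlip_trace]
  rw [e4]
  ring

end SignedRecursion

/-! ### Divisibility of the numerator and Lagrange interpolation at reciprocal nodes. -/

section PoleExpansion

open Polynomial

variable {I J : Type*} [Fintype I] [Fintype J] [DecidableEq I] [DecidableEq J] {t : ℂ}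

/-- `(1 - x z) (1 - x⁻¹ z)` as a polynomial in `z`, with `T = x + x⁻¹`. -/
def quadP (T : ℂ) : ℂ[X] := X ^ 2 - C T * X + 1

/-- `(1 - t x z) (1 - t x⁻¹ z)` as a polynomial in `z`, with `T = x + x⁻¹`. -/
def quadQ (t T : ℂ) : ℂ[X] := C (t ^ 2) * X ^ 2 - C (t * T) * X + 1

/-- `(z - y) (1 - t y z)` as a polynomial in `z`. -/
def wallPoly (t y : ℂ) : ℂ[X] := (X - C y) * (1 - C (t * y) * X)

theorem eval_quadP (T z : ℂ) : (quadP T).eval z = z ^ 2 - T * z + 1 := by simp [quadP]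

theorem eval_quadQ (t T z : ℂ) : (quadQ t T).eval z = t ^ 2 * z ^ 2 - t * T * z + 1 := by
  simp [quadQ]

theorem eval_wallPoly (t y z : ℂ) : (wallPoly t y).eval z = (z - y) * (1 - t * y * z) := by
  simp [wallPoly]

/-- With β = 1 + tz², the quartic is the quadratic form β² - (1 + t)Tzβ + ((1 - t)² + tT²)z² in z
and β, and `wallPoly t y` is (1 + ty²)z - yβ. Modulo the latter, (z, β) is proportional to its value
at `y`; the quotient is read off from the form. The argument is algebraic, so a double root or a
missing second root does no harm. -/
theorem wallPoly_dvd_sq_mul_sub (t y T : ℂ) :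
    wallPoly t y ∣ C ((1 + t * y ^ 2) ^ 2) * (quadP T * quadQ t T) -
      (1 + C t * X ^ 2) ^ 2 * C ((quadP T * quadQ t T).eval y) := by
  refine ⟨-(C ((1 + t) * T * (1 + t * y ^ 2)) * (1 + C t * X ^ 2)) +
    C ((1 - t) ^ 2 + t * T ^ 2) *
      (C (1 + t * y ^ 2) * X + C y * (1 + C t * X ^ 2)), ?_⟩
  rw [eval_mul, eval_quadP, eval_quadQ, wallPoly, quadP, quadQ]
  simp only [C_mul, C_add, C_sub, C_pow, C_1]
  ring

theorem wallPoly_dvd_sq_mul_sub' (t y T : ℂ) :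
    wallPoly t y ∣ C (y ^ 2) * (quadP T * quadQ t T) -
      X ^ 2 * C ((quadP T * quadQ t T).eval y) := by
  refine ⟨-(C (1 + t * y ^ 2) * X + C y * (1 + C t * X ^ 2)) +
    C ((1 + t) * T * y) * X, ?_⟩
  rw [eval_mul, eval_quadP, eval_quadQ, wallPoly, quadP, quadQ]
  simp only [C_mul, C_add, C_sub, C_pow, C_1]
  ring

/-- A linear combination of products of all but one of the quartics `quadP * quadQ`. -/
def poleNumerator (t : ℂ) (T c : I → ℂ) : ℂ[X] :=
  ∑ i, C (c i) * ∏ k ∈ Finset.univ.erase i, (quadP (T k) * quadQ t (T k))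

/-- Every summand has the same number of quartic factors, so the congruences multiply to a single
one: modulo `W`, the numerator is a common multiple of its value at `y`. -/
theorem dvd_poleNumerator_of_dvd_sub {W B : ℂ[X]} {a y : ℂ} {T : I → ℂ} {c : I → ℂ} (ha : a ≠ 0)
    (h : ∀ i, W ∣ C a * (quadP (T i) * quadQ t (T i)) -
      B * C ((quadP (T i) * quadQ t (T i)).eval y))
    (h0 : (poleNumerator t T c).eval y = 0) : W ∣ poleNumerator t T c := by
  have hq : ∀ i, Ideal.Quotient.mk (Ideal.span {W}) (C a * (quadP (T i) * quadQ t (T i))) =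
      Ideal.Quotient.mk (Ideal.span {W}) (B * C ((quadP (T i) * quadQ t (T i)).eval y)) :=
    fun i => Ideal.Quotient.eq.2 (Ideal.mem_span_singleton.2 (h i))
  have key : Ideal.Quotient.mk (Ideal.span {W})
      (C (a ^ (Fintype.card I - 1)) * poleNumerator t T c) =
      Ideal.Quotient.mk (Ideal.span {W})
        (B ^ (Fintype.card I - 1) * C ((poleNumerator t T c).eval y)) := by
    simp only [poleNumerator, eval_finsetSum, eval_mul, eval_prod, eval_C, map_sum, map_mul,
      map_prod, map_pow, Finset.mul_sum]
    refine Finset.sum_congr rfl fun i _ => ?_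
    have hc : (Finset.univ.erase i).card = Fintype.card I - 1 := by
      rw [Finset.card_erase_of_mem (Finset.mem_univ i), Finset.card_univ]
    rw [← hc, mul_left_comm, mul_left_comm _ (Ideal.Quotient.mk (Ideal.span {W}) (C (c i))),
      ← Finset.prod_const, ← Finset.prod_const, ← Finset.prod_mul_distrib,
      ← Finset.prod_mul_distrib]
    congr 1
    refine Finset.prod_congr rfl fun k _ => ?_
    have := hq k
    simpa only [map_mul, eval_mul] using this
  rw [h0, C_0, mul_zero, map_zero, Ideal.Quotient.eq_zero_iff_mem, Ideal.mem_span_singleton] at key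
  have hu : IsUnit (C (a ^ (Fintype.card I - 1))) :=
    Polynomial.isUnit_C.2 (isUnit_iff_ne_zero.2 (pow_ne_zero _ ha))
  exact hu.dvd_mul_left.1 key

/-- The two normalizations of the congruence cover all cases: if `1 + t * y ^ 2` vanishes, then `y`
does not. -/
theorem wallPoly_dvd_poleNumerator {y : ℂ} {T c : I → ℂ}
    (h0 : (poleNumerator t T c).eval y = 0) : wallPoly t y ∣ poleNumerator t T c := by
  by_cases h : 1 + t * y ^ 2 = 0
  · have hy : y ≠ 0 := by
      rintro rfl
      simp at h
    exact dvd_poleNumerator_of_dvd_sub (pow_ne_zero 2 hy)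
      (fun i => wallPoly_dvd_sq_mul_sub' t y (T i)) h0
  · exact dvd_poleNumerator_of_dvd_sub (pow_ne_zero 2 h)
      (fun i => wallPoly_dvd_sq_mul_sub t y (T i)) h0

theorem isCoprime_wallPoly {y z : ℂ} (h : y ≠ z) (h' : t * y * z ≠ 1) :
    IsCoprime (wallPoly t y) (wallPoly t z) := by
  set d := (z - y) * (1 - t * y * z) with hd
  have hd0 : d ≠ 0 := mul_ne_zero (sub_ne_zero.2 h.symm) (sub_ne_zero.2 h'.symm)
  -- With W_y = (1 + ty²)X - y(1 + tX²), eliminating the term in X leaves d(1 + tX²), eliminating 1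
  -- + tX² leaves a multiple of X; subtracting tX times the latter from the former leaves the
  -- constant d.
  refine ⟨C d⁻¹ * (C (1 + t * z ^ 2) - C (t * z) * X),
    C d⁻¹ * (-C (1 + t * y ^ 2) + C (t * y) * X), ?_⟩
  have e : (C (1 + t * z ^ 2) - C (t * z) * X) * wallPoly t y +
      (-C (1 + t * y ^ 2) + C (t * y) * X) * wallPoly t z = C d := by
    rw [hd, wallPoly, wallPoly]
    simp only [C_mul, C_add, C_sub, C_pow, C_1]
    ring
  rw [mul_assoc, mul_assoc, ← mul_add, e, ← C_mul, inv_mul_cancel₀ hd0, C_1]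

theorem natDegree_quad_mul_le (t T : ℂ) : (quadP T * quadQ t T).natDegree ≤ 4 := by
  rw [quadP, quadQ]
  compute_degree

theorem natDegree_quad_zero_mul_le (T : ℂ) : (quadP T * quadQ 0 T).natDegree ≤ 2 := by
  have : quadQ 0 T = 1 := by simp [quadQ]
  rw [this, mul_one, quadP]
  compute_degree

theorem natDegree_poleNumerator_le {d : ℕ} {T : I → ℂ} (c : I → ℂ)
    (h : ∀ i, (quadP (T i) * quadQ t (T i)).natDegree ≤ d) :
    (poleNumerator t T c).natDegree ≤ (Fintype.card I - 1) * d := by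
  refine natDegree_sum_le_of_forall_le _ _ fun i _ => ?_
  refine (natDegree_C_mul_le _ _).trans ((natDegree_prod_le _ _).trans ?_)
  refine (Finset.sum_le_sum fun k _ => h k).trans ?_
  rw [Finset.sum_const, Finset.card_erase_of_mem (Finset.mem_univ i), Finset.card_univ,
    smul_eq_mul]

theorem wallPoly_ne_zero (t y : ℂ) : wallPoly t y ≠ 0 := by
  refine mul_ne_zero (X_sub_C_ne_zero y) fun h => ?_
  have := congrArg (eval 0) h
  simp at this

theorem natDegree_wallPoly (ht : t ≠ 0) (y : ℂ) :
    2 ≤ (wallPoly t y).natDegree + if y = 0 then 1 else 0 := by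
  have h1 : (1 - C (t * y) * X : ℂ[X]) ≠ 0 := right_ne_zero_of_mul (wallPoly_ne_zero t y)
  rw [wallPoly, natDegree_mul (X_sub_C_ne_zero y) h1, natDegree_X_sub_C]
  split_ifs with h
  · omega
  · have : (1 - C (t * y) * X : ℂ[X]) = -(C (t * y)) * X + C 1 := by
      rw [C_1]; ring
    rw [this, ← C_neg, natDegree_linear (neg_ne_zero.2 (mul_ne_zero ht h))]

/-- For `t ≠ 0` the numerator has degree at most 4(|I| - 1), and dividing by |J| = |I| - 1
quadratics leaves 2(|I| - 1). At most one `y j` is zero, which costs one degree and still stays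
below 2|I|. For `t = 0` the numerator itself has degree at most 2(|I| - 1). -/
theorem natDegree_lt_of_prod_wallPoly_mul_eq (hcard : Fintype.card I = Fintype.card J + 1)
    {y : J → ℂ} (hy : Function.Injective y) {T c : I → ℂ} {V : ℂ[X]}
    (h : poleNumerator t T c = (∏ j, wallPoly t (y j)) * V) :
    V.natDegree < 2 * Fintype.card I := by
  rcases eq_or_ne V 0 with rfl | hV
  · rw [natDegree_zero]; omega
  have hW : ∏ j, wallPoly t (y j) ≠ 0 := Finset.prod_ne_zero_iff.2 fun j _ => wallPoly_ne_zero t _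
  have hdeg : (poleNumerator t T c).natDegree =
      ∑ j, (wallPoly t (y j)).natDegree + V.natDegree := by
    rw [h, natDegree_mul hW hV, natDegree_prod _ _ fun j _ => wallPoly_ne_zero t _]
  rcases eq_or_ne t 0 with rfl | ht
  · have := natDegree_poleNumerator_le (t := 0) (T := T) c fun i => natDegree_quad_zero_mul_le _
    omega
  · have h1 := natDegree_poleNumerator_le (t := t) (T := T) c fun i => natDegree_quad_mul_le _ _
    have h2 : ∑ _j : J, 2 ≤ ∑ j, ((wallPoly t (y j)).natDegree + if y j = 0 then 1 else 0) :=
      Finset.sum_le_sum fun j _ => natDegree_wallPoly ht (y j)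
    have h3 : ∑ j, (if y j = 0 then 1 else 0) ≤ 1 := by
      rw [← Finset.card_filter, Finset.card_le_one]
      intro a ha b hb
      exact hy ((Finset.mem_filter.1 ha).2.trans (Finset.mem_filter.1 hb).2.symm)
    rw [Finset.sum_add_distrib, Finset.sum_const, Finset.card_univ, smul_eq_mul] at h2
    omega

/-- The pair of reciprocal nodes `x i`, `(x i)⁻¹`. -/
def node (x : I → ℂ) (s : I × Bool) : ℂ := if s.2 then (x s.1)⁻¹ else x s.1

theorem prod_sub_node (x : I → ℂ) (h0 : ∀ i, x i ≠ 0) (z : ℂ) (i : I) :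
    ∏ b, (z - node x (i, b)) = (quadP (x i + (x i)⁻¹)).eval z := by
  rw [Fintype.prod_bool, eval_quadP]
  simp only [node, if_true, Bool.false_eq_true, if_false]
  have := mul_inv_cancel₀ (h0 i)
  linear_combination this

theorem node_injective {x : I → ℂ} (h0 : ∀ i, x i ≠ 0) (h1 : ∀ i, x i ^ 2 ≠ 1)
    (hxx : ∀ i j, i ≠ j → x i ≠ x j ∧ x i * x j ≠ 1) : Function.Injective (node x) := by
  have hinv : ∀ i j, x i = (x j)⁻¹ → x i * x j = 1 := fun i j h => by
    rw [h, inv_mul_cancel₀ (h0 j)]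
  rintro ⟨i, b⟩ ⟨j, b'⟩ h
  have hij : i = j := by
    by_contra hne
    obtain ⟨g1, g2⟩ := hxx i j hne
    cases b <;> cases b' <;> simp only [node, if_true, Bool.false_eq_true, if_false] at h
    · exact g1 h
    · exact g2 (hinv _ _ h)
    · exact g2 (by rw [mul_comm]; exact hinv _ _ h.symm)
    · exact g1 (inv_injective h)
  subst hij
  have hb : b = b' := by
    cases b <;> cases b' <;> simp only [node, if_true, Bool.false_eq_true, if_false] at h
    · rfl
    · exact absurd (by rw [sq]; exact hinv _ _ h) (h1 i)
    · exact absurd (by rw [sq]; exact hinv _ _ h.symm) (h1 i)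
    · rfl
  rw [hb]

theorem nodalWeight_node {x : I → ℂ} (h0 : ∀ i, x i ≠ 0) (s : I × Bool) :
    Lagrange.nodalWeight Finset.univ (node x) s =
      ((node x s - (node x s)⁻¹) *
        ∏ k ∈ Finset.univ.erase s.1, (quadP (x k + (x k)⁻¹)).eval (node x s))⁻¹ := by
  obtain ⟨i, b⟩ := s
  rw [Lagrange.nodalWeight, Finset.prod_inv_distrib]
  congr 1
  have e : ∏ s ∈ Finset.univ.erase (i, b), (node x (i, b) - node x s) =
      ∏ s, if s = (i, b) then 1 else node x (i, b) - node x s := by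
    rw [← Finset.mul_prod_erase _ _ (Finset.mem_univ (i, b)), if_pos rfl, one_mul]
    exact Finset.prod_congr rfl fun s hs => (if_neg (Finset.ne_of_mem_erase hs)).symm
  rw [e, Fintype.prod_prod_type, ← Finset.mul_prod_erase _ _ (Finset.mem_univ i)]
  congr 1
  · cases b <;> simp [node]
  · refine Finset.prod_congr rfl fun k hk => ?_
    rw [← prod_sub_node x h0]
    refine Finset.prod_congr rfl fun b' _ => if_neg fun h => ?_
    exact Finset.ne_of_mem_erase hk (Prod.ext_iff.1 h).1

theorem eval_quadP_node {x : I → ℂ} (h0 : ∀ i, x i ≠ 0) (s : I × Bool) :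
    (quadP (x s.1 + (x s.1)⁻¹)).eval (node x s) = 0 := by
  rw [← prod_sub_node x h0]
  exact Finset.prod_eq_zero (Finset.mem_univ s.2) (sub_self _)

/-- The left side is V(z) over the product of the `quadP`, where V is the numerator divided by all
wall polynomials. As deg V < 2|I|, interpolation at the 2|I| nodes is its partial fraction
expansion; at a node over `i` only the summand with index `i` of the numerator survives. -/
theorem sum_eq_sum_node_poles (hcard : Fintype.card I = Fintype.card J + 1) {x : I → ℂ}
    (h0 : ∀ i, x i ≠ 0) (h1 : ∀ i, x i ^ 2 ≠ 1)
    (hxx : ∀ i j, i ≠ j → x i ≠ x j ∧ x i * x j ≠ 1) {y : J → ℂ}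
    (hy : ∀ i j, i ≠ j → y i ≠ y j ∧ t * y i * y j ≠ 1) {c : I → ℂ}
    (hc : ∀ j, (poleNumerator t (fun i => x i + (x i)⁻¹) c).eval (y j) = 0) {z : ℂ}
    (hz : ∀ s, z ≠ node x s) (hzy : ∀ j, (wallPoly t (y j)).eval z ≠ 0)
    (hxy : ∀ s j, (wallPoly t (y j)).eval (node x s) ≠ 0) :
    ∑ i, c i * (∏ k ∈ Finset.univ.erase i, (quadQ t (x k + (x k)⁻¹)).eval z) /
        ((quadP (x i + (x i)⁻¹)).eval z * ∏ j, (wallPoly t (y j)).eval z) =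
      ∑ i, ∑ b, c i * (∏ k ∈ Finset.univ.erase i, (quadQ t (x k + (x k)⁻¹)).eval (node x (i, b))) /
        ((z - node x (i, b)) * (node x (i, b) - (node x (i, b))⁻¹) *
          ∏ j, (wallPoly t (y j)).eval (node x (i, b))) := by
  set T : I → ℂ := fun i => x i + (x i)⁻¹ with hT
  have hyi : Function.Injective y := fun i j h => by_contra fun hne => (hy i j hne).1 h
  obtain ⟨V, hV⟩ : ∏ j, wallPoly t (y j) ∣ poleNumerator t T c :=
    Finset.prod_dvd_of_coprime
      (fun i _ j _ hij => isCoprime_wallPoly (hy i j hij).1 (hy i j hij).2)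
      fun j _ => wallPoly_dvd_poleNumerator (hc j)
  have hdeg := natDegree_lt_of_prod_wallPoly_mul_eq hcard hyi hV
  have hinj := node_injective h0 h1 hxx
  have hdeg' : V.degree < (Finset.univ : Finset (I × Bool)).card := by
    refine degree_le_natDegree.trans_lt ?_
    rw [Finset.card_univ, Fintype.card_prod, Fintype.card_bool, mul_comm]
    exact_mod_cast hdeg
  have hlag := Lagrange.eq_interpolate (f := V) hinj.injOn hdeg'
  have heval : V.eval z = _ := congrArg (eval z) hlag
  rw [Lagrange.eval_interpolate_not_at_node _ fun s _ => hz s, Lagrange.eval_nodal,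
    Fintype.prod_prod_type] at heval
  simp only [prod_sub_node x h0, nodalWeight_node h0] at heval
  have hPz : ∀ i, (quadP (T i)).eval z ≠ 0 := fun i => by
    rw [hT, ← prod_sub_node x h0]
    exact Finset.prod_ne_zero_iff.2 fun b _ => sub_ne_zero.2 (hz _)
  have hL : ∑ i, c i * (∏ k ∈ Finset.univ.erase i, (quadQ t (T k)).eval z) /
        ((quadP (T i)).eval z * ∏ j, (wallPoly t (y j)).eval z) =
      V.eval z / ∏ i, (quadP (T i)).eval z := by
    have hWz : ∏ j, (wallPoly t (y j)).eval z ≠ 0 := Finset.prod_ne_zero_iff.2 fun j _ => hzy j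
    have hPall : ∏ i, (quadP (T i)).eval z ≠ 0 := Finset.prod_ne_zero_iff.2 fun i _ => hPz i
    have e1 := congrArg (eval z) hV
    rw [eval_mul, eval_prod, poleNumerator, eval_finsetSum] at e1
    rw [eq_div_iff hPall, ← mul_right_inj' hWz, ← e1, Finset.sum_mul, Finset.mul_sum]
    refine Finset.sum_congr rfl fun i _ => ?_
    rw [← Finset.mul_prod_erase _ _ (Finset.mem_univ i), eval_mul, eval_C, eval_prod]
    simp only [eval_mul]
    rw [Finset.prod_mul_distrib]
    have := hPz i
    field_simp
  rw [hL, heval, Fintype.sum_prod_type, mul_div_cancel_left₀ _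
    (Finset.prod_ne_zero_iff.2 fun i _ => hPz i)]
  refine Finset.sum_congr rfl fun i _ => Finset.sum_congr rfl fun b _ => ?_
  have hWv : ∏ j, (wallPoly t (y j)).eval (node x (i, b)) ≠ 0 :=
    Finset.prod_ne_zero_iff.2 fun j _ => hxy _ j
  have hPv : ∏ k ∈ Finset.univ.erase i, (quadP (T k)).eval (node x (i, b)) ≠ 0 := by
    refine Finset.prod_ne_zero_iff.2 fun k hk => ?_
    rw [hT, ← prod_sub_node x h0]
    refine Finset.prod_ne_zero_iff.2 fun b' _ => sub_ne_zero.2 fun h => ?_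
    exact Finset.ne_of_mem_erase hk (Prod.ext_iff.1 (hinj h)).1.symm
  have hVv : (∏ j, (wallPoly t (y j)).eval (node x (i, b))) * V.eval (node x (i, b)) =
      c i * ((∏ k ∈ Finset.univ.erase i, (quadP (T k)).eval (node x (i, b))) *
        ∏ k ∈ Finset.univ.erase i, (quadQ t (T k)).eval (node x (i, b))) := by
    have e1 := congrArg (eval (node x (i, b))) hV
    rw [eval_mul, eval_prod, poleNumerator, eval_finsetSum,
      Finset.sum_eq_single_of_mem i (Finset.mem_univ i)] at e1
    · rw [← e1, eval_mul, eval_C, eval_prod, ← Finset.prod_mul_distrib]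
      simp only [eval_mul]
    · intro k _ hk
      rw [eval_mul, eval_prod, Finset.prod_eq_zero (Finset.mem_erase.2 ⟨hk.symm, Finset.mem_univ i⟩),
        mul_zero]
      rw [eval_mul, eval_quadP_node h0 (i, b), zero_mul]
  have hzv : z - node x (i, b) ≠ 0 := sub_ne_zero.2 (hz _)
  have hV' : V.eval (node x (i, b)) =
      c i * ((∏ k ∈ Finset.univ.erase i, (quadP (T k)).eval (node x (i, b))) *
        ∏ k ∈ Finset.univ.erase i, (quadQ t (T k)).eval (node x (i, b))) /
          ∏ j, (wallPoly t (y j)).eval (node x (i, b)) := by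
    rw [eq_div_iff hWv, mul_comm, hVv]
  rw [hV']
  simp only [mul_inv, div_eq_mul_inv]
  have hPc := mul_inv_cancel₀ hPv
  linear_combination (c i * (∏ k ∈ Finset.univ.erase i, (quadQ t (T k)).eval (node x (i, b))) *
    (z - node x (i, b))⁻¹ * (node x (i, b) - (node x (i, b))⁻¹)⁻¹ *
    (∏ j, (wallPoly t (y j)).eval (node x (i, b)))⁻¹) * hPc

end PoleExpansion

/-! ### The determinant satisfies the same column recursion. -/

section DeterminantRecursion

open Polynomial

variable {n : ℕ} {t : ℂ}

theorem univ_erase_eq_map (i : Fin (n + 1)) :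
    Finset.univ.erase i = Finset.univ.map (Fin.succAboveEmb i) := by
  ext k
  simp only [Finset.mem_erase, Finset.mem_univ, and_true, Finset.mem_map, true_and,
    Fin.succAboveEmb_apply]
  exact (Fin.exists_succAbove_eq_iff (x := i)).symm

theorem prod_ite_lt_succAbove (i : Fin (n + 1)) :
    ∏ k : Fin n, (if i < i.succAbove k then (1 : ℂ) else -1) = (-1) ^ (i : ℕ) := by
  simp only [Fin.lt_succAbove_iff_le_castSucc, Fin.le_def, Fin.val_castSucc]
  rw [Fin.prod_univ_eq_prod_range (fun k => if (i : ℕ) ≤ k then (1 : ℂ) else -1) n,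
    Finset.prod_ite, Finset.prod_const_one, one_mul, Finset.prod_const]
  congr 1
  have : (Finset.range n).filter (fun k => ¬ (i : ℕ) ≤ k) = Finset.range i := by
    ext k
    simp only [Finset.mem_filter, Finset.mem_range]
    omega
  rw [this, Finset.card_range]

/-- Moving row `i` to the front of the Vandermonde product produces the sign that later cancels the
one in the Laplace expansion. -/
theorem prod_sub_succAbove (T : Fin (n + 1) → ℂ) (i : Fin (n + 1)) :
    ∏ a, ∏ b ∈ Finset.univ.filter (fun b => a < b), (T a - T b) =
      (-1) ^ (i : ℕ) * (∏ k : Fin n, (T i - T (i.succAbove k))) *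
        ∏ k : Fin n, ∏ l ∈ Finset.univ.filter (fun l => k < l),
          (T (i.succAbove k) - T (i.succAbove l)) := by
  have h : ∀ k, (if i < i.succAbove k then T i - T (i.succAbove k)
      else T (i.succAbove k) - T i) =
      (if i < i.succAbove k then 1 else -1) * (T i - T (i.succAbove k)) := fun k => by
    split_ifs
    · rw [one_mul]
    · rw [neg_one_mul, neg_sub]
  rw [prod_prod_lt_succAbove (fun a b => T a - T b) i,
    Finset.prod_congr rfl fun k _ => h k, Finset.prod_mul_distrib, prod_ite_lt_succAbove]

/-- The matrix of the determinant in `reflectingDet`. -/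
def reflectingMatrix (t : ℂ) (x y : Fin n → ℂ) : Matrix (Fin n) (Fin n) ℂ :=
  Matrix.of fun i j => (1 - t) / ((quadP (x i + (x i)⁻¹)).eval (y j) *
    (quadQ t (x i + (x i)⁻¹)).eval (y j))

/-- The pairwise factors in the denominator of `reflectingDet` that involve the `y j`. -/
def columnFactor (t : ℂ) (y : Fin n → ℂ) : ℂ :=
  ∏ i, ∏ j ∈ Finset.univ.filter (fun j => i < j), ((y i - y j) * (1 - t * y i * y j))

theorem quadP_eval_eq {x : ℂ} (h : x ≠ 0) (z : ℂ) :
    (quadP (x + x⁻¹)).eval z = (1 - x * z) * (1 - x⁻¹ * z) := by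
  rw [eval_quadP]
  linear_combination (-z ^ 2) * mul_inv_cancel₀ h

theorem quadQ_eval_eq {x : ℂ} (h : x ≠ 0) (z : ℂ) :
    (quadQ t (x + x⁻¹)).eval z = (1 - t * x * z) * (1 - t * x⁻¹ * z) := by
  rw [eval_quadQ]
  linear_combination (-(t * z) ^ 2) * mul_inv_cancel₀ h

/-- Rewrites everything through the traces x + 1/x, using (x - x')(1 - 1/(xx')) = (x + 1/x) - (x' +
1/x'). -/
theorem reflectingDet_eq {x : Fin n → ℂ} (h0 : ∀ i, x i ≠ 0) (y : Fin n → ℂ) :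
    reflectingDet t x y = (∏ i, ∏ j, (quadQ t (x i + (x i)⁻¹)).eval (y j)) /
      ((∏ i, ∏ j ∈ Finset.univ.filter (fun j => i < j),
        ((x i + (x i)⁻¹) - (x j + (x j)⁻¹))) * columnFactor t y) *
        (reflectingMatrix t x y).det := by
  rw [reflectingDet, columnFactor, ← Finset.prod_mul_distrib]
  congr 1
  · congr 1
    · exact Finset.prod_congr rfl fun i _ => Finset.prod_congr rfl fun j _ =>
        (quadQ_eval_eq (h0 i) _).symm
    · refine Finset.prod_congr rfl fun i _ => ?_
      rw [← Finset.prod_mul_distrib]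
      refine Finset.prod_congr rfl fun j _ => ?_
      have hi := h0 i
      have hj := h0 j
      have e : (x i - x j) * (1 - (x i)⁻¹ * (x j)⁻¹) = x i + (x i)⁻¹ - (x j + (x j)⁻¹) := by
        field_simp
        ring
      rw [← e]
      ring
  · congr 1
    ext i j
    rw [reflectingMatrix, Matrix.of_apply, Matrix.of_apply, quadP_eval_eq (h0 i),
      quadQ_eval_eq (h0 i)]
    congr 1
    ring

theorem det_reflectingMatrix_cons (x : Fin (n + 1) → ℂ) (z : ℂ) (y : Fin n → ℂ) :
    (reflectingMatrix t x (Fin.cons z y)).det =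
      ∑ i : Fin (n + 1), (-1) ^ (i : ℕ) * ((1 - t) / ((quadP (x i + (x i)⁻¹)).eval z *
        (quadQ t (x i + (x i)⁻¹)).eval z)) *
          (reflectingMatrix t (fun k => x (i.succAbove k)) y).det := by
  rw [Matrix.det_succ_column_zero]
  refine Finset.sum_congr rfl fun i _ => ?_
  congr 1

theorem columnFactor_cons (z : ℂ) (y : Fin n → ℂ) :
    columnFactor t (Fin.cons z y : Fin (n + 1) → ℂ) =
      (∏ j, (wallPoly t (y j)).eval z) * columnFactor t y := by
  rw [columnFactor, prod_prod_lt_succAbove _ 0]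
  congr 1
  refine Finset.prod_congr rfl fun j _ => ?_
  rw [Fin.succAbove_zero, if_pos (Fin.succ_pos j), Fin.cons_zero, Fin.cons_succ, eval_wallPoly]
  ring

/-- The non-degeneracy conditions under which the determinant is manipulated. -/
structure Generic (t : ℂ) (x y : Fin n → ℂ) : Prop where
  x_ne_zero : ∀ i, x i ≠ 0
  x_sq : ∀ i, x i ^ 2 ≠ 1
  x_pair : ∀ i j, i ≠ j → x i ≠ x j ∧ x i * x j ≠ 1
  y_pair : ∀ i j, i ≠ j → y i ≠ y j ∧ t * y i * y j ≠ 1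
  xy : ∀ i j, 1 - x i * y j ≠ 0 ∧ 1 - (x i)⁻¹ * y j ≠ 0
  txy : ∀ i j, 1 - t * x i * y j ≠ 0 ∧ 1 - t * (x i)⁻¹ * y j ≠ 0

theorem Generic.quadP_ne_zero {x y : Fin n → ℂ} (h : Generic t x y) (i j : Fin n) :
    (quadP (x i + (x i)⁻¹)).eval (y j) ≠ 0 := by
  rw [quadP_eval_eq (h.x_ne_zero i)]
  exact mul_ne_zero (h.xy i j).1 (h.xy i j).2

theorem Generic.quadQ_ne_zero {x y : Fin n → ℂ} (h : Generic t x y) (i j : Fin n) :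
    (quadQ t (x i + (x i)⁻¹)).eval (y j) ≠ 0 := by
  rw [quadQ_eval_eq (h.x_ne_zero i)]
  exact mul_ne_zero (h.txy i j).1 (h.txy i j).2

theorem Generic.succAbove {x : Fin (n + 1) → ℂ} {z : ℂ} {y : Fin n → ℂ}
    (h : Generic t x (Fin.cons z y : Fin (n + 1) → ℂ)) (i : Fin (n + 1)) :
    Generic t (fun k => x (i.succAbove k)) y where
  x_ne_zero k := h.x_ne_zero _
  x_sq k := h.x_sq _
  x_pair k l hkl := h.x_pair _ _ fun e => hkl (Fin.succAbove_right_injective e)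
  y_pair k l hkl := by
    have := h.y_pair k.succ l.succ fun e => hkl (Fin.succ_injective _ e)
    simpa only [Fin.cons_succ] using this
  xy k l := by
    have := h.xy (i.succAbove k) l.succ
    simpa only [Fin.cons_succ] using this
  txy k l := by
    have := h.txy (i.succAbove k) l.succ
    simpa only [Fin.cons_succ] using this

/-- Laplace expansion along the first column presents the determinant as the rational function of
`z` treated in `sum_eq_sum_node_poles`, with minors as coefficients; its residues are then matched
with `poleCoeff`. -/
theorem reflectingDet_cons {x : Fin (n + 1) → ℂ} {z : ℂ} {y : Fin n → ℂ}
    (h : Generic t x (Fin.cons z y : Fin (n + 1) → ℂ)) :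
    reflectingDet t x (Fin.cons z y : Fin (n + 1) → ℂ) = ∑ i, ∑ b : Bool,
      poleCoeff t (if b then (x i)⁻¹ else x i) z
        (fun k => x (i.succAbove k) + (x (i.succAbove k))⁻¹) (List.ofFn y) *
        reflectingDet t (fun k => x (i.succAbove k)) y := by
  have h0 := h.x_ne_zero
  set T : Fin (n + 1) → ℂ := fun i => x i + (x i)⁻¹ with hT
  set Q : ℂ := ∏ i, ∏ j, (quadQ t (T i)).eval (y j) with hQ
  set Δ : ℂ := ∏ i, ∏ j ∈ Finset.univ.filter (fun j => i < j), (T i - T j) with hΔ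
  set m : Fin (n + 1) → ℂ := fun i => (reflectingMatrix t (fun k => x (i.succAbove k)) y).det
    with hm
  set c : Fin (n + 1) → ℂ := fun i =>
    (1 - t) * Q / (Δ * columnFactor t y) * ((-1) ^ (i : ℕ) * m i) with hc
  have hPz : ∀ i, (quadP (T i)).eval z ≠ 0 := fun i => by
    simpa only [Fin.cons_zero] using h.quadP_ne_zero i 0
  have hQz : ∀ i, (quadQ t (T i)).eval z ≠ 0 := fun i => by
    simpa only [Fin.cons_zero] using h.quadQ_ne_zero i 0
  have hPy : ∀ i j, (quadP (T i)).eval (y j) ≠ 0 := fun i j => by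
    simpa only [Fin.cons_succ] using h.quadP_ne_zero i j.succ
  have hQy : ∀ i j, (quadQ t (T i)).eval (y j) ≠ 0 := fun i j => by
    simpa only [Fin.cons_succ] using h.quadQ_ne_zero i j.succ
  have hL : reflectingDet t x (Fin.cons z y : Fin (n + 1) → ℂ) =
      ∑ i, c i * (∏ k ∈ Finset.univ.erase i, (quadQ t (T k)).eval z) /
        ((quadP (T i)).eval z * ∏ j, (wallPoly t (y j)).eval z) := by
    rw [reflectingDet_eq h0, det_reflectingMatrix_cons, columnFactor_cons, Finset.mul_sum]
    refine Finset.sum_congr rfl fun i _ => ?_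
    have e : ∀ i, ∏ j, (quadQ t (T i)).eval ((Fin.cons z y : Fin (n + 1) → ℂ) j) =
        (quadQ t (T i)).eval z * ∏ j, (quadQ t (T i)).eval (y j) := fun i => by
      rw [Fin.prod_univ_succ]
      simp only [Fin.cons_zero, Fin.cons_succ]
    rw [Finset.prod_congr rfl fun i _ => e i, Finset.prod_mul_distrib, ← Finset.mul_prod_erase _ _ (Finset.mem_univ i)]
    have := hQz i
    simp only [hc, hm, hQ, hΔ, hT] at this ⊢
    simp only [div_eq_mul_inv, mul_inv]
    have e := mul_inv_cancel₀ this
    generalize ((quadQ t (x i + (x i)⁻¹)).eval z) = q at e ⊢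
    linear_combination ((1 - t) * (∏ k ∈ Finset.univ.erase i, (quadQ t (x k + (x k)⁻¹)).eval z) *
      (∏ i, ∏ j, (quadQ t (x i + (x i)⁻¹)).eval (y j)) *
      (∏ i, ∏ j ∈ Finset.univ.filter (fun j => i < j),
        (x i + (x i)⁻¹ - (x j + (x j)⁻¹)))⁻¹ * (columnFactor t y)⁻¹ *
      (∏ j, (wallPoly t (y j)).eval z)⁻¹ * ((quadP (x i + (x i)⁻¹)).eval z)⁻¹ *
      ((-1) ^ (i : ℕ) * (reflectingMatrix t (fun k => x (i.succAbove k)) y).det)) * e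
  -- At `z = y j` the numerator is a multiple of a determinant with two equal columns.
  have hvanish : ∀ j, (poleNumerator t T c).eval (y j) = 0 := by
    intro j
    have hdet : (reflectingMatrix t x (Fin.cons (y j) y)).det = 0 := by
      refine Matrix.det_zero_of_column_eq (Fin.succ_ne_zero j).symm fun k => ?_
      simp [reflectingMatrix]
    rw [det_reflectingMatrix_cons] at hdet
    have e : (poleNumerator t T c).eval (y j) =
        (∏ k, (quadP (T k) * quadQ t (T k)).eval (y j)) * (Q / (Δ * columnFactor t y)) *
          ∑ i : Fin (n + 1), (-1) ^ (i : ℕ) * ((1 - t) / ((quadP (x i + (x i)⁻¹)).eval (y j) *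
            (quadQ t (x i + (x i)⁻¹)).eval (y j))) *
            (reflectingMatrix t (fun k => x (i.succAbove k)) y).det := by
      rw [poleNumerator, eval_finsetSum, Finset.mul_sum]
      refine Finset.sum_congr rfl fun i _ => ?_
      rw [← Finset.mul_prod_erase _ _ (Finset.mem_univ i), eval_mul, eval_mul, eval_C, eval_prod]
      have h1 := hPy i j
      have h2 := hQy i j
      simp only [hT] at h1 h2
      simp only [hc, hm, hT]
      generalize (quadP (x i + (x i)⁻¹)).eval (y j) = p at h1 ⊢
      generalize (quadQ t (x i + (x i)⁻¹)).eval (y j) = q at h2 ⊢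
      generalize ∏ k ∈ Finset.univ.erase i,
        (quadP (x k + (x k)⁻¹) * quadQ t (x k + (x k)⁻¹)).eval (y j) = R
      field_simp
    rw [e, hdet, mul_zero]
  have hnode : ∀ s, node x s ≠ 0 := fun s => by
    rw [node]
    split_ifs
    · exact inv_ne_zero (h0 _)
    · exact h0 _
  have hnode' : ∀ s : Fin (n + 1) × Bool, (node x s)⁻¹ = node x (s.1, !s.2) := fun s => by
    rcases s with ⟨i, b⟩
    cases b <;> simp [node]
  have hz : ∀ s, z ≠ node x s := by
    intro s hs
    refine hPz s.1 ?_
    rw [hs]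
    exact eval_quadP_node h0 s
  have hyz : ∀ j, (wallPoly t (y j)).eval z ≠ 0 := by
    intro j
    have := h.y_pair 0 j.succ (Fin.succ_ne_zero j).symm
    rw [Fin.cons_zero, Fin.cons_succ] at this
    rw [eval_wallPoly]
    refine mul_ne_zero (sub_ne_zero.2 this.1) (sub_ne_zero.2 fun e => this.2 ?_)
    rw [e]
    ring
  have hxy : ∀ s j, (wallPoly t (y j)).eval (node x s) ≠ 0 := by
    intro s j
    rw [eval_wallPoly]
    refine mul_ne_zero (fun e => hPy s.1 j ?_) (fun e => hQy s.1 j ?_)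
    · rw [← sub_eq_zero.1 e]
      exact eval_quadP_node h0 s
    · rw [hT, quadQ_eval_eq (h0 _)]
      rcases s with ⟨i, b⟩
      cases b <;> simp only [node, if_true, Bool.false_eq_true, if_false] at e
      · rw [show 1 - t * x i * y j = 0 by linear_combination e, zero_mul]
      · rw [show 1 - t * (x i)⁻¹ * y j = 0 by linear_combination e, mul_zero]
  rw [hL, sum_eq_sum_node_poles (by simp) h0 h.x_sq h.x_pair
    (fun i j hij => by
      have := h.y_pair i.succ j.succ fun e => hij (Fin.succ_injective _ e)
      simpa only [Fin.cons_succ] using this) hvanish hz hyz hxy]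
  refine Finset.sum_congr rfl fun i _ => ?_
  -- The term of `poleCoeff` for `w` has its pole at the inverse node, so the two signs are
  -- interchanged.
  rw [← Equiv.sum_comp Equiv.boolNot]
  refine Finset.sum_congr rfl fun b _ => ?_
  have hb : node x (i, Equiv.boolNot b) = (node x (i, b))⁻¹ := (hnode' (i, b)).symm
  have hw0 := hnode (i, b)
  have hTw : node x (i, b) + (node x (i, b))⁻¹ = T i := by
    cases b <;> simp [node, hT, add_comm]
  have hwz : 1 - node x (i, b) * z ≠ 0 := by
    intro e
    refine hz (i, !b) ?_
    rw [← hnode' (i, b)]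
    exact eq_inv_of_mul_eq_one_right (sub_eq_zero.1 e).symm
  have hw1 : 1 - (node x (i, b))⁻¹ ^ 2 ≠ 0 := by
    intro e
    refine h.x_sq i ?_
    cases b <;> simp only [node, if_true, Bool.false_eq_true, if_false, inv_inv, inv_pow] at e
    · exact inv_eq_one.1 (sub_eq_zero.1 e).symm
    · exact (sub_eq_zero.1 e).symm
  rw [hb]
  have hif : (if b then (x i)⁻¹ else x i) = node x (i, b) := rfl
  rw [hif, poleCoeff, hTw, List.map_ofFn, List.prod_ofFn, reflectingDet_eq fun k => h0 _,
    univ_erase_eq_map, Finset.prod_map]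
  simp only [Fin.succAboveEmb_apply, Function.comp_apply, hc]
  have hyw : ∀ j, 1 - node x (i, b) * y j ≠ 0 ∧ 1 - t * (node x (i, b))⁻¹ * y j ≠ 0 := by
    intro j
    have := hxy (i, !b) j
    rw [← hnode' (i, b), eval_wallPoly] at this
    constructor
    · intro e
      refine left_ne_zero_of_mul this ?_
      rw [sub_eq_zero]
      exact (eq_inv_of_mul_eq_one_right (sub_eq_zero.1 e).symm).symm
    · intro e
      refine right_ne_zero_of_mul this ?_
      linear_combination e
  set w := node x (i, b) with hw
  have e1 : (z - w⁻¹) * (w⁻¹ - w⁻¹⁻¹) = (1 - w * z) * (1 - w⁻¹ ^ 2) := by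
    rw [inv_inv]
    field_simp
    ring
  -- Passing from `w` to `w⁻¹` costs `w ^ n` here and in `e3`; the two powers cancel.
  have e2 : ∏ k, (w + t ^ 2 * w⁻¹ - t * (x (i.succAbove k) + (x (i.succAbove k))⁻¹)) /
        (T i - (x (i.succAbove k) + (x (i.succAbove k))⁻¹)) =
      w ^ n * (∏ k, (quadQ t (T (i.succAbove k))).eval w⁻¹) /
        ∏ k, (T i - T (i.succAbove k)) := by
    rw [Finset.prod_div_distrib]
    congr 1
    have : w ^ n = ∏ _k : Fin n, w := by simp
    rw [this, ← Finset.prod_mul_distrib]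
    refine Finset.prod_congr rfl fun k _ => ?_
    rw [eval_quadQ]
    change w + t ^ 2 * w⁻¹ - t * T (i.succAbove k) = _
    field_simp
    ring
  have e3 : w ^ n * ∏ j, (1 - t * w * y j) / (1 - w * y j) =
      (∏ j, (quadQ t (T i)).eval (y j)) / ∏ j, (wallPoly t (y j)).eval w⁻¹ := by
    have : w ^ n = ∏ _k : Fin n, w := by simp
    rw [this, ← Finset.prod_mul_distrib, ← Finset.prod_div_distrib]
    refine Finset.prod_congr rfl fun j _ => ?_
    obtain ⟨g1, g2⟩ := hyw j
    have g3 : (wallPoly t (y j)).eval w⁻¹ =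
        w⁻¹ * ((1 - w * y j) * (1 - t * w⁻¹ * y j)) := by
      rw [eval_wallPoly]
      field_simp
    have g4 : (quadQ t (T i)).eval (y j) = (1 - t * w * y j) * (1 - t * w⁻¹ * y j) := by
      rw [← hTw, quadQ_eval_eq hw0]
    rw [g3, g4]
    generalize 1 - t * w⁻¹ * y j = r at g2 ⊢
    field_simp
  have e4 : Q = (∏ j, (quadQ t (T i)).eval (y j)) *
      ∏ k, ∏ j, (quadQ t (T (i.succAbove k))).eval (y j) := by
    rw [hQ, Fin.prod_univ_succAbove _ i]
  have e5 := prod_sub_succAbove T i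
  have e6 : (((-1 : ℂ) ^ (i : ℕ))⁻¹) * (-1) ^ (i : ℕ) = 1 :=
    inv_mul_cancel₀ (pow_ne_zero _ (neg_ne_zero.2 one_ne_zero))
  rw [e1, e2, e4, hΔ, e5]
  simp only [div_eq_mul_inv, mul_inv] at e3 ⊢
  generalize ((-1 : ℂ) ^ (i : ℕ)) = s at e6 ⊢
  linear_combination (((1 - t) * (∏ j, (quadQ t (T i)).eval (y j)) *
      (∏ k, ∏ j, (quadQ t (T (i.succAbove k))).eval (y j)) *
      (∏ k, (T i - T (i.succAbove k)))⁻¹ *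
      (∏ k, ∏ l ∈ Finset.univ.filter (fun l => k < l),
        (T (i.succAbove k) - T (i.succAbove l)))⁻¹ * (columnFactor t y)⁻¹ * m i *
      (∏ k, (quadQ t (T (i.succAbove k))).eval w⁻¹) * (1 - w * z)⁻¹ * (1 - w⁻¹ ^ 2)⁻¹ *
      (∏ j, (wallPoly t (y j)).eval w⁻¹)⁻¹)) * e6 -
    ((1 - t) * (1 - w * z)⁻¹ * (1 - w⁻¹ ^ 2)⁻¹ *
      (∏ k, (quadQ t (T (i.succAbove k))).eval w⁻¹) * (∏ k, (T i - T (i.succAbove k)))⁻¹ *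
      (∏ k, ∏ j, (quadQ t (T (i.succAbove k))).eval (y j)) *
      (∏ k, ∏ l ∈ Finset.univ.filter (fun l => k < l),
        (T (i.succAbove k) - T (i.succAbove l)))⁻¹ * (columnFactor t y)⁻¹ * m i) * e3

/-- Equal recursions in the first column parameter and equal values without rows. -/
theorem reflectingDet_eq_signedDomainWall : ∀ {n : ℕ} {x y : Fin n → ℂ}, Generic t x y →
    reflectingDet t x y = signedDomainWall t x (List.ofFn y)
  | 0, x, y, _ => by
      simp [reflectingDet, signedDomainWall, bcFactor, domainWall_nil]
  | n + 1, x, y, h => by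
      obtain ⟨z, y, rfl⟩ : ∃ z y', y = Fin.cons z y' := ⟨y 0, Fin.tail y, (Fin.cons_self_tail y).symm⟩
      rw [reflectingDet_cons h, List.ofFn_succ, Fin.cons_zero]
      simp only [Fin.cons_succ]
      rw [signedDomainWall_cons x h.x_ne_zero]
      exact Finset.sum_congr rfl fun i _ => by
        rw [reflectingDet_eq_signedDomainWall (h.succAbove i)]

end DeterminantRecursion

/-! ### Row operators of the six-vertex model and their exchange relations. -/

section RowOperators

variable {n : ℕ} {t : ℂ}

/-- The weight of a single row with left edge `l`, a particle on the right edge, top edges `u` and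
bottom edges `b`. The row parameter is `w` and the inverse column parameters are `c`. -/
def rowWeight (t w : ℂ) (c : Fin n → ℂ) (l : Bool) (u b : Fin n → Bool) : ℂ :=
  ∑ h : Fin (n + 1) → Bool, if h 0 = l ∧ h (Fin.last n) = true then
    ∏ k, sixVertexWeight t (w * c k) (h k.castSucc) (h k.succ) (b k) (u k) else 0

theorem rowWeight_zero (w : ℂ) (c : Fin 0 → ℂ) (l : Bool) (u b : Fin 0 → Bool) :
    rowWeight t w c l u b = if l = true then 1 else 0 := by
  rw [rowWeight, ← (Equiv.funUnique (Fin 1) Bool).symm.sum_comp, Fintype.sum_bool]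
  cases l <;> simp

theorem rowWeight_succ (w : ℂ) (c : Fin (n + 1) → ℂ) (l : Bool) (u b : Fin (n + 1) → Bool) :
    rowWeight t w c l u b = ∑ m, sixVertexWeight t (w * c 0) l m (b 0) (u 0) *
      rowWeight t w (fun k => c k.succ) m (fun k => u k.succ) fun k => b k.succ := by
  rw [rowWeight, ← (Fin.insertNthEquiv (fun _ => Bool) 0).sum_comp, Fintype.sum_prod_type,
    Finset.sum_eq_single_of_mem l (Finset.mem_univ l)]
  · simp only [rowWeight, Finset.mul_sum]
    rw [Finset.sum_comm]
    refine Finset.sum_congr rfl fun h _ => ?_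
    rw [Finset.sum_eq_single_of_mem (h 0) (Finset.mem_univ _)]
    · simp [Fin.insertNthEquiv, Fin.prod_univ_succ, ← Fin.succ_last, Fin.castSucc_succ]
    · intro m _ hm
      rw [if_neg fun h' => hm h'.1.symm, mul_zero]
  · intro l' _ hl
    refine Finset.sum_eq_zero fun h _ => if_neg fun h' => hl ?_
    simpa using h'.1

/-- The operator of a single row with a particle on the right edge. It maps functions of the top
edges to functions of the bottom edges. -/
def rowOp (t : ℂ) (c : Fin n → ℂ) (l : Bool) (w : ℂ) :
    ((Fin n → Bool) → ℂ) →ₗ[ℂ] ((Fin n → Bool) → ℂ) :=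
  Matrix.mulVecLin (Matrix.of fun b u => rowWeight t w c l u b)

theorem rowOp_apply (c : Fin n → ℂ) (l : Bool) (w : ℂ) (ψ : (Fin n → Bool) → ℂ)
    (b : Fin n → Bool) : rowOp t c l w ψ b = ∑ u, rowWeight t w c l u b * ψ u := rfl

/-- Fix the state of the first vertical edge. -/
def slice (s : Bool) : ((Fin (n + 1) → Bool) → ℂ) →ₗ[ℂ] ((Fin n → Bool) → ℂ) :=
  LinearMap.funLeft ℂ ℂ fun v => (Fin.cons s v : Fin (n + 1) → Bool)

theorem slice_apply (s : Bool) (ψ : (Fin (n + 1) → Bool) → ℂ) (v : Fin n → Bool) :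
    slice s ψ v = ψ (Fin.cons s v) := rfl

theorem ext_slice {ψ φ : (Fin (n + 1) → Bool) → ℂ} (h0 : slice false ψ = slice false φ)
    (h1 : slice true ψ = slice true φ) : ψ = φ := by
  funext v
  rw [← Fin.cons_self_tail v]
  cases v 0
  · exact congrFun h0 (Fin.tail v)
  · exact congrFun h1 (Fin.tail v)

theorem slice_rowOp (c : Fin (n + 1) → ℂ) (l : Bool) (w : ℂ) (ψ : (Fin (n + 1) → Bool) → ℂ)
    (s : Bool) : slice s (rowOp t c l w ψ) = ∑ r, ∑ m, sixVertexWeight t (w * c 0) l m s r •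
      rowOp t (fun k => c k.succ) m w (slice r ψ) := by
  funext v
  rw [slice_apply, rowOp_apply, ← (Fin.insertNthEquiv (fun _ => Bool) 0).sum_comp,
    Fintype.sum_prod_type]
  simp only [Finset.sum_apply, Pi.smul_apply, smul_eq_mul, rowOp_apply, Finset.mul_sum,
    rowWeight_succ, Finset.sum_mul]
  refine Finset.sum_congr rfl fun r _ => ?_
  rw [Finset.sum_comm]
  refine Finset.sum_congr rfl fun m _ => Finset.sum_congr rfl fun u _ => ?_
  simp [slice_apply, mul_assoc, Fin.insertNthEquiv]

theorem slice_false_rowOp_false (c : Fin (n + 1) → ℂ) (w : ℂ) (ψ : (Fin (n + 1) → Bool) → ℂ) :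
    slice false (rowOp t c false w ψ) = ((1 - t * (w * c 0)) / (1 - w * c 0)) •
      rowOp t (fun k => c k.succ) false w (slice false ψ) := by
  rw [slice_rowOp]
  simp [sixVertexWeight]

theorem slice_true_rowOp_false (c : Fin (n + 1) → ℂ) (w : ℂ) (ψ : (Fin (n + 1) → Bool) → ℂ) :
    slice true (rowOp t c false w ψ) =
      t • rowOp t (fun k => c k.succ) false w (slice true ψ) +
      ((1 - t) * (w * c 0) / (1 - w * c 0)) •
        rowOp t (fun k => c k.succ) true w (slice false ψ) := by
  rw [slice_rowOp]
  simp [sixVertexWeight]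

theorem slice_false_rowOp_true (c : Fin (n + 1) → ℂ) (w : ℂ) (ψ : (Fin (n + 1) → Bool) → ℂ) :
    slice false (rowOp t c true w ψ) = rowOp t (fun k => c k.succ) true w (slice false ψ) +
      ((1 - t) / (1 - w * c 0)) • rowOp t (fun k => c k.succ) false w (slice true ψ) := by
  rw [slice_rowOp]
  simp [sixVertexWeight, add_comm]

theorem slice_true_rowOp_true (c : Fin (n + 1) → ℂ) (w : ℂ) (ψ : (Fin (n + 1) → Bool) → ℂ) :
    slice true (rowOp t c true w ψ) = ((1 - t * (w * c 0)) / (1 - w * c 0)) •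
      rowOp t (fun k => c k.succ) true w (slice true ψ) := by
  rw [slice_rowOp]
  simp [sixVertexWeight]

theorem rowOp_zero (c : Fin 0 → ℂ) (l : Bool) (w : ℂ) (ψ : (Fin 0 → Bool) → ℂ) :
    rowOp t c l w ψ = if l = true then ψ else 0 := by
  funext v
  rw [rowOp_apply, Fintype.sum_unique, rowWeight_zero, Subsingleton.elim v default]
  split_ifs
  · rw [one_mul]
    exact congrArg ψ (Subsingleton.elim _ _)
  · rw [zero_mul, Pi.zero_apply]

/-- The exchange relations of the operators of two rows with parameters `u` and `v`. -/
theorem rowOp_relations : ∀ {n : ℕ} (c : Fin n → ℂ) {u v : ℂ}, u ≠ v →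
    (∀ k, 1 - u * c k ≠ 0) → (∀ k, 1 - v * c k ≠ 0) → ∀ ψ : (Fin n → Bool) → ℂ,
    rowOp t c false u (rowOp t c false v ψ) = rowOp t c false v (rowOp t c false u ψ) ∧
    rowOp t c true u (rowOp t c true v ψ) = rowOp t c true v (rowOp t c true u ψ) ∧
    rowOp t c true u (rowOp t c false v ψ) =
      ((v - t * u) / (v - u)) • rowOp t c false v (rowOp t c true u ψ) +
        ((1 - t) * v / (u - v)) • rowOp t c false u (rowOp t c true v ψ)
  | 0, c, u, v, _, _, _, ψ => by simp [rowOp_zero]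
  | n + 1, c, u, v, huv, hu, hv, ψ => by
      have IH := fun φ => rowOp_relations (fun k => c k.succ) huv (fun k => hu k.succ)
        (fun k => hv k.succ) φ
      -- The relation with `u` and `v` interchanged is needed too: slicing the first column produces
      -- mixed products in both orders of the parameters.
      have IH' := fun φ => rowOp_relations (fun k => c k.succ) huv.symm (fun k => hv k.succ)
        (fun k => hu k.succ) φ
      have h1 : v - u ≠ 0 := sub_ne_zero.2 huv.symm
      have hu0 : 1 - u * c 0 ≠ 0 := hu 0
      have hv0 : 1 - v * c 0 ≠ 0 := hv 0
      have hu1 : 1 - c 0 * u ≠ 0 := by rwa [mul_comm]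
      have hv1 : 1 - c 0 * v ≠ 0 := by rwa [mul_comm]
      have e : u - v = -(v - u) := by ring
      have hCC := fun φ => (IH φ).1
      have hDD := fun φ => (IH φ).2.1
      have hDC := fun φ => (IH φ).2.2
      have hDC' := fun φ => (IH' φ).2.2
      -- Slicing off the first column rewrites both sides through operators with one column fewer;
      -- the shorter relations move creation operators to the left, after which the coefficients
      -- agree as rational functions.
      refine ⟨ext_slice ?_ ?_, ext_slice ?_ ?_, ext_slice ?_ ?_⟩ <;>
      · simp only [map_add, map_smul, slice_false_rowOp_false, slice_true_rowOp_false,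
          slice_false_rowOp_true, slice_true_rowOp_true, hDC, hDC', hCC, hDD]
        match_scalars <;> (try simp only [e]) <;> field_simp <;> ring

end RowOperators

/-! ### States created from the vacuum, and their component with all edges occupied. -/

section RowStates

variable {n : ℕ} {t : ℂ}

/-- The state without particles. -/
def vacuum {n : ℕ} : (Fin n → Bool) → ℂ := fun v => if v = (fun _ => false) then 1 else 0

theorem slice_false_vacuum : slice false (vacuum (n := n + 1)) = vacuum := by
  funext v
  rw [slice_apply, vacuum, vacuum]
  refine if_congr ⟨fun h => ?_, fun h => ?_⟩ rfl rfl
  · funext k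
    simpa using congrFun h k.succ
  · subst h
    funext k
    exact Fin.cases rfl (fun _ => rfl) k

theorem slice_true_vacuum : slice true (vacuum (n := n + 1)) = 0 := by
  funext v
  rw [slice_apply, vacuum, if_neg fun h => by simpa using congrFun h 0, Pi.zero_apply]

theorem rowOp_true_vacuum : ∀ {n : ℕ} (c : Fin n → ℂ) (w : ℂ),
    rowOp t c true w vacuum = vacuum
  | 0, c, w => by rw [rowOp_zero, if_pos rfl]
  | n + 1, c, w => ext_slice
      (by rw [slice_false_rowOp_true, slice_false_vacuum, slice_true_vacuum, map_zero, smul_zero,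
        add_zero, rowOp_true_vacuum])
      (by rw [slice_true_rowOp_true, slice_true_vacuum, map_zero, smul_zero])

/-- The state created from the vacuum by rows with hole left edges and parameters in `L`. -/
def rowState (t : ℂ) (c : Fin n → ℂ) (L : List ℂ) : (Fin n → Bool) → ℂ :=
  L.foldr (fun w ψ => rowOp t c false w ψ) vacuum

theorem rowState_cons (c : Fin n → ℂ) (w : ℂ) (L : List ℂ) :
    rowState t c (w :: L) = rowOp t c false w (rowState t c L) := rfl

theorem rowOp_false_comm {c : Fin n → ℂ} {u v : ℂ} (hu : ∀ k, 1 - u * c k ≠ 0)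
    (hv : ∀ k, 1 - v * c k ≠ 0) (ψ : (Fin n → Bool) → ℂ) :
    rowOp t c false u (rowOp t c false v ψ) = rowOp t c false v (rowOp t c false u ψ) := by
  by_cases h : u = v
  · rw [h]
  · exact (rowOp_relations c h hu hv ψ).1

theorem rowState_perm {c : Fin n → ℂ} {L L' : List ℂ} (h : L.Perm L')
    (hL : ∀ w ∈ L, ∀ k, 1 - w * c k ≠ 0) : rowState t c L = rowState t c L' :=
  h.foldr_eq' (fun _ hu _ hv ψ => rowOp_false_comm (hL _ hv) (hL _ hu) ψ) _

variable {ι : Type*} [DecidableEq ι] {w : ι → ℂ} {c : Fin n → ℂ}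

theorem rowState_insert {S : Finset ι} {i : ι} (hi : i ∉ S)
    (hw : ∀ j ∈ insert i S, ∀ k, 1 - w j * c k ≠ 0) :
    rowState t c ((insert i S).toList.map w) =
      rowOp t c false (w i) (rowState t c (S.toList.map w)) := by
  rw [← rowState_cons, ← List.map_cons]
  refine rowState_perm ((Finset.toList_insert hi).map w) fun z hz => ?_
  obtain ⟨j, hj, rfl⟩ := List.mem_map.1 hz
  exact hw j (Finset.mem_toList.1 hj)

/-- A row with particle left edge acting on a state created from the vacuum. -/
theorem rowOp_true_rowState (S : Finset ι) : ∀ {u : ℂ}, (∀ i ∈ S, ∀ j ∈ S, i ≠ j → w i ≠ w j) →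
    (∀ i ∈ S, u ≠ w i) → (∀ k, 1 - u * c k ≠ 0) → (∀ i ∈ S, ∀ k, 1 - w i * c k ≠ 0) →
    rowOp t c true u (rowState t c (S.toList.map w)) =
      (∏ j ∈ S, (w j - t * u) / (w j - u)) • rowState t c (S.toList.map w) +
      ∑ i ∈ S, ((1 - t) * w i / (u - w i) * ∏ j ∈ S.erase i, (w j - t * w i) / (w j - w i)) •
        rowOp t c false u (rowState t c ((S.erase i).toList.map w)) := by
  induction S using Finset.induction_on with
  | empty =>
    intro u _ _ _ _
    simp [rowState, rowOp_true_vacuum]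
  | insert k S hk ih =>
    intro u hw hu huc hwc
    have hw' : ∀ i ∈ S, ∀ j ∈ S, i ≠ j → w i ≠ w j := fun i hi j hj =>
      hw i (Finset.mem_insert_of_mem hi) j (Finset.mem_insert_of_mem hj)
    have hwc' : ∀ i ∈ S, ∀ k, 1 - w i * c k ≠ 0 := fun i hi =>
      hwc i (Finset.mem_insert_of_mem hi)
    have hkc := hwc k (Finset.mem_insert_self _ _)
    have huk := hu k (Finset.mem_insert_self _ _)
    have hkw : ∀ i ∈ S, w k ≠ w i := fun i hi =>
      hw k (Finset.mem_insert_self _ _) i (Finset.mem_insert_of_mem hi) (by rintro rfl; exact hk hi)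
    rw [Finset.sum_insert hk, Finset.erase_insert hk, Finset.prod_insert hk,
      rowState_insert hk hwc, (rowOp_relations c huk huc hkc _).2.2,
      ih hw' (fun i hi => hu i (Finset.mem_insert_of_mem hi)) huc hwc', ih hw' hkw hkc hwc']
    -- The unwanted term at `i` arises in two ways: `u` passes `k` and is exchanged with `i`, or `u`
    -- is exchanged with `k`, which is then exchanged with `i`. The coefficients add up to one of
    -- the same form.
    have e : ∀ i ∈ S, ((1 - t) * w i / (u - w i) *
          ∏ j ∈ (insert k S).erase i, (w j - t * w i) / (w j - w i)) •
        rowOp t c false u (rowState t c (((insert k S).erase i).toList.map w)) =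
        ((w k - t * u) / (w k - u) * ((1 - t) * w i / (u - w i) *
          ∏ j ∈ S.erase i, (w j - t * w i) / (w j - w i)) +
        (1 - t) * w k / (u - w k) * ((1 - t) * w i / (w k - w i) *
          ∏ j ∈ S.erase i, (w j - t * w i) / (w j - w i))) •
        rowOp t c false u (rowOp t c false (w k) (rowState t c ((S.erase i).toList.map w))) := by
      intro i hi
      have hki : k ≠ i := by rintro rfl; exact hk hi
      have hk' : k ∉ S.erase i := fun h => hk (Finset.mem_of_mem_erase h)
      rw [Finset.erase_insert_of_ne hki, Finset.prod_insert hk', rowState_insert hk']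
      · congr 1
        have h1 : w k - u ≠ 0 := sub_ne_zero.2 huk.symm
        have h2 : w k - w i ≠ 0 := sub_ne_zero.2 (hkw i hi)
        have h3 : u - w i ≠ 0 := sub_ne_zero.2 (hu i (Finset.mem_insert_of_mem hi))
        rw [show u - w k = -(w k - u) by ring]
        field_simp
        ring
      · intro j hj
        rw [Finset.mem_insert] at hj
        exact hwc j (Finset.mem_insert.2 (hj.imp_right Finset.mem_of_mem_erase))
    rw [Finset.sum_congr rfl e]
    simp only [map_add, map_sum, map_smul, smul_add, Finset.smul_sum, smul_smul, add_smul,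
      Finset.sum_add_distrib, rowOp_false_comm hkc huc]
    abel

theorem slice_false_rowState {c : Fin (n + 1) → ℂ} (L : List ℂ) :
    slice false (rowState t c L) = (L.map fun w => (1 - t * (w * c 0)) / (1 - w * c 0)).prod •
      rowState t (fun k => c k.succ) L := by
  induction L with
  | nil => simp [rowState, slice_false_vacuum]
  | cons w L ih =>
    rw [rowState_cons, slice_false_rowOp_false, ih, map_smul, List.map_cons, List.prod_cons,
      rowState_cons, smul_smul]

/-- A particle on the first column must have been created by some row `i`. Moving the resulting
particle-preserving operator through the other rows by `rowOp_true_rowState` gives the coefficient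
of that row. -/
theorem slice_true_rowState {c : Fin (n + 1) → ℂ} (S : Finset ι) :
    (∀ i ∈ S, ∀ j ∈ S, i ≠ j → w i ≠ w j) → (∀ i ∈ S, ∀ k, 1 - w i * c k ≠ 0) →
    slice true (rowState t c (S.toList.map w)) =
      ∑ i ∈ S, ((1 - t) * (w i * c 0) / (1 - w i * c 0) * ∏ j ∈ S.erase i,
        ((w j - t * w i) / (w j - w i) * ((1 - t * (w j * c 0)) / (1 - w j * c 0)))) •
        rowState t (fun k => c k.succ) ((S.erase i).toList.map w) := by
  induction S using Finset.induction_on with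
  | empty =>
    intro _ _
    simp [rowState, slice_true_vacuum]
  | insert k S hk ih =>
    intro hw hwc
    have hw' : ∀ i ∈ S, ∀ j ∈ S, i ≠ j → w i ≠ w j := fun i hi j hj =>
      hw i (Finset.mem_insert_of_mem hi) j (Finset.mem_insert_of_mem hj)
    have hwc' : ∀ i ∈ S, ∀ k, 1 - w i * c k ≠ 0 := fun i hi =>
      hwc i (Finset.mem_insert_of_mem hi)
    have hkc := hwc k (Finset.mem_insert_self _ _)
    have hkw : ∀ i ∈ S, w k ≠ w i := fun i hi =>
      hw k (Finset.mem_insert_self _ _) i (Finset.mem_insert_of_mem hi) (by rintro rfl; exact hk hi)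
    rw [Finset.sum_insert hk, Finset.erase_insert hk, rowState_insert hk hwc,
      slice_true_rowOp_false, slice_false_rowState, ih hw' hwc', map_smul,
      rowOp_true_rowState S hw' hkw (fun k => hkc k.succ) fun i hi k => hwc' i hi k.succ,
      List.map_map, Finset.prod_map_toList]
    have e : ∀ i ∈ S, ((1 - t) * (w i * c 0) / (1 - w i * c 0) * ∏ j ∈ (insert k S).erase i,
        ((w j - t * w i) / (w j - w i) * ((1 - t * (w j * c 0)) / (1 - w j * c 0)))) •
        rowState t (fun k => c k.succ) (((insert k S).erase i).toList.map w) =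
        (t * ((1 - t) * (w i * c 0) / (1 - w i * c 0) * ∏ j ∈ S.erase i,
          ((w j - t * w i) / (w j - w i) * ((1 - t * (w j * c 0)) / (1 - w j * c 0)))) +
        (1 - t) * (w k * c 0) / (1 - w k * c 0) *
          ((∏ j ∈ S, (1 - t * (w j * c 0)) / (1 - w j * c 0)) * ((1 - t) * w i / (w k - w i) *
          ∏ j ∈ S.erase i, (w j - t * w i) / (w j - w i)))) •
        rowOp t (fun k => c k.succ) false (w k)
          (rowState t (fun k => c k.succ) ((S.erase i).toList.map w)) := by
      intro i hi
      have hki : k ≠ i := by rintro rfl; exact hk hi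
      have hk' : k ∉ S.erase i := fun h => hk (Finset.mem_of_mem_erase h)
      rw [Finset.erase_insert_of_ne hki, Finset.prod_insert hk', rowState_insert hk',
        ← Finset.mul_prod_erase S _ hi, Finset.prod_mul_distrib]
      · congr 1
        have h2 : w k - w i ≠ 0 := sub_ne_zero.2 (hkw i hi)
        have h3 : 1 - w k * c 0 ≠ 0 := hkc 0
        have h4 : 1 - w i * c 0 ≠ 0 := hwc' i hi 0
        have h3' : 1 - c 0 * w k ≠ 0 := by rwa [mul_comm]
        have h4' : 1 - c 0 * w i ≠ 0 := by rwa [mul_comm]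
        generalize (∏ j ∈ S.erase i, (w j - t * w i) / (w j - w i)) = P
        generalize (∏ j ∈ S.erase i, (1 - t * (w j * c 0)) / (1 - w j * c 0)) = Q
        field_simp
        ring
      · intro j hj l
        rw [Finset.mem_insert] at hj
        exact hwc j (Finset.mem_insert.2 (hj.imp_right Finset.mem_of_mem_erase)) _
    rw [Finset.sum_congr rfl e, Finset.prod_mul_distrib]
    simp only [map_sum, map_smul, smul_add, Finset.smul_sum, smul_smul, add_smul,
      Finset.sum_add_distrib, Function.comp_apply]
    rw [add_left_comm, mul_comm (∏ j ∈ S, (w j - t * w k) / (w j - w k))]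

/-- The component of a created state with particles on all vertical edges. -/
theorem rowState_apply_true : ∀ {n : ℕ} {c : Fin n → ℂ} (S : Finset ι),
    (∀ i ∈ S, ∀ j ∈ S, i ≠ j → w i ≠ w j) → (∀ i ∈ S, ∀ k, 1 - w i * c k ≠ 0) →
    rowState t c (S.toList.map w) (fun _ => true) =
      (∏ i ∈ S, w i) * (∏ k, c k) * domainWall t w (List.ofFn c).reverse S
  | 0, c, S, _, _ => by
      rcases S.eq_empty_or_nonempty with rfl | ⟨i, hi⟩
      · simp [rowState, vacuum, domainWall_nil]
        exact Subsingleton.elim _ _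
      · rw [List.ofFn_zero, List.reverse_nil, domainWall_nil, if_neg (Finset.ne_empty_of_mem hi),
          mul_zero]
        have hn : S.toList.map w ≠ [] := by
          simpa using Finset.ne_empty_of_mem hi
        obtain ⟨a, L, h⟩ := List.exists_cons_of_ne_nil hn
        rw [h, rowState_cons, rowOp_zero, if_neg (by simp), Pi.zero_apply]
  | n + 1, c, S, hw, hwc => by
      have e : (fun _ : Fin (n + 1) => true) = Fin.cons true fun _ => true := by
        funext k
        exact Fin.cases rfl (fun _ => rfl) k
      -- The first lattice column is the last entry of the reversed list, so the slice matches the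
      -- recursion in the last column parameter.
      rw [e, ← slice_apply true (rowState t c _), slice_true_rowState S hw hwc, List.ofFn_succ, List.reverse_cons,
        domainWall_append_singleton, Finset.sum_apply, Finset.mul_sum]
      refine Finset.sum_congr rfl fun i hi => ?_
      rw [Pi.smul_apply, smul_eq_mul, rowState_apply_true (S.erase i)
        (fun a ha b hb => hw a (Finset.mem_of_mem_erase ha) b (Finset.mem_of_mem_erase hb))
        fun a ha k => hwc a (Finset.mem_of_mem_erase ha) k.succ,
        ← Finset.mul_prod_erase S _ hi, Fin.prod_univ_succ]
      simp only [← mul_assoc]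
      ring

end RowStates

/-! ### Double rows with a U-turn as signed sums of single rows. -/

section DoubleRow

variable {n : ℕ} {t : ℂ} {c : Fin n → ℂ}

/-- The operator of the double row with parameters `x` and `x⁻¹`, joined by a U-turn. -/
def doubleRow (t : ℂ) (c : Fin n → ℂ) (x : ℂ) :
    ((Fin n → Bool) → ℂ) →ₗ[ℂ] ((Fin n → Bool) → ℂ) :=
  rowOp t c true x⁻¹ ∘ₗ rowOp t c false x - t • (rowOp t c false x⁻¹ ∘ₗ rowOp t c true x)

/-- The state created from the vacuum by double rows. -/
def doubleRowState (t : ℂ) (c : Fin n → ℂ) : ∀ {N : ℕ}, (Fin N → ℂ) → (Fin n → Bool) → ℂ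
  | 0, _ => vacuum
  | _ + 1, x => doubleRow t c (x (Fin.last _)) (doubleRowState t c fun k => x k.castSucc)

/-- Commuting one product and absorbing the term with `-t` gives both coefficients the factor x -
t/x. What remains is invariant under x ↦ 1/x; this makes the expansion a sum over signs. -/
theorem doubleRow_apply {x : ℂ} (hx : x ≠ x⁻¹) (hc : ∀ k, 1 - x * c k ≠ 0)
    (hc' : ∀ k, 1 - x⁻¹ * c k ≠ 0) (ψ : (Fin n → Bool) → ℂ) :
    doubleRow t c x ψ = ((x - t * x⁻¹) / (x - x⁻¹)) • rowOp t c false x (rowOp t c true x⁻¹ ψ) +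
      ((x - t * x⁻¹) / (x⁻¹ - x)) • rowOp t c false x⁻¹ (rowOp t c true x ψ) := by
  have h : x⁻¹ - x ≠ 0 := sub_ne_zero.2 hx.symm
  have e : (x - t * x⁻¹) / (x⁻¹ - x) = (1 - t) * x / (x⁻¹ - x) - t := by
    rw [eq_sub_iff_add_eq, div_add' _ _ _ h]
    congr 1
    ring
  rw [doubleRow, LinearMap.sub_apply, LinearMap.smul_apply, LinearMap.comp_apply,
    LinearMap.comp_apply, (rowOp_relations c hx.symm hc' hc ψ).2.2, e, sub_smul, add_sub_assoc]

theorem doubleRow_rowState {ι : Type*} [DecidableEq ι] {w : ι → ℂ} {x : ℂ} (S : Finset ι)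
    (hw : ∀ i ∈ S, ∀ j ∈ S, i ≠ j → w i ≠ w j) (hxw : ∀ i ∈ S, x ≠ w i ∧ x⁻¹ ≠ w i)
    (hx : x ≠ x⁻¹) (hc : ∀ k, 1 - x * c k ≠ 0) (hc' : ∀ k, 1 - x⁻¹ * c k ≠ 0)
    (hwc : ∀ i ∈ S, ∀ k, 1 - w i * c k ≠ 0) :
    doubleRow t c x (rowState t c (S.toList.map w)) =
      ((x - t * x⁻¹) / (x - x⁻¹) * ∏ j ∈ S, (w j - t * x⁻¹) / (w j - x⁻¹)) •
        rowOp t c false x (rowState t c (S.toList.map w)) +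
      ((x - t * x⁻¹) / (x⁻¹ - x) * ∏ j ∈ S, (w j - t * x) / (w j - x)) •
        rowOp t c false x⁻¹ (rowState t c (S.toList.map w)) +
      ∑ i ∈ S, ((1 - t) * (x - t * x⁻¹) * (w i / ((x⁻¹ - w i) * (x - w i))) *
          ∏ j ∈ S.erase i, (w j - t * w i) / (w j - w i)) •
        rowOp t c false x (rowOp t c false x⁻¹ (rowState t c ((S.erase i).toList.map w))) := by
  rw [doubleRow_apply hx hc hc', rowOp_true_rowState S hw (fun i hi => (hxw i hi).2) hc' hwc,
    rowOp_true_rowState S hw (fun i hi => (hxw i hi).1) hc hwc]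
  have e : ∀ i ∈ S, ((1 - t) * (x - t * x⁻¹) * (w i / ((x⁻¹ - w i) * (x - w i))) *
        ∏ j ∈ S.erase i, (w j - t * w i) / (w j - w i)) •
      rowOp t c false x (rowOp t c false x⁻¹ (rowState t c ((S.erase i).toList.map w))) =
      ((x - t * x⁻¹) / (x - x⁻¹) * ((1 - t) * w i / (x⁻¹ - w i) *
        ∏ j ∈ S.erase i, (w j - t * w i) / (w j - w i)) +
      (x - t * x⁻¹) / (x⁻¹ - x) * ((1 - t) * w i / (x - w i) *
        ∏ j ∈ S.erase i, (w j - t * w i) / (w j - w i))) •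
      rowOp t c false x (rowOp t c false x⁻¹ (rowState t c ((S.erase i).toList.map w))) := by
    intro i hi
    congr 1
    obtain ⟨z, hz⟩ : ∃ z, z = x⁻¹ := ⟨_, rfl⟩
    obtain ⟨h1, h2⟩ := hxw i hi
    rw [← hz] at hx h2 ⊢
    have h1 : x - w i ≠ 0 := sub_ne_zero.2 h1
    have h2 : z - w i ≠ 0 := sub_ne_zero.2 h2
    have h3 : x - z ≠ 0 := sub_ne_zero.2 hx
    rw [show z - x = -(x - z) by ring]
    field_simp
    ring
  rw [Finset.sum_congr rfl e]
  simp only [map_add, map_sum, map_smul, smul_add, Finset.smul_sum, smul_smul, add_smul,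
    Finset.sum_add_distrib, rowOp_false_comm hc' hc]
  abel

/-- The coefficients of the expansion of the state created by double rows. -/
def doubleRowCoeff {N : ℕ} (t : ℂ) (x : Fin N → ℂ) (e : Fin N → Bool) : ℂ :=
  (∏ i, (x i - t * (x i)⁻¹)) * bcFactor t (signFlip e x) * ∏ i, (signFlip e x i)⁻¹

variable {N : ℕ}

theorem doubleRowCoeff_succAbove (x : Fin (N + 1) → ℂ) (e : Fin (N + 1) → Bool)
    (i : Fin (N + 1)) : doubleRowCoeff t x e =
      (x i - t * (x i)⁻¹) / (signFlip e x i - (signFlip e x i)⁻¹) *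
      (∏ k, (1 - t * (signFlip e x i)⁻¹ * (signFlip e x (i.succAbove k))⁻¹) /
        (1 - (signFlip e x i)⁻¹ * (signFlip e x (i.succAbove k))⁻¹)) *
      doubleRowCoeff t (fun k => x (i.succAbove k)) fun k => e (i.succAbove k) := by
  rw [doubleRowCoeff, doubleRowCoeff, bcFactor_succAbove t _ i, Fin.prod_univ_succAbove _ i,
    Fin.prod_univ_succAbove (fun i => (signFlip e x i)⁻¹) i]
  have h : (signFlip e x i)⁻¹ * (1 / (1 - (signFlip e x i)⁻¹ ^ 2)) =
      1 / (signFlip e x i - (signFlip e x i)⁻¹) := by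
    generalize signFlip e x i = w
    rcases eq_or_ne w 0 with rfl | hw
    · simp
    · rw [inv_eq_one_div w, div_mul_div_comm, one_mul]
      congr 1
      field_simp
  change _ = _ * _ * (_ * bcFactor t (fun k => signFlip e x (i.succAbove k)) *
    ∏ k, (signFlip e x (i.succAbove k))⁻¹)
  rw [div_eq_mul_one_div (x i - t * (x i)⁻¹), ← h]
  ring

/-- After multiplication by the factors of an unwanted term, the sign at `i` enters only through w -
1/w, which is odd under inversion; all else depends on the trace of row `i`. -/
theorem doubleRowCoeff_mul_prod (x : Fin (N + 1) → ℂ) (h0 : ∀ i, x i ≠ 0)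
    (e : Fin (N + 1) → Bool) (i : Fin (N + 1)) :
    doubleRowCoeff t x e * ∏ j ∈ Finset.univ.erase i,
        (signFlip e x j - t * signFlip e x i) / (signFlip e x j - signFlip e x i) =
      (x i - t * (x i)⁻¹) / (signFlip e x i - (signFlip e x i)⁻¹) *
      (∏ k, (signFlip e x (i.succAbove k) + t ^ 2 * (signFlip e x (i.succAbove k))⁻¹ -
          t * (x i + (x i)⁻¹)) /
        (signFlip e x (i.succAbove k) + (signFlip e x (i.succAbove k))⁻¹ - (x i + (x i)⁻¹))) *
      doubleRowCoeff t (fun k => x (i.succAbove k)) fun k => e (i.succAbove k) := by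
  rw [doubleRowCoeff_succAbove x e i, univ_erase_eq_map, Finset.prod_map, mul_right_comm,
    mul_assoc (_ / _) (Finset.prod _ _) (Finset.prod _ _), ← Finset.prod_mul_distrib]
  congr 2
  refine Finset.prod_congr rfl fun k _ => ?_
  rw [← signFlip_trace e x i, ← exchange_factor_trace (signFlip_ne_zero h0 e _)
    (signFlip_ne_zero h0 e _), Fin.succAboveEmb_apply, mul_right_comm t,
    mul_comm (signFlip e x i)⁻¹]

/-- Flipping the sign at `i` leaves `A`, the state and the trace factors unchanged and negates the
odd factor 1/(w - 1/w), so the terms cancel in pairs. -/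
theorem sum_doubleRowCoeff_eq_zero {V : Type*} [AddCommGroup V] [Module ℂ V]
    (x : Fin N → ℂ) (h0 : ∀ i, x i ≠ 0) (i : Fin N) (A : ℂ → ℂ)
    (hA : A (x i)⁻¹ = A (x i)) (Ψ : List ℂ → V) :
    ∑ e, (doubleRowCoeff t x e * (A (signFlip e x i) * ∏ j ∈ Finset.univ.erase i,
        (signFlip e x j - t * signFlip e x i) / (signFlip e x j - signFlip e x i))) •
      Ψ ((Finset.univ.erase i).toList.map (signFlip e x)) = 0 := by
  cases N with
  | zero => exact i.elim0
  | succ N =>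
    refine Finset.sum_involution (fun e _ => Function.update e i (!e i)) (fun e _ => ?_)
      (fun e _ _ h => ?_) (fun _ _ => Finset.mem_univ _) fun e _ => ?_
    · have e1 : signFlip (Function.update e i (!e i)) x i = (signFlip e x i)⁻¹ := by
        cases h : e i <;> simp [signFlip, h]
      have e2 : ∀ j, j ≠ i → signFlip (Function.update e i (!e i)) x j = signFlip e x j :=
        fun j hj => by simp [signFlip, hj]
      have e3 : ∀ k, Function.update e i (!e i) (i.succAbove k) = e (i.succAbove k) := fun k => by
        simp
      have e4 : A (signFlip e x i)⁻¹ = A (signFlip e x i) := by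
        cases h : e i <;> simp [signFlip, h, hA]
      rw [List.map_congr_left (f := signFlip (Function.update e i (!e i)) x) (g := signFlip e x)
        fun j hj => e2 j (Finset.ne_of_mem_erase (Finset.mem_toList.1 hj)), ← add_smul,
        mul_left_comm, mul_left_comm (doubleRowCoeff t x (Function.update e i (!e i))),
        doubleRowCoeff_mul_prod x h0, doubleRowCoeff_mul_prod x h0, e1, e4, inv_inv]
      simp only [e2 _ (Fin.succAbove_ne i _), e3]
      rw [← neg_sub (signFlip e x i) (signFlip e x i)⁻¹, div_neg]
      convert zero_smul ℂ _
      ring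
    · have := congrFun h i
      simp at this
    · simp

theorem toList_map_perm {ι κ : Type*} (f : ι ↪ κ) (S : Finset ι) :
    (S.map f).toList.Perm (S.toList.map f) :=
  Multiset.coe_eq_coe.1 (by rw [← Multiset.map_coe, Finset.coe_toList, Finset.coe_toList,
    Finset.map_val])

theorem rowState_univ_succAbove {w : Fin (N + 1) → ℂ} (hw : ∀ i k, 1 - w i * c k ≠ 0)
    (i : Fin (N + 1)) : rowState t c (Finset.univ.toList.map w) =
      rowOp t c false (w i) (rowState t c (Finset.univ.toList.map fun k => w (i.succAbove k))) := by
  rw [← Finset.insert_erase (Finset.mem_univ i),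
    rowState_insert (Finset.notMem_erase i _) fun j _ => hw j, univ_erase_eq_map]
  congr 1
  have h := (toList_map_perm (Fin.succAboveEmb i) Finset.univ).map w
  rw [List.map_map] at h
  refine rowState_perm h fun z hz => ?_
  obtain ⟨j, _, rfl⟩ := List.mem_map.1 hz
  exact hw j

/-- Induction on the number of double rows, the bottom one being applied last. Its two wanted terms
are the two signs of the new parameter, and its unwanted terms vanish after summation over the
earlier signs. -/
theorem doubleRowState_eq : ∀ {N : ℕ} (x : Fin N → ℂ), (∀ i, x i ≠ 0) → (∀ i, x i ^ 2 ≠ 1) →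
    (∀ i j, i < j → x i ≠ x j ∧ x i * x j ≠ 1) →
    (∀ i k, 1 - x i * c k ≠ 0 ∧ 1 - (x i)⁻¹ * c k ≠ 0) →
    doubleRowState t c x = ∑ e, doubleRowCoeff t x e •
      rowState t c (Finset.univ.toList.map (signFlip e x))
  | 0, x, _, _, _, _ => by
      simp [doubleRowState, doubleRowCoeff, bcFactor, rowState]
  | N + 1, x, h0, hsq, hxx, hc => by
      have hs : ∀ e i k, 1 - signFlip e x i * c k ≠ 0 := fun e i k => by
        rw [signFlip]
        split_ifs
        exacts [(hc i k).2, (hc i k).1]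
      have hinv : x (Fin.last N) ≠ (x (Fin.last N))⁻¹ := fun h => hsq (Fin.last N) (by
        rw [sq]
        nth_rw 2 [h]
        exact mul_inv_cancel₀ (h0 _))
      have hlast : ∀ (e : Fin N → Bool) i, x (Fin.last N) ≠ signFlip e (fun k => x k.castSucc) i ∧
          (x (Fin.last N))⁻¹ ≠ signFlip e (fun k => x k.castSucc) i := fun e i => by
        obtain ⟨h1, h2⟩ := hxx _ _ (Fin.castSucc_lt_last i)
        have h3 : x (Fin.last N) ≠ (x i.castSucc)⁻¹ := fun h => h2 (by
          rw [h, mul_inv_cancel₀ (h0 _)])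
        rw [signFlip]
        split_ifs
        · exact ⟨h3, fun h => h1 (inv_injective h).symm⟩
        · exact ⟨h1.symm, fun h => h3 (by rw [← h, inv_inv])⟩
      have hxx' : ∀ i j : Fin N, i < j → x i.castSucc ≠ x j.castSucc ∧
          x i.castSucc * x j.castSucc ≠ 1 := fun i j h => hxx _ _ h
      rw [doubleRowState, doubleRowState_eq (fun k => x k.castSucc) (fun _ => h0 _)
        (fun _ => hsq _) hxx' fun _ k => hc _ k, map_sum]
      have step := fun e : Fin N → Bool => doubleRow_rowState (t := t) (c := c)
        (w := signFlip e fun k => x k.castSucc)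
        Finset.univ (fun i _ j _ h => (signFlip_injective (fun _ => h0 _) hxx' e).ne h)
        (fun i _ => hlast e i) hinv (fun k => (hc _ k).1) (fun k => (hc _ k).2)
        fun i _ k => by
          rw [signFlip]
          split_ifs
          exacts [(hc _ k).2, (hc _ k).1]
      simp only [map_smul, step, smul_add, Finset.smul_sum, smul_smul, Finset.sum_add_distrib]
      rw [Finset.sum_comm (s := Finset.univ) (t := Finset.univ) (f := fun e i => _ • _)]
      have hz : ∀ i : Fin N, ∑ e : Fin N → Bool, (doubleRowCoeff t (fun k => x k.castSucc) e *
          ((1 - t) * (x (Fin.last N) - t * (x (Fin.last N))⁻¹) *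
            (signFlip e (fun k => x k.castSucc) i /
              (((x (Fin.last N))⁻¹ - signFlip e (fun k => x k.castSucc) i) *
                (x (Fin.last N) - signFlip e (fun k => x k.castSucc) i))) *
            ∏ j ∈ Finset.univ.erase i,
              (signFlip e (fun k => x k.castSucc) j - t * signFlip e (fun k => x k.castSucc) i) /
              (signFlip e (fun k => x k.castSucc) j - signFlip e (fun k => x k.castSucc) i))) •
          rowOp t c false (x (Fin.last N)) (rowOp t c false (x (Fin.last N))⁻¹
            (rowState t c ((Finset.univ.erase i).toList.map
              (signFlip e fun k => x k.castSucc)))) = 0 := fun i => by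
        refine sum_doubleRowCoeff_eq_zero (fun k => x k.castSucc) (fun _ => h0 _) i (fun w =>
          (1 - t) * (x (Fin.last N) - t * (x (Fin.last N))⁻¹) *
            (w / (((x (Fin.last N))⁻¹ - w) * (x (Fin.last N) - w)))) ?_ (fun L =>
          rowOp t c false (x (Fin.last N)) (rowOp t c false (x (Fin.last N))⁻¹
            (rowState t c L)))
        have a := h0 (Fin.last N)
        have b := h0 i.castSucc
        congr 1
        -- Dividing by `w` exhibits the coefficient of an unwanted term as a function of the trace,
        -- hence invariant under inversion as the cancellation requires.
        have key : ∀ w, w ≠ 0 → w / (((x (Fin.last N))⁻¹ - w) * (x (Fin.last N) - w)) =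
            1 / (w + w⁻¹ - (x (Fin.last N) + (x (Fin.last N))⁻¹)) := fun w hw => by
          rw [show ((x (Fin.last N))⁻¹ - w) * (x (Fin.last N) - w) =
            w * (w + w⁻¹ - (x (Fin.last N) + (x (Fin.last N))⁻¹)) by field_simp; ring,
            div_mul_eq_div_div, div_self hw]
        rw [key _ (inv_ne_zero b), key _ b, inv_inv, add_comm (x i.castSucc)⁻¹]
      rw [Finset.sum_eq_zero fun i _ => hz i, add_zero,
        ← (Fin.insertNthEquiv (fun _ => Bool) (Fin.last N)).sum_comp, Fintype.sum_prod_type,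
        Fintype.sum_bool, add_comm]
      have hK : ∀ (b : Bool) (e : Fin N → Bool), doubleRowCoeff t x
          (Fin.insertNthEquiv (fun _ => Bool) (Fin.last N) (b, e)) •
          rowState t c (Finset.univ.toList.map
            (signFlip (Fin.insertNthEquiv (fun _ => Bool) (Fin.last N) (b, e)) x)) =
          (doubleRowCoeff t (fun k => x k.castSucc) e *
            ((x (Fin.last N) - t * (x (Fin.last N))⁻¹) /
              ((if b then (x (Fin.last N))⁻¹ else x (Fin.last N)) -
                (if b then (x (Fin.last N))⁻¹ else x (Fin.last N))⁻¹) *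
            ∏ k, (signFlip e (fun k => x k.castSucc) k -
                t * (if b then (x (Fin.last N))⁻¹ else x (Fin.last N))⁻¹) /
              (signFlip e (fun k => x k.castSucc) k -
                (if b then (x (Fin.last N))⁻¹ else x (Fin.last N))⁻¹))) •
          rowOp t c false (if b then (x (Fin.last N))⁻¹ else x (Fin.last N))
            (rowState t c (Finset.univ.toList.map (signFlip e fun k => x k.castSucc))) := by
        intro b e
        have e1 : signFlip (Fin.insertNthEquiv (fun _ => Bool) (Fin.last N) (b, e)) x
            (Fin.last N) = if b then (x (Fin.last N))⁻¹ else x (Fin.last N) := by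
          simp [signFlip]
        have e2 : ∀ k, signFlip (Fin.insertNthEquiv (fun _ => Bool) (Fin.last N) (b, e)) x
            k.castSucc = signFlip e (fun k => x k.castSucc) k := by
          intro k
          rw [← Fin.succAbove_last]
          simp [signFlip]
        have e3 : ∀ k, Fin.insertNthEquiv (fun _ => Bool) (Fin.last N) (b, e)
            k.castSucc = e k := by
          intro k
          rw [← Fin.succAbove_last]
          simp only [Fin.insertNthEquiv_apply, Fin.insertNth_apply_succAbove]
        have e4 : ∀ v w : ℂ, v ≠ 0 →
            (1 - t * w⁻¹ * v⁻¹) / (1 - w⁻¹ * v⁻¹) = (v - t * w⁻¹) / (v - w⁻¹) := by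
          intro v w hv
          rw [← mul_div_mul_left _ _ hv]
          congr 1 <;> field_simp
        rw [rowState_univ_succAbove (hs _) (Fin.last N), doubleRowCoeff_succAbove _ _ (Fin.last N)]
        simp only [Fin.succAbove_last, e1, e2, e3]
        rw [Finset.prod_congr rfl fun k _ => e4 _ _ (signFlip_ne_zero (fun _ => h0 _) e k),
          mul_comm, ← mul_assoc]
      simp only [hK]
      simp

end DoubleRow

/-! ### The lattice sum as a matrix element of double row operators. -/

section PartitionFunction

variable {n N : ℕ} {t : ℂ}

theorem upperRow_castSucc (i : Fin N) : upperRow i.castSucc = (upperRow i).castSucc.castSucc := rfl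

theorem lowerRow_castSucc (i : Fin N) : lowerRow i.castSucc = (lowerRow i).castSucc.castSucc := rfl

theorem upperRow_last : upperRow (Fin.last N) = (Fin.last (2 * N)).castSucc := rfl

theorem lowerRow_last : lowerRow (Fin.last N) = Fin.last (2 * N + 1) := rfl

theorem sum_two_mul_succ {A : Type*} [Fintype A] (F : (Fin (2 * (N + 1)) → A) → ℂ) :
    ∑ h, F h = ∑ p, ∑ q, ∑ h : Fin (2 * N) → A,
      F (Fin.snoc (α := fun _ => A) (Fin.snoc (α := fun _ => A) h p) q :
        Fin (2 * N + 1 + 1) → A) := by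
  change ∑ h : Fin (2 * N + 1 + 1) → A, F h = _
  rw [← (Fin.snocEquiv fun _ => A).sum_comp, Fintype.sum_prod_type, Finset.sum_comm,
    ← (Fin.snocEquiv fun _ => A).sum_comp, Fintype.sum_prod_type]
  refine Finset.sum_congr rfl fun p _ => ?_
  rw [Finset.sum_comm]
  rfl

theorem sum_prod_rows {A : Type*} [Fintype A] : ∀ {N : ℕ} (G : Fin N → A → A → ℂ),
    ∑ h : Fin (2 * N) → A, ∏ i, G i (h (upperRow i)) (h (lowerRow i)) =
      ∏ i, ∑ p, ∑ q, G i p q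
  | 0, G => by
      change ∑ h : Fin 0 → A, _ = _
      simp
  | N + 1, G => by
      rw [sum_two_mul_succ, Fin.prod_univ_castSucc, ← sum_prod_rows, Finset.mul_sum]
      refine Finset.sum_congr rfl fun p _ => ?_
      rw [Finset.mul_sum]
      refine Finset.sum_congr rfl fun q _ => ?_
      rw [Finset.sum_mul]
      refine Finset.sum_congr rfl fun h _ => ?_
      rw [Fin.prod_univ_castSucc]
      simp only [upperRow_castSucc, lowerRow_castSucc, upperRow_last, lowerRow_last,
        Fin.snoc_castSucc, Fin.snoc_last]

/-- The weight of a double row with top edges `u`, middle edges `m` and bottom edges `b`. -/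
def doubleRowWeight (t : ℂ) (c : Fin n → ℂ) (x : ℂ) (u m b : Fin n → Bool) : ℂ :=
  ∑ p : Fin (n + 1) → Bool, ∑ q : Fin (n + 1) → Bool,
    if p (Fin.last n) = true ∧ q (Fin.last n) = true then
      uTurnWeight t (p 0) (q 0) * ∏ k,
        (sixVertexWeight t (x * c k) (p k.castSucc) (p k.succ) (m k) (u k) *
          sixVertexWeight t (x⁻¹ * c k) (q k.castSucc) (q k.succ) (b k) (m k)) else 0

theorem doubleRowWeight_eq (c : Fin n → ℂ) (x : ℂ) (u m b : Fin n → Bool) :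
    doubleRowWeight t c x u m b =
      rowWeight t x c false u m * rowWeight t x⁻¹ c true m b -
        t * (rowWeight t x c true u m * rowWeight t x⁻¹ c false m b) := by
  simp only [rowWeight]
  rw [Finset.sum_mul_sum, Finset.sum_mul_sum, doubleRowWeight, Finset.mul_sum,
    ← Finset.sum_sub_distrib]
  refine Finset.sum_congr rfl fun p _ => ?_
  rw [Finset.mul_sum, ← Finset.sum_sub_distrib]
  refine Finset.sum_congr rfl fun q _ => ?_
  rw [Finset.prod_mul_distrib]
  cases p 0 <;> cases q 0 <;> cases p (Fin.last n) <;> cases q (Fin.last n) <;>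
    simp [uTurnWeight]

theorem doubleRow_apply_eq_sum (c : Fin n → ℂ) (x : ℂ) (ψ : (Fin n → Bool) → ℂ)
    (b : Fin n → Bool) :
    doubleRow t c x ψ b = ∑ m, ∑ u, doubleRowWeight t c x u m b * ψ u := by
  simp only [doubleRow, LinearMap.sub_apply, LinearMap.smul_apply, LinearMap.comp_apply,
    Pi.sub_apply, Pi.smul_apply, rowOp_apply, smul_eq_mul, Finset.mul_sum, doubleRowWeight_eq,
    ← Finset.sum_sub_distrib]
  refine Finset.sum_congr rfl fun m _ => Finset.sum_congr rfl fun u _ => ?_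
  ring

theorem doubleRowState_apply (c : Fin n → ℂ) : ∀ {N : ℕ} (x : Fin N → ℂ) (b : Fin n → Bool),
    doubleRowState t c x b = ∑ v : Fin (2 * N + 1) → Fin n → Bool,
      if v 0 = (fun _ => false) ∧ v (Fin.last (2 * N)) = b then
        ∏ i, doubleRowWeight t c (x i) (v (upperRow i).castSucc) (v (upperRow i).succ)
          (v (lowerRow i).succ) else 0
  | 0, x, b => by
      rw [← (Equiv.funUnique (Fin 1) (Fin n → Bool)).symm.sum_comp,
        Finset.sum_eq_single_of_mem b (Finset.mem_univ b)]
      · simp [doubleRowState, vacuum]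
      · intro v _ hv
        exact if_neg fun h => hv h.2
  | N + 1, x, b => by
      have e : ∀ F : (Fin (2 * (N + 1) + 1) → Fin n → Bool) → ℂ, ∑ v, F v =
          ∑ b', ∑ m, ∑ v : Fin (2 * N + 1) → Fin n → Bool,
            F (Fin.snoc (α := fun _ => Fin n → Bool)
              (Fin.snoc (α := fun _ => Fin n → Bool) v m) b' :
              Fin (2 * N + 1 + 1 + 1) → Fin n → Bool) := by
        intro F
        change ∑ v : Fin (2 * N + 1 + 1 + 1) → Fin n → Bool, F v = _
        rw [← (Fin.snocEquiv fun _ => Fin n → Bool).sum_comp, Fintype.sum_prod_type]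
        refine Finset.sum_congr rfl fun b' _ => ?_
        rw [← (Fin.snocEquiv fun _ => Fin n → Bool).sum_comp, Fintype.sum_prod_type]
        rfl
      rw [doubleRowState, doubleRow_apply_eq_sum, e]
      symm
      rw [Finset.sum_eq_single_of_mem b (Finset.mem_univ b)]
      · symm
        refine Finset.sum_congr rfl fun m _ => ?_
        simp only [doubleRowState_apply c, Finset.mul_sum]
        rw [Finset.sum_comm]
        refine Finset.sum_congr rfl fun v _ => ?_
        rw [Finset.sum_eq_single_of_mem (v (Fin.last _)) (Finset.mem_univ _)]
        · have h0 : (0 : Fin (2 * N + 1 + 1 + 1)) =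
            (0 : Fin (2 * N + 1)).castSucc.castSucc := rfl
          have hl : Fin.last (2 * (N + 1)) = Fin.last (2 * N + 1 + 1) := rfl
          have hu : ∀ i : Fin N, (upperRow i.castSucc).castSucc =
            (upperRow i).castSucc.castSucc.castSucc := fun _ => rfl
          have hm : ∀ i : Fin N, (upperRow i.castSucc).succ =
            (upperRow i).succ.castSucc.castSucc := fun _ => rfl
          have hb : ∀ i : Fin N, (lowerRow i.castSucc).succ =
            (lowerRow i).succ.castSucc.castSucc := fun _ => rfl
          have hu' : (upperRow (Fin.last N)).castSucc =
            (Fin.last (2 * N)).castSucc.castSucc := rfl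
          have hm' : (upperRow (Fin.last N)).succ = (Fin.last (2 * N + 1)).castSucc := rfl
          have hb' : (lowerRow (Fin.last N)).succ = Fin.last (2 * N + 1 + 1) := rfl
          rw [Fin.prod_univ_castSucc]
          simp only [hu, hm, hb, hu', hm', hb']
          erw [h0, hl]
          simp only [Fin.snoc_castSucc, Fin.snoc_last, and_true, mul_ite, mul_zero]
          refine if_congr Iff.rfl ?_ rfl
          rw [mul_comm]
        · intro u _ hu
          rw [if_neg fun h => hu h.2.symm, mul_zero]
      · intro b' _ hb
        refine Finset.sum_eq_zero fun m _ => Finset.sum_eq_zero fun v _ => if_neg fun h => hb ?_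
        rw [← h.2]
        exact (Fin.snoc_last (α := fun _ => Fin n → Bool) _ _).symm

/-- For fixed vertical edges the sum over horizontal edges factors into double rows. The vertical
sums then compose the double row operators, starting from the vacuum at the top. -/
theorem uTurnPartitionFunction_eq (x y : Fin n → ℂ) :
    uTurnPartitionFunction t x y =
      doubleRowState t (fun k => y k.rev) x fun _ => true := by
  rw [doubleRowState_apply, uTurnPartitionFunction, Finset.sum_comm]
  refine Finset.sum_congr rfl fun v _ => ?_
  simp only [doubleRowWeight]
  rw [← sum_prod_rows]
  by_cases hv : v 0 = (fun _ => false) ∧ v (Fin.last (2 * n)) = fun _ => true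
  · rw [if_pos hv]
    refine Finset.sum_congr rfl fun h _ => ?_
    by_cases hh : ∀ r, h r (Fin.last n) = true
    · rw [if_pos ⟨congrFun hv.1, congrFun hv.2, hh⟩]
      refine Finset.prod_congr rfl fun i _ => ?_
      rw [if_pos ⟨hh _, hh _⟩]
      rfl
    · rw [if_neg fun h' => hh h'.2.2]
      push Not at hh
      obtain ⟨r, hr⟩ := hh
      symm
      -- The right boundary condition is imposed on each double row separately, so a violation in
      -- row `r` kills the factor of double row `r / 2`.
      refine Finset.prod_eq_zero (i := (⟨r / 2, by omega⟩ : Fin n)) (Finset.mem_univ _)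
        (if_neg fun h' => hr ?_)
      rcases Nat.mod_two_eq_zero_or_one r with h2 | h2
      · convert h'.1
        refine Fin.ext ?_
        change r.val = 2 * (r.val / 2)
        omega
      · convert h'.2
        refine Fin.ext ?_
        change r.val = 2 * (r.val / 2) + 1
        omega
  · rw [if_neg hv]
    exact Finset.sum_eq_zero fun h _ => if_neg fun h' => hv ⟨funext h'.1, funext h'.2.1⟩

end PartitionFunction

/-! ### Comparison of normalizations. -/

section Normalization

variable {n : ℕ} {t : ℂ} {x y : Fin n → ℂ}

theorem uTurnPartitionFunction_eq_signedDomainWall (h0 : ∀ i, x i ≠ 0) (hsq : ∀ i, x i ^ 2 ≠ 1)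
    (hxx : ∀ i j, i < j → x i ≠ x j ∧ x i * x j ≠ 1)
    (hxy : ∀ i j, 1 - x i * y j ≠ 0 ∧ 1 - (x i)⁻¹ * y j ≠ 0) :
    uTurnPartitionFunction t x y =
      (∏ i, (x i - t * (x i)⁻¹) * y i) * signedDomainWall t x (List.ofFn y) := by
  rw [uTurnPartitionFunction_eq, doubleRowState_eq x h0 hsq hxx fun i k => hxy i k.rev,
    Finset.sum_apply, signedDomainWall, Finset.mul_sum]
  refine Finset.sum_congr rfl fun e _ => ?_
  have hr : (List.ofFn fun k : Fin n => y k.rev).reverse = List.ofFn y := by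
    refine List.ext_getElem (by simp) fun k h1 h2 => ?_
    rw [List.getElem_reverse, List.getElem_ofFn, List.getElem_ofFn]
    congr 1
    ext
    simp at h2
    simp
    omega
  have hy : ∏ k : Fin n, y k.rev = ∏ k, y k := Equiv.prod_comp Fin.revPerm y
  -- The inverse parameters in `doubleRowCoeff` cancel the row parameters produced by
  -- `rowState_apply_true`, so the overall prefactor is independent of the signs.
  have hs : (∏ i, (signFlip e x i)⁻¹) * ∏ i, signFlip e x i = 1 := by
    rw [← Finset.prod_mul_distrib]
    exact Finset.prod_eq_one fun i _ => inv_mul_cancel₀ (signFlip_ne_zero h0 e i)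
  rw [Pi.smul_apply, smul_eq_mul, rowState_apply_true Finset.univ
    (fun i _ j _ h => (signFlip_injective h0 hxx e).ne h) fun i _ k => ?_, hr, hy,
    doubleRowCoeff, Finset.prod_mul_distrib]
  · linear_combination ((∏ i, (x i - t * (x i)⁻¹)) * bcFactor t (signFlip e x) * (∏ i, y i) *
      domainWall t (signFlip e x) (List.ofFn y) Finset.univ) * hs
  · rw [signFlip]
    split_ifs
    exacts [(hxy i _).2, (hxy i _).1]

end Normalization

end ReflCauchy

end

theorem mainTheorem3 (n : ℕ) (t : ℂ) (x y : Fin n → ℂ)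
    (hx0 : ∀ i, x i ≠ 0)
    (hx1 : ∀ i, x i ^ 2 ≠ 1)
    (hxx : ∀ i j, i < j → x i ≠ x j ∧ x i * x j ≠ 1)
    (hyy : ∀ i j, i < j → y i ≠ y j ∧ t * y i * y j ≠ 1)
    (hxy : ∀ i j, ‖x i * y j‖ < 1 ∧ ‖(x i)⁻¹ * y j‖ < 1)
    (htxy : ∀ i j, t * x i * y j ≠ 1 ∧ t * (x i)⁻¹ * y j ≠ 1) :
    HasSum
      (fun lam : ReflCauchy.Part n =>
        (∏ i ∈ Finset.Icc 1 (ReflCauchy.mult lam.1 0), (1 - t ^ i)) *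
          ReflCauchy.bFactor t lam.1 *
          ReflCauchy.hallLittlewoodK t lam.1 x *
          ReflCauchy.hallLittlewoodP t lam.1 y)
      (ReflCauchy.reflectingDet t x y) ∧
    ReflCauchy.uTurnPartitionFunction t x y =
      (∏ i, (x i - t * (x i)⁻¹) * y i) * ReflCauchy.reflectingDet t x y := by
  have hne : ∀ z : ℂ, ‖z‖ < 1 → 1 - z ≠ 0 := fun z hz h => by
    rw [← sub_eq_zero.1 h, norm_one] at hz
    exact lt_irrefl _ hz
  have hxy' : ∀ i j, 1 - x i * y j ≠ 0 ∧ 1 - (x i)⁻¹ * y j ≠ 0 := fun i j =>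
    ⟨hne _ (hxy i j).1, hne _ (hxy i j).2⟩
  have hyp : ∀ i j, i ≠ j → y i ≠ y j ∧ t * y i * y j ≠ 1 := fun i j hij => by
    rcases lt_or_gt_of_ne hij with h | h
    · exact hyy i j h
    · exact ⟨(hyy j i h).1.symm, by rw [mul_right_comm]; exact (hyy j i h).2⟩
  have hxp : ∀ i j, i ≠ j → x i ≠ x j ∧ x i * x j ≠ 1 := fun i j hij => by
    rcases lt_or_gt_of_ne hij with h | h
    · exact hxx i j h
    · exact ⟨(hxx j i h).1.symm, by rw [mul_comm]; exact (hxx j i h).2⟩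
  have hyi : Function.Injective y := fun i j h => by
    by_contra hij
    exact (hyp i j hij).1 h
  have hdet := ReflCauchy.reflectingDet_eq_signedDomainWall (t := t) (x := x) (y := y)
    ⟨hx0, hx1, hxp, hyp, hxy', fun i j => ⟨sub_ne_zero.2 (htxy i j).1.symm,
      sub_ne_zero.2 (htxy i j).2.symm⟩⟩
  rw [hdet]
  exact ⟨ReflCauchy.hasSum_hallLittlewoodK hx0 hxx hyi hxy,
    ReflCauchy.uTurnPartitionFunction_eq_signedDomainWall hx0 hx1 hxx hxy'⟩
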